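/- **Setting.** Let $d\ge 2$. Let $D\subset\mathbb R^d$ be a bounded polyhedral domain with a conforming finite simplicial mesh $\mathcal T$ ($D$ is the interior of the union of the closed elements). Let $\mathcal S$ be the set of interior faces, $h_T$ and $h_F$ the diameters of the element $T$ and the face $F$, and assume that $\mathcal T$ is shape regular with constant $\kappa$: every $T$ contains a ball of some radius $r>0$ with $h_T\le\kappa r$. Let $\mathcal X=H^1_0(D)$ with $\|u\|_{\mathcal X}=\|\nabla u\|_{L^2(D)}$, let $X_p(\mathcal T)\subset\mathcal X$ be the space of functions in $\mathcal X$ that are polynomials of degree at most $p$ on every element ($p\ge1$), and let $f\in L^2(D)$. Let $b_\ell\in L^\infty(D)$, $\alpha_\ell=\|b_\ell\|_{L^\infty(D)}$ with $\sum_\ell\alpha_\ell<\infty$, $a(x,y)=\exp\bigl(\sum_\ell b_\ell(x)y_\ell\bigr)$, $0<\vartheta<1$, $\rho>0$, $\sigma_m=e^{\vartheta\rho\alpha_m}$. On the parameter set $\Gamma=\{y\in\mathbb R^{\mathbb N}:\sum_\ell\alpha_\ell|y_\ell|<\infty\}$, which has full measure, let $\gamma=\bigotimes_m N(0,1)$,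 $\gamma_{\vartheta\rho}=\bigotimes_m N(0,\sigma_m^2)$ and $\zeta_{\vartheta\rho}(y)=\prod_m\sigma_m^{-1}\exp\bigl(-\tfrac12(\sigma_m^{-2}-1)y_m^2\bigr)$. Let $H_\mu(y)=\prod_m H_{\mu_m}(y_m/\sigma_m)$ be the scaled tensor product Hermite polynomials, where $H_n$ is the $n$-th Hermite polynomial normalized in $L^2(N(0,1))$. Let $\mathcal V_{\vartheta\rho}$ be the space of measurable $v:\Gamma\to\mathcal X$ with $\int_\Gamma\int_D a\,|\nabla v|^2\,dx\,d\gamma_{\vartheta\rho}<\infty$. For such $v$ let $v_\mu=\int_\Gamma v\,H_\mu\,d\gamma_{\vartheta\rho}\in\mathcal X$. Let $\Lambda=\{\mu:\mu_m<d_m\ (m\le M),\ \mu_m=0\ (m>M)\}$ with $d_m\ge1$, and let $\Delta=\{\nu:\nu_\ell<q_\ell\ (\ell\le L),\ \nu_\ell=0\ (\ell>L)\}$. Let $\mathcal V_N=\{\sum_{\mu\in\Lambda}w_\mu H_\mu: w_\mu\in X_p(\mathcal T)\}$, and let $a_{\Delta,s}(x,y)=\sum_{\nu\in\Delta}a_\nu(x)H_\nu(y)$,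 where every $a_\nu$ is, on each element, the restriction of a $C^1$ function on $\mathbb R^d$. For $w_N=\sum_{\mu\in\Lambda}w_\mu H_\mu\in\mathcal V_N$ put $$\mathrm{res}(x,\eta)=\sum_{\mu\in\Lambda}\sum_{\nu\in\Delta}\kappa_{\mu\nu\eta}\,a_\nu(x)\nabla w_\mu(x),\qquad \kappa_{\mu\nu\eta}=\prod_m\int_{\mathbb R} H_{\mu_m}H_{\nu_m}H_{\eta_m}\,dN(0,1),$$ which is the $\eta$-th Hermite coefficient of $a_{\Delta,s}\nabla w_N$. The active residual is $\mathcal R_{+,\Lambda}(w_N)=f+\sum_{\eta\in\Lambda}\operatorname{div}\mathrm{res}(\cdot,\eta)H_\eta$, with the pairing $$\langle\mathcal R_{+,\Lambda}(w_N),u\rangle_{\vartheta\rho}=\int_\Gamma\int_D\Bigl(f\,u-\sum_{\eta\in\Lambda}H_\eta\,\mathrm{res}(\cdot,\eta)\cdot\nabla u\Bigr)dx\,d\gamma_{\vartheta\rho}.$$ On an element $T$, $\mathcal R_{+,\Lambda}(w_N)$ denotes the function obtained by taking the divergence elementwise. On $F\in\mathcal S$ with adjacent elements $T_1,T_2$ and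 outer unit normals $n_1,n_2$ its jump is $[\![\mathcal R_{+,\Lambda}(w_N)]\!]=\sum_{\eta\in\Lambda}\bigl(\mathrm{res}|_{T_1}(\cdot,\eta)\cdot n_1+\mathrm{res}|_{T_2}(\cdot,\eta)\cdot n_2\bigr)H_\eta$. The deterministic error estimator is $$\mathrm{est}_{\det}(w_N)=\Bigl(\sum_{T\in\mathcal T}h_T^2\|\mathcal R_{+,\Lambda}(w_N)\zeta_{\vartheta\rho}\|^2_{L^2(\Gamma,\gamma;L^2(T))}+\sum_{F\in\mathcal S}h_F\|[\![\mathcal R_{+,\Lambda}(w_N)]\!]\zeta_{\vartheta\rho}\|^2_{L^2(\Gamma,\gamma;L^2(F))}\Bigr)^{1/2}\in[0,\infty].$$ The Clément interpolant of $u\in\mathcal X$ is $Iu=\sum_z\bigl(|\omega_z|^{-1}\int_{\omega_z}u\,dx\bigr)\lambda_z$, where the sum is over the mesh vertices $z\in D$, $\lambda_z$ is the piecewise affine nodal basis function of $z$, and $\omega_z$ is the union of the elements with vertex $z$. The tensor Clément interpolant is $\mathcal Iv=\sum_{\mu\in\Lambda}(Iv_\mu)H_\mu$. **Proposition (deterministic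 error estimation).** There is a constant $c_{\det}>0$ that depends only on $d$ and $\kappa$ such that, for all data as above, all $v\in\mathcal V_{\vartheta\rho}$ and all $w_N\in\mathcal V_N$, the outer integrand (over $\Gamma$) of the pairing of $\mathcal R_{+,\Lambda}(w_N)$ with $(\mathrm{id}-\mathcal I)v$ is $\gamma_{\vartheta\rho}$-integrable and $$\bigl|\langle\mathcal R_{+,\Lambda}(w_N),(\mathrm{id}-\mathcal I)v\rangle_{\vartheta\rho}\bigr|\le c_{\det}\,\mathrm{est}_{\det}(w_N)\,\|v\|_{L^2(\Gamma,\gamma;\mathcal X)}.$$ Here $0\cdot\infty=0$ on the right-hand side. -/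

import Mathlib

open MeasureTheory ProbabilityTheory Set Filter
open scoped ENNReal NNReal ContDiff

noncomputable section

namespace SGFEM

/-- The physical space `ℝ^d` with its Euclidean structure. -/
abbrev E (d : ℕ) := EuclideanSpace ℝ (Fin d)

/-! ### The space `H¹₀(D)` -/

/-- The space `L²(D) × L²(D; ℝ^d)`, in which `H¹(D)` embeds by `u ↦ (u, ∇u)`. -/
abbrev L2Pair {d : ℕ} (D : Set (E d)) :=
  Lp ℝ 2 (volume.restrict D) × Lp (E d) 2 (volume.restrict D)

/-- The pairs `(φ, ∇φ)` of smooth functions `φ` with compact support in `D`. -/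
def testPairs {d : ℕ} (D : Set (E d)) : Set (L2Pair D) :=
  {w | ∃ φ : E d → ℝ, ContDiff ℝ ∞ φ ∧ HasCompactSupport φ ∧ tsupport φ ⊆ D ∧
    w.1 =ᵐ[volume.restrict D] φ ∧ w.2 =ᵐ[volume.restrict D] gradient φ}

/-- `X = H¹₀(D)`, the closure of the smooth compactly supported functions in `H¹(D)`; an element
is a function together with its weak gradient. -/
def H10 {d : ℕ} (D : Set (E d)) : Submodule ℝ (L2Pair D) :=
  (Submodule.span ℝ (testPairs D)).topologicalClosure

instance {d : ℕ} (D : Set (E d)) : CompleteSpace (H10 D) :=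
  (Submodule.isClosed_topologicalClosure _).completeSpace_coe

/-- The underlying `L²` function of an element of `H¹₀(D)`. -/
def val {d : ℕ} {D : Set (E d)} (u : H10 D) : Lp ℝ 2 (volume.restrict D) := u.1.1

/-- The weak gradient of an element of `H¹₀(D)`. -/
def grad {d : ℕ} {D : Set (E d)} (u : H10 D) : Lp (E d) 2 (volume.restrict D) := u.1.2

/-- The norm `‖u‖_X = ‖∇u‖_{L²(D)}` of `X = H¹₀(D)`. -/
def normX {d : ℕ} {D : Set (E d)} (u : H10 D) : ℝ := ‖grad u‖

/-! ### Simplicial meshes -/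

/-- A conforming finite simplicial mesh of a polyhedral set of `ℝ^d`: a finite simplicial complex
in which every simplex is a face of a `d`-dimensional one. -/
structure Mesh (d : ℕ) extends Geometry.SimplicialComplex ℝ (E d) where
  finite_faces : faces.Finite
  pure : ∀ s ∈ faces, ∃ t ∈ faces, s ⊆ t ∧ t.card = d + 1

namespace Mesh

variable {d : ℕ} (M : Mesh d)

/-- The domain `D`, the interior of the union of all simplices of the mesh. -/
def domain : Set (E d) := interior M.toSimplicialComplex.space

/-- The elements `T ∈ 𝒯`, each given by its set of `d + 1` vertices. -/
def elements : Finset (Finset (E d)) := M.finite_faces.toFinset.filter fun T => T.card = d + 1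

open Classical in
/-- The interior faces `F ∈ 𝒮`, i.e. the common faces of two elements, each given by its set of
`d` vertices. -/
def interiorFaces : Finset (Finset (E d)) :=
  M.finite_faces.toFinset.filter fun F =>
    F.card = d ∧ (M.elements.filter fun T => F ⊆ T).card = 2

open Classical in
/-- The vertices of the mesh that lie in the open set `D`. -/
def interiorVertices : Finset (E d) :=
  (M.finite_faces.toFinset.biUnion id).filter fun z => z ∈ M.domain

/-- The open simplex with vertex set `T`. -/
def openSimplex (T : Finset (E d)) : Set (E d) := interior (convexHull ℝ (T : Set (E d)))

/-- The diameter `h_S` of the simplex with vertex set `S`. -/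
def size (S : Finset (E d)) : ℝ := Metric.diam (convexHull ℝ (S : Set (E d)))

/-- The vertex patch `ω_z`, the union of the elements that have `z` as a vertex (up to the null
set of the element boundaries). -/
def patch (z : E d) : Set (E d) := ⋃ T ∈ M.elements, ⋃ (_ : z ∈ T), openSimplex T

/-- Shape regularity with constant `κ`: every element contains a ball of radius `r > 0` with
`h_T ≤ κ r`. -/
def ShapeRegular (κ : ℝ) : Prop :=
  ∀ T ∈ M.elements, ∃ (x : E d) (r : ℝ), 0 < r ∧
    Metric.closedBall x r ⊆ convexHull ℝ (T : Set (E d)) ∧ size T ≤ κ * r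

/-- The unit normal vector of the face `F` that points out of the element `T`. -/
def outerNormal (T F : Finset (E d)) : E d :=
  Classical.epsilon fun n : E d => ‖n‖ = 1 ∧ (∀ x ∈ F, ∀ y ∈ F, inner ℝ (x - y) n = 0) ∧
    ∀ x ∈ F, ∀ z ∈ T, z ∉ F → inner ℝ (z - x) n < 0

/-! ### Finite elements and the Clément interpolant -/

/-- The conforming finite element space `X_p(𝒯)` of the functions in `H¹₀(D)` that are polynomials
of degree at most `p` on every element. -/
def feSpace (p : ℕ) : Set (H10 M.domain) :=
  {u | ∀ T ∈ M.elements, ∃ q : MvPolynomial (Fin d) ℝ, q.totalDegree ≤ p ∧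
    val u =ᵐ[volume.restrict (openSimplex T)] fun x => MvPolynomial.eval (fun i => x i) q}

/-- The polynomial that agrees with `u` on the element `T` (zero if there is none). -/
def localPoly (u : H10 M.domain) (T : Finset (E d)) : MvPolynomial (Fin d) ℝ :=
  open Classical in
  if h : ∃ q : MvPolynomial (Fin d) ℝ,
    val u =ᵐ[volume.restrict (openSimplex T)] fun x => MvPolynomial.eval (fun i => x i) q
  then h.choose else 0

/-- `u` is the nodal basis function of `z`: on each element it is the affine function with the
value `1` at `z` and `0` at the other vertices. -/
def IsHat (z : E d) (u : H10 M.domain) : Prop :=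
  ∀ T ∈ M.elements, ∃ l : E d →ᵃ[ℝ] ℝ, (∀ z' ∈ T, (z' = z → l z' = 1) ∧ (z' ≠ z → l z' = 0)) ∧
    val u =ᵐ[volume.restrict (openSimplex T)] l

/-- The nodal basis function `λ_z` of an interior vertex `z`. -/
def hat (z : E d) : H10 M.domain := Classical.epsilon (M.IsHat z)

/-- The Clément interpolant `I u = ∑_z (mean of u over ω_z) λ_z`, summed over the interior
vertices `z`. -/
def clement (u : H10 M.domain) : H10 M.domain :=
  ∑ z ∈ M.interiorVertices, (⨍ x in M.patch z, val u x) • M.hat z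

end Mesh

/-! ### Gaussian measures and Hermite polynomials on `ℝ^∞` -/

/-- `γ`, the countable product of standard Gaussian measures. -/
def gammaStd : Measure (ℕ → ℝ) := Measure.infinitePi fun _ => gaussianReal 0 1

/-- The countable product of the centred Gaussian measures with standard deviations `σ m`. -/
def gammaMeasure (σ : ℕ → ℝ) : Measure (ℕ → ℝ) :=
  Measure.infinitePi fun m => gaussianReal 0 (Real.toNNReal (σ m ^ 2))

/-- The density `ζ(y) = ∏ₘ σₘ⁻¹ exp(-(σₘ⁻² - 1) yₘ² / 2)` of `gammaMeasure σ` with respect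
to `γ`. -/
def zeta (σ : ℕ → ℝ) (y : ℕ → ℝ) : ℝ :=
  ∏' m, (σ m)⁻¹ * Real.exp (-(((σ m)⁻¹ ^ 2 - 1) / 2 * y m ^ 2))

/-- The `n`-th Hermite polynomial, normalized in `L²` of the standard Gaussian measure. -/
def hermite1 (n : ℕ) (t : ℝ) : ℝ :=
  Polynomial.aeval t (Polynomial.hermite n) / Real.sqrt (n.factorial : ℝ)

/-- The scaled tensor product Hermite polynomial `∏ₘ H_{μₘ}(yₘ / σₘ)`. -/
def hermiteT (σ : ℕ → ℝ) (μ : ℕ →₀ ℕ) (y : ℕ → ℝ) : ℝ :=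
  ∏ m ∈ μ.support, hermite1 (μ m) (y m / σ m)

/-- The univariate triple products `κ_{i,j,k} = ∫ H_i H_j H_k dγ₁`. -/
def triple1 (i j k : ℕ) : ℝ := ∫ t, hermite1 i t * hermite1 j t * hermite1 k t ∂gaussianReal 0 1

/-- The triple products `∏ₘ κ_{μₘ,νₘ,ηₘ}` (all other factors are equal to one). -/
def triple (μ ν η : ℕ →₀ ℕ) : ℝ :=
  ∏ m ∈ μ.support ∪ ν.support ∪ η.support, triple1 (μ m) (ν m) (η m)

/-- The tensor set of all `μ` with `μₘ < n m` for `m < k` and `μₘ = 0` for `m ≥ k`. -/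
def tensorSet (k : ℕ) (n : ℕ → ℕ) : Finset (ℕ →₀ ℕ) :=
  (Finset.range k).finsupp fun m => Finset.range (n m)

/-! ### The parametric problem and its discretization -/

section Problem

variable {d : ℕ}

/-- `α_ℓ = ‖b_ℓ‖_{L^∞(D)}`. -/
def alpha (D : Set (E d)) (b : ℕ → E d → ℝ) (l : ℕ) : ℝ :=
  (eLpNorm (b l) ⊤ (volume.restrict D)).toReal

/-- `σ_m = exp(ϑ ρ α_m)`. -/
def sigma (D : Set (E d)) (b : ℕ → E d → ℝ) (ϑ ρ : ℝ) (m : ℕ) : ℝ :=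
  Real.exp (ϑ * ρ * alpha D b m)

/-- The lognormal coefficient `a(x,y) = exp(∑_ℓ b_ℓ(x) y_ℓ)`. -/
def coeffA (b : ℕ → E d → ℝ) (x : E d) (y : ℕ → ℝ) : ℝ := Real.exp (∑' l, b l x * y l)

/-- The space `𝒱_{ϑρ}`: the measurable `v : Γ → X` with
`∫_Γ ∫_D a(x,y) |∇v(x,y)|² dx dγ_{ϑρ}(y) < ∞`. -/
def MemV (D : Set (E d)) (b : ℕ → E d → ℝ) (ϑ ρ : ℝ) (v : (ℕ → ℝ) → H10 D) : Prop :=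
  AEStronglyMeasurable v gammaStd ∧
    ∫⁻ y, (∫⁻ x in D, ENNReal.ofReal (coeffA b x y * ‖grad (v y) x‖ ^ 2))
      ∂gammaMeasure (sigma D b ϑ ρ) < ⊤

/-- The norm of `L²(Γ, γ; X)`. -/
def normL2X {D : Set (E d)} (v : (ℕ → ℝ) → H10 D) : ℝ≥0∞ :=
  (∫⁻ y, ENNReal.ofReal (normX (v y) ^ 2) ∂gammaStd) ^ (1 / 2 : ℝ)

/-- The Hermite coefficient `v_μ = ∫_Γ v H_μ dγ_{ϑρ} ∈ X`, where `γ_{ϑρ}` is given by its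
standard deviations `σ`. -/
def hermiteCoeff {D : Set (E d)} (σ : ℕ → ℝ) (v : (ℕ → ℝ) → H10 D) (μ : ℕ →₀ ℕ) : H10 D :=
  ∫ y, hermiteT σ μ y • v y ∂gammaMeasure σ

variable (M : Mesh d)

/-- The fully discrete space `𝒱_N = {∑_{μ ∈ Λ} w_μ H_μ : w_μ ∈ X_p(𝒯)}`. -/
def discreteSpace (p : ℕ) (σ : ℕ → ℝ) (Λ : Finset (ℕ →₀ ℕ)) : Set ((ℕ → ℝ) → H10 M.domain) :=
  {w | ∃ W : (ℕ →₀ ℕ) → H10 M.domain, (∀ μ ∈ Λ, W μ ∈ M.feSpace p) ∧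
    ∀ y, w y = ∑ μ ∈ Λ, hermiteT σ μ y • W μ}

/-- The tensor Clément interpolant `ℐ v = ∑_{μ ∈ Λ} (I v_μ) H_μ`. -/
def tensorClement (σ : ℕ → ℝ) (Λ : Finset (ℕ →₀ ℕ)) (v : (ℕ → ℝ) → H10 M.domain)
    (y : ℕ → ℝ) : H10 M.domain :=
  ∑ μ ∈ Λ, hermiteT σ μ y • M.clement (hermiteCoeff σ v μ)

/-- `u` is piecewise continuously differentiable on the mesh, up to the element boundaries. -/
def PiecewiseC1 (u : E d → ℝ) : Prop :=
  ∀ T ∈ M.elements, ∃ g : E d → ℝ, ContDiff ℝ 1 g ∧ EqOn u g (Mesh.openSimplex T)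

/-- A `C¹` extension of the restriction of `u` to the open element `T` (zero if there is none);
on the closed element it consists of `u` and its one-sided boundary values. -/
def branch (u : E d → ℝ) (T : Finset (E d)) : E d → ℝ :=
  open Classical in
  if h : ∃ g : E d → ℝ, ContDiff ℝ 1 g ∧ EqOn u g (Mesh.openSimplex T) then h.choose else 0

/-- The function `res(·, η)`, the `η`-th Hermite coefficient of `a_{Δ,s} ∇w` for
`a_{Δ,s}(x,y) = ∑_{ν ∈ Δ} a_ν(x) H_ν(y)` and `w = ∑_{μ ∈ Λ} w_μ H_μ`. -/
def res (σ : ℕ → ℝ) (Λ Δ : Finset (ℕ →₀ ℕ)) (a : (ℕ →₀ ℕ) → E d → ℝ)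
    (w : (ℕ → ℝ) → H10 M.domain) (η : ℕ →₀ ℕ) (x : E d) : E d :=
  ∑ μ ∈ Λ, ∑ ν ∈ Δ, (triple μ ν η * a ν x) • grad (hermiteCoeff σ w μ) x

/-- The smooth representative of `res(·, η)` on the element `T` and its boundary. -/
def resOn (σ : ℕ → ℝ) (Λ Δ : Finset (ℕ →₀ ℕ)) (a : (ℕ →₀ ℕ) → E d → ℝ)
    (w : (ℕ → ℝ) → H10 M.domain) (T : Finset (E d)) (η : ℕ →₀ ℕ) (x : E d) : E d :=
  ∑ μ ∈ Λ, ∑ ν ∈ Δ, (triple μ ν η * branch (a ν) T x) •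
    gradient (fun x' : E d =>
      MvPolynomial.eval (fun i => x' i) (M.localPoly (hermiteCoeff σ w μ) T)) x

/-- The divergence of a vector field. -/
def divergence (q : E d → E d) (x : E d) : ℝ :=
  ∑ i, fderiv ℝ q x (EuclideanSpace.single i 1) i

/-- The functional on `X` given by the active residual
`ℛ_{+,Λ}(w) = f + ∑_{η ∈ Λ} div res(·,η) H_η` at the parameter `y`. -/
def activeResidual (σ : ℕ → ℝ) (Λ Δ : Finset (ℕ →₀ ℕ)) (a : (ℕ →₀ ℕ) → E d → ℝ)
    (f : Lp ℝ 2 (volume.restrict M.domain)) (w : (ℕ → ℝ) → H10 M.domain)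
    (y : ℕ → ℝ) (u : H10 M.domain) : ℝ :=
  (∫ x in M.domain, f x * val u x) -
    ∑ η ∈ Λ, hermiteT σ η y * ∫ x in M.domain, inner ℝ (res M σ Λ Δ a w η x) (grad u x)

/-- The pairing `⟨ℛ_{+,Λ}(w), v⟩_{ϑρ}`, integrated over the parameters with respect to
`γ_{ϑρ}`. -/
def residualPairing (σ : ℕ → ℝ) (Λ Δ : Finset (ℕ →₀ ℕ)) (a : (ℕ →₀ ℕ) → E d → ℝ)
    (f : Lp ℝ 2 (volume.restrict M.domain)) (w v : (ℕ → ℝ) → H10 M.domain) : ℝ :=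
  ∫ y, activeResidual M σ Λ Δ a f w y (v y) ∂gammaMeasure σ

/-- The active residual on the element `T`, as a function. -/
def elementResidual (σ : ℕ → ℝ) (Λ Δ : Finset (ℕ →₀ ℕ)) (a : (ℕ →₀ ℕ) → E d → ℝ)
    (f : Lp ℝ 2 (volume.restrict M.domain)) (w : (ℕ → ℝ) → H10 M.domain)
    (T : Finset (E d)) (x : E d) (y : ℕ → ℝ) : ℝ :=
  f x + ∑ η ∈ Λ, divergence (resOn M σ Λ Δ a w T η) x * hermiteT σ η y

open Classical in
/-- The jump of the active residual on the face `F`, i.e. the jump of the normal component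
of the flux `∑_{η ∈ Λ} res(·,η) H_η`. -/
def faceJump (σ : ℕ → ℝ) (Λ Δ : Finset (ℕ →₀ ℕ)) (a : (ℕ →₀ ℕ) → E d → ℝ)
    (w : (ℕ → ℝ) → H10 M.domain) (F : Finset (E d)) (x : E d) (y : ℕ → ℝ) : ℝ :=
  ∑ T ∈ M.elements.filter (fun T => F ⊆ T),
    ∑ η ∈ Λ, inner ℝ (resOn M σ Λ Δ a w T η x) (Mesh.outerNormal T F) * hermiteT σ η y

/-- The deterministic error estimator: the square root of the sum of
`h_T² ‖ℛ_{+,Λ}(w) ζ‖²_{L²(Γ,γ;L²(T))}` over the elements `T` and of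
`h_F ‖[[ℛ_{+,Λ}(w)]] ζ‖²_{L²(Γ,γ;L²(F))}` over the interior faces `F`. -/
def estDet (σ : ℕ → ℝ) (Λ Δ : Finset (ℕ →₀ ℕ)) (a : (ℕ →₀ ℕ) → E d → ℝ)
    (f : Lp ℝ 2 (volume.restrict M.domain)) (w : (ℕ → ℝ) → H10 M.domain) : ℝ≥0∞ :=
  ((∑ T ∈ M.elements, ENNReal.ofReal (Mesh.size T ^ 2) *
      ∫⁻ y, (∫⁻ x in Mesh.openSimplex T,
        ENNReal.ofReal ((elementResidual M σ Λ Δ a f w T x y * zeta σ y) ^ 2)) ∂gammaStd) +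
    ∑ F ∈ M.interiorFaces, ENNReal.ofReal (Mesh.size F) *
      ∫⁻ y, (∫⁻ x in convexHull ℝ (F : Set (E d)),
        ENNReal.ofReal ((faceJump M σ Λ Δ a w F x y * zeta σ y) ^ 2)
          ∂(Measure.euclideanHausdorffMeasure (d - 1))) ∂gammaStd) ^ (1 / 2 : ℝ)

end Problem

end SGFEM

end

/-! The active residual contains only the modes $H_\eta$ with $\eta\in\Lambda$; the load is $fH_0$,
and $0\in\Lambda$ because all $d_m\ge1$. The Clément operator $I$ is linear and bounded on
$H^1_0(D)$. By orthonormality of the scaled Hermite polynomials in $L^2(\gamma_{\vartheta\rho})$,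
the truncated expansion $\sum_{\mu\in\Lambda}(Iv_\mu)H_\mu$ cannot be distinguished from $y\mapsto
I(v(y))$ when it is tested with such a mode. Hence the pairing is the
$\gamma_{\vartheta\rho}$-integral of the residual at $y$ applied to $v(y)-I(v(y))$
(`integral_activeResidual_tensorClement`), and the problem becomes deterministic for each $y$.

For fixed $y$, the classical residual estimate (`activeResidual_bound`) gives $|R_y(u-Iu)|\le
c\,\eta(y)\,\|\nabla u\|$, where $\eta(y)^2$ is `etaSq` of the flux at $y$. Since
$d\gamma_{\vartheta\rho}=\zeta\,d\gamma$ (`gammaMeasure_eq_withDensity`), the Cauchy–Schwarz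
inequality in $L^2(\gamma)$ with the whole density attached to $\eta$ yields the estimator times the
unweighted norm of $v$.

The deterministic estimate is shown for smooth $\varphi$ with compact support in $D$ and extended by
density. Elementwise integration by parts (`elements_sum_by_parts`) leaves element residuals and
jumps over interior faces: the interpolation error is continuous across faces and zero on boundary
facets. It remains to bound this error on elements and facets (`integral_localError_sq_le`,
`facet_localError_le`). On $T$ it equals $\varphi$ minus its mean, which the Poincaré inequality for
convex sets controls, plus a combination of differences between the mean over $T$ and the nodal
values.

For these differences, the means over two elements with a common facet are compared through their
trace on it (`mean_sub_mean`), and the comparison is chained through the star of a vertex. The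
existence of chains is topological (`starGraph_connected`): if a facet-connected part of the star
has no boundary facet through the vertex, its cones cover $\mathbb R^d$, so the vertex is interior
and the part is the whole star. Otherwise the chain ends at a boundary facet, where $\varphi=0$,
which matches the nodal value zero at boundary vertices. A packing argument (`card_star_le`) bounds
the size of the star, so all constants depend on $d$ and $\kappa$ only.

Three supports are needed: the divergence theorem on a simplex, from polar coordinates about each
vertex; the existence of the nodal functions in $H^1_0(D)$ (`exists_isHat`); and exponential moments
of $\sum_\ell\alpha_\ell|y_\ell|$, which make every $H_\mu v$ Bochner integrable. -/

namespace SGFEM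

/-! ### Barycentric coordinates on nondegenerate simplices -/

/-- `T` is the vertex set of a nondegenerate `d`-dimensional simplex of `ℝ^d`. -/
def IsSimplex {d : ℕ} (T : Finset (E d)) : Prop :=
  T.card = d + 1 ∧ AffineIndependent ℝ ((↑) : T → E d)

section Bary

variable {d : ℕ} {T : Finset (E d)}

/-- The affine basis of `ℝ^d` formed by the vertices of a simplex. -/
noncomputable def IsSimplex.basis (h : IsSimplex T) : AffineBasis T ℝ (E d) :=
  ⟨(↑), h.2, (h.2.affineSpan_eq_top_iff_card_eq_finrank_add_one).2 (by simp [h.1])⟩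

theorem IsSimplex.basis_apply (h : IsSimplex T) (z : T) : h.basis z = z := rfl

open Classical in
/-- The barycentric coordinate of the vertex `z` of the simplex `T`, as a function on `ℝ^d`. -/
noncomputable def bary (T : Finset (E d)) (z : E d) : E d →ᵃ[ℝ] ℝ :=
  if h : IsSimplex T ∧ z ∈ T then h.1.basis.coord ⟨z, h.2⟩ else 0

theorem IsSimplex.bary_eq (h : IsSimplex T) (z : T) : bary T z = h.basis.coord z := by
  simp [bary, h]

theorem bary_of_notMem {z : E d} (h : z ∉ T) : bary T z = 0 := by
  simp [bary, h]

theorem IsSimplex.bary_self (h : IsSimplex T) {z : E d} (hz : z ∈ T) : bary T z z = 1 := by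
  have := h.basis.coord_apply_eq (⟨z, hz⟩ : T)
  rwa [← h.bary_eq] at this

theorem IsSimplex.bary_of_ne (h : IsSimplex T) {z z' : E d} (hz' : z' ∈ T)
    (hne : z' ≠ z) : bary T z z' = 0 := by
  by_cases hz : z ∈ T
  · have := h.basis.coord_apply_ne (i := ⟨z, hz⟩) (j := ⟨z', hz'⟩) (by simpa using hne.symm)
    rwa [← h.bary_eq] at this
  · simp [bary_of_notMem hz]

theorem IsSimplex.sum_bary (h : IsSimplex T) (x : E d) : ∑ z ∈ T, bary T z x = 1 := by
  rw [← h.basis.sum_coord_apply_eq_one x, ← Finset.sum_coe_sort]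
  exact Finset.sum_congr rfl fun z _ => by rw [h.bary_eq]

theorem IsSimplex.sum_bary_smul (h : IsSimplex T) (x : E d) : ∑ z ∈ T, bary T z x • z = x := by
  have := h.basis.linear_combination_coord_eq_self x
  rw [← Finset.sum_coe_sort]
  refine Eq.trans (Finset.sum_congr rfl fun z _ => ?_) this
  rw [h.bary_eq, h.basis_apply]

/-- An affine map is determined by its values at the vertices of a simplex. -/
theorem IsSimplex.affine_apply (h : IsSimplex T) (l : E d →ᵃ[ℝ] ℝ) (x : E d) :
    l x = ∑ z ∈ T, bary T z x * l z := by
  have h1 : ∀ y : E d, l y = l.linear y + l 0 := fun y => by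
    have := l.map_vadd 0 y
    simpa using this
  rw [h1 x]
  conv_lhs => rw [← h.sum_bary_smul x]
  simp only [map_sum, map_smul, smul_eq_mul]
  calc _ = ∑ z ∈ T, bary T z x * l.linear z + (∑ z ∈ T, bary T z x) * l 0 := by
        rw [h.sum_bary, one_mul]
    _ = _ := by
        rw [Finset.sum_mul, ← Finset.sum_add_distrib]
        exact Finset.sum_congr rfl fun z _ => by rw [h1 z]; ring

theorem IsSimplex.affine_ext (h : IsSimplex T) {l l' : E d →ᵃ[ℝ] ℝ}
    (hl : ∀ z ∈ T, l z = l' z) : l = l' := by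
  ext x
  rw [h.affine_apply l, h.affine_apply l']
  exact Finset.sum_congr rfl fun z hz => by rw [hl z hz]

theorem IsSimplex.mem_convexHull (h : IsSimplex T) {x : E d} :
    x ∈ convexHull ℝ (T : Set (E d)) ↔ ∀ z ∈ T, 0 ≤ bary T z x := by
  have := h.basis.convexHull_eq_nonneg_coord
  have hr : Set.range h.basis = (T : Set (E d)) := by
    ext y; simp [h.basis_apply]
  rw [hr] at this
  rw [this]
  constructor
  · intro hx z hz
    have := hx ⟨z, hz⟩
    rwa [← h.bary_eq] at this
  · intro hx z
    rw [← h.bary_eq]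
    exact hx z z.2

theorem IsSimplex.mem_openSimplex (h : IsSimplex T) {x : E d} :
    x ∈ Mesh.openSimplex T ↔ ∀ z ∈ T, 0 < bary T z x := by
  have := h.basis.interior_convexHull
  have hr : Set.range h.basis = (T : Set (E d)) := by
    ext y; simp [h.basis_apply]
  rw [hr] at this
  rw [Mesh.openSimplex, this]
  constructor
  · intro hx z hz
    have := hx ⟨z, hz⟩
    rwa [← h.bary_eq] at this
  · intro hx z
    rw [← h.bary_eq]
    exact hx z z.2

/-- A coordinate that vanishes at the vertices of a face vanishes on its hull. Conversely, once the
coordinates off `S` are zero, the barycentric representation of `x` is a convex combination over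
`S`. -/
theorem IsSimplex.mem_convexHull_subset (h : IsSimplex T) {S : Finset (E d)} (hS : S ⊆ T)
    {x : E d} : x ∈ convexHull ℝ (S : Set (E d)) ↔
      (∀ z ∈ T, 0 ≤ bary T z x) ∧ ∀ z ∈ T, z ∉ S → bary T z x = 0 := by
  constructor
  · intro hx
    refine ⟨h.mem_convexHull.1 (convexHull_mono (by exact_mod_cast hS) hx), fun z _ hzS => ?_⟩
    have hsub : convexHull ℝ (S : Set (E d)) ⊆ {y | bary T z y = 0} := by
      refine convexHull_min (fun y hy => ?_) ?_
      · exact h.bary_of_ne (hS hy) fun e => hzS (e ▸ hy)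
      · exact (convex_singleton (0 : ℝ)).affine_preimage (bary T z)
    exact hsub hx
  · rintro ⟨h0, h1⟩
    have hx := h.sum_bary_smul x
    have hs := h.sum_bary x
    rw [← Finset.sum_subset hS fun z hz hzS => by rw [h1 z hz hzS]] at hs
    rw [← Finset.sum_subset hS fun z hz hzS => by rw [h1 z hz hzS, zero_smul]] at hx
    rw [← hx]
    exact (convex_convexHull ℝ _).sum_mem (fun z hz => h0 z (hS hz)) hs
      fun z hz => subset_convexHull ℝ _ hz

theorem affine_continuous (l : E d →ᵃ[ℝ] ℝ) : Continuous l := l.continuous_of_finiteDimensional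

theorem convexHull_isCompact (S : Finset (E d)) : IsCompact (convexHull ℝ (S : Set (E d))) :=
  S.finite_toSet.isCompact_convexHull ℝ

theorem convexHull_isClosed (S : Finset (E d)) : IsClosed (convexHull ℝ (S : Set (E d))) :=
  (convexHull_isCompact S).isClosed

theorem openSimplex_isOpen (T : Finset (E d)) : IsOpen (Mesh.openSimplex T) := isOpen_interior

theorem openSimplex_subset (T : Finset (E d)) :
    Mesh.openSimplex T ⊆ convexHull ℝ (T : Set (E d)) := interior_subset

/-- The frontier of a convex set is Lebesgue null, so open and closed simplices are interchangeable
in volume integrals. -/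
theorem openSimplex_ae_eq (T : Finset (E d)) :
    (Mesh.openSimplex T : Set (E d)) =ᵐ[volume] convexHull ℝ (T : Set (E d)) :=
  interior_ae_eq_of_null_frontier ((convex_convexHull ℝ _).addHaar_frontier volume)

theorem IsSimplex.openSimplex_nonempty (h : IsSimplex T) : (Mesh.openSimplex T).Nonempty := by
  have := h.basis.centroid_mem_interior_convexHull
  have hr : Set.range h.basis = (T : Set (E d)) := by
    ext y; simp [h.basis_apply]
  rw [hr] at this
  exact ⟨_, this⟩

/-- The gradient of an affine function. -/
noncomputable def affGrad (l : E d →ᵃ[ℝ] ℝ) : E d :=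
  (InnerProductSpace.toDual ℝ (E d)).symm (LinearMap.toContinuousLinearMap l.linear)

theorem inner_affGrad (l : E d →ᵃ[ℝ] ℝ) (v : E d) : inner ℝ (affGrad l) v = l.linear v := by
  simp [affGrad]

theorem affine_sub (l : E d →ᵃ[ℝ] ℝ) (x y : E d) : l x - l y = inner ℝ (affGrad l) (x - y) := by
  rw [inner_affGrad]
  have := l.linearMap_vsub x y
  simpa using this.symm

theorem hasGradientAt_affine (l : E d →ᵃ[ℝ] ℝ) (x : E d) : HasGradientAt l (affGrad l) x := by
  have h1 : (l : E d → ℝ) = fun y => LinearMap.toContinuousLinearMap l.linear y + l 0 := by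
    ext y
    have := l.map_vadd 0 y
    simpa using this
  have : HasFDerivAt l (LinearMap.toContinuousLinearMap l.linear) x := by
    rw [h1]
    exact (ContinuousLinearMap.hasFDerivAt _).add_const _
  rw [hasGradientAt_iff_hasFDerivAt]
  simpa [affGrad] using this

theorem contDiff_affine (l : E d →ᵃ[ℝ] ℝ) {n : WithTop ℕ∞} : ContDiff ℝ n l := by
  have h1 : (l : E d → ℝ) = fun y => LinearMap.toContinuousLinearMap l.linear y + l 0 := by
    ext y
    have := l.map_vadd 0 y
    simpa using this
  rw [h1]
  exact (ContinuousLinearMap.contDiff _).add contDiff_const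

end Bary

end SGFEM


namespace SGFEM

/-! ### Integration on cones and the divergence theorem on simplices -/

section Cone

variable {d : ℕ} {T : Finset (E d)}

/-- The height of the simplex `T` over the facet opposite to the vertex `z`. -/
noncomputable def height (T : Finset (E d)) (z : E d) : ℝ := ‖affGrad (bary T z)‖⁻¹

/-- The facet of `T` opposite to `z`, as a set. -/
def facetSet (T : Finset (E d)) (z : E d) : Set (E d) :=
  convexHull ℝ ((T : Set (E d)) \ {z})

theorem facetSet_eq_erase [DecidableEq (E d)] (T : Finset (E d)) (z : E d) :
    facetSet T z = convexHull ℝ ((T.erase z : Finset (E d)) : Set (E d)) := by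
  rw [facetSet, Finset.coe_erase]

theorem IsSimplex.exists_ne (h : IsSimplex T) (hd : 1 ≤ d) (z : E d) : ∃ x ∈ T, x ≠ z := by
  by_contra! hc
  have : T ⊆ {z} := fun x hx => by simp [hc x hx]
  have := Finset.card_le_card this
  rw [h.1] at this
  simp at this; omega

theorem IsSimplex.affGrad_ne_zero (h : IsSimplex T) (hd : 1 ≤ d) {z : E d} (hz : z ∈ T) :
    affGrad (bary T z) ≠ 0 := by
  intro h0
  obtain ⟨x, hx, hxz⟩ := h.exists_ne hd z
  have := affine_sub (bary T z) z x
  rw [h0, inner_zero_left, h.bary_self hz, h.bary_of_ne hx hxz] at this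
  norm_num at this

theorem IsSimplex.height_pos (h : IsSimplex T) (hd : 1 ≤ d) {z : E d} (hz : z ∈ T) :
    0 < height T z :=
  inv_pos.2 (norm_pos_iff.2 (h.affGrad_ne_zero hd hz))

theorem bary_homothety {l : E d →ᵃ[ℝ] ℝ} (z x : E d) (t : ℝ) :
    l (AffineMap.homothety z t x) = l z + t * (l x - l z) := by
  have h1 := affine_sub l (AffineMap.homothety z t x) z
  have h2 := affine_sub l x z
  rw [AffineMap.homothety_apply] at h1 ⊢
  simp only [vsub_eq_sub, vadd_eq_add, add_sub_cancel_right, inner_smul_right] at h1 ⊢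
  rw [← h2] at h1
  linarith

theorem IsSimplex.mem_facetSet (h : IsSimplex T) {z : E d} (hz : z ∈ T) {x : E d} :
    x ∈ facetSet T z ↔ (∀ w ∈ T, 0 ≤ bary T w x) ∧ bary T z x = 0 := by
  classical
  rw [facetSet_eq_erase, h.mem_convexHull_subset (Finset.erase_subset z T)]
  refine and_congr_right fun _ => ⟨fun hx => hx z hz (by simp), fun hx w hw hwz => ?_⟩
  have : w = z := by
    by_contra hne
    exact hwz (Finset.mem_erase.2 ⟨hne, hw⟩)
  rwa [this]

/-- Dilation about `z` multiplies every coordinate except that of `z` by `t` and moves the level `0`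
of the latter to `1 - t`. Thus each slice parallel to the facet is a scaled copy of it. -/
theorem IsSimplex.homothety_image_facet (h : IsSimplex T) {z : E d} (hz : z ∈ T) {t : ℝ}
    (ht : 0 < t) (ht1 : t ≤ 1) :
    AffineMap.homothety z t '' facetSet T z =
      {y | y ∈ convexHull ℝ (T : Set (E d)) ∧ bary T z y = 1 - t} := by
  ext y
  constructor
  · rintro ⟨x, hx, rfl⟩
    rw [h.mem_facetSet hz] at hx
    refine ⟨h.mem_convexHull.2 fun w hw => ?_, ?_⟩
    · rw [bary_homothety]
      by_cases hwz : w = z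
      · subst hwz; rw [h.bary_self hw, hx.2]; linarith
      · rw [h.bary_of_ne hz (Ne.symm hwz)]
        have := hx.1 w hw
        simp only [sub_zero, zero_add]; positivity
    · rw [bary_homothety, h.bary_self hz, hx.2]; ring
  · rintro ⟨hy, hyt⟩
    refine ⟨AffineMap.homothety z t⁻¹ y, ?_, ?_⟩
    · rw [h.mem_facetSet hz]
      refine ⟨fun w hw => ?_, ?_⟩
      · rw [bary_homothety]
        by_cases hwz : w = z
        · subst hwz; rw [h.bary_self hw, hyt]
          have : t⁻¹ * (1 - t - 1) = -1 := by field_simp; ring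
          rw [this]; norm_num
        · rw [h.bary_of_ne hz (Ne.symm hwz)]
          have := h.mem_convexHull.1 hy w hw
          simp only [sub_zero, zero_add]; positivity
      · rw [bary_homothety, h.bary_self hz, hyt]; field_simp; ring
    · rw [AffineMap.homothety_apply, AffineMap.homothety_apply]
      simp [smul_smul, ht.ne']

/-- Fubini in the direction normal to the facet: the slice at relative distance `t` from the apex is
the facet scaled by `t`, whose surface measure scales by `t ^ (d - 1)`, and the height converts `t`
into length. -/
theorem IsSimplex.volume_inter_eq_lintegral (h : IsSimplex T) (hd : 1 ≤ d) {z : E d}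
    (hz : z ∈ T) {A : Set (E d)} (hA : MeasurableSet A) :
    volume (A ∩ convexHull ℝ (T : Set (E d))) =
      ∫⁻ t in Ioc (0 : ℝ) 1, ENNReal.ofReal (height T z * t ^ (d - 1)) *
        (Measure.euclideanHausdorffMeasure (d - 1) : Measure (E d))
          (AffineMap.homothety z t ⁻¹' A ∩ facetSet T z) := by
  set g := affGrad (bary T z) with hg
  have hg0 : g ≠ 0 := h.affGrad_ne_zero hd hz
  have hgn : 0 < ‖g‖ := norm_pos_iff.2 hg0
  have hp : 0 < height T z := h.height_pos hd hz
  -- The vector from the apex perpendicularly to the facet plane; it is scaled so that `z + x • v`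
  -- lies on the level `1 - x`.
  set v : E d := -((‖g‖⁻¹ ^ 2) • g) with hv
  have hvn : ‖v‖ = height T z := by
    rw [hv, norm_neg, norm_smul, height, ← hg, norm_pow, norm_inv, norm_norm]
    field_simp
  have hv0 : v ≠ 0 := by
    rw [← norm_pos_iff, hvn]; exact hp
  have hm : MeasurableSet (A ∩ convexHull ℝ (T : Set (E d))) :=
    hA.inter (convexHull_isClosed T).measurableSet
  have key := EuclideanGeometry.euclideanHausdorffMeasure_eq_lintegral (V := E d) z hv0 hm
  rw [finrank_euclideanSpace_fin, EuclideanSpace.euclideanHausdorffMeasure_eq_volume] at key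
  rw [key]
  have hslice : ∀ x : ℝ, ((AffineSubspace.mk' (x • v +ᵥ z) (Submodule.span ℝ {v})ᗮ :
      AffineSubspace ℝ (E d)) : Set (E d)) = {y | bary T z y = 1 - x} := by
    intro x
    ext y
    simp only [SetLike.mem_coe, AffineSubspace.mem_mk', Submodule.mem_orthogonal_singleton_iff_inner_right,
      mem_ofPred_eq, vadd_eq_add, vsub_eq_sub]
    have h1 := affine_sub (bary T z) y z
    rw [h.bary_self hz] at h1
    have h2 : inner ℝ v (y - (x • v + z)) = -(‖g‖⁻¹ ^ 2) * (inner ℝ g (y - z) + x) := by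
      have : y - (x • v + z) = (y - z) - x • v := by abel
      rw [this, inner_sub_right, inner_smul_right, real_inner_self_eq_norm_sq, hvn, hv,
        inner_neg_left, inner_smul_left, height, ← hg]
      simp; ring
    rw [h2, ← h1, mul_eq_zero, or_iff_right (by simp [hg0])]
    constructor <;> intro h3 <;> linarith
  simp_rw [hslice]
  rw [← lintegral_const_mul' _ _ (by simp), ← lintegral_indicator measurableSet_Ioc]
  -- At `x = 0` the slice of the simplex is the apex and not empty; this single value is discarded.
  have hne : ∀ᵐ x : ℝ, x ≠ 0 := by
    simp [ae_iff, measure_singleton]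
  refine lintegral_congr_ae ?_
  filter_upwards [hne] with x hx0
  by_cases hx : x ∈ Ioc (0 : ℝ) 1
  · rw [indicator_of_mem hx]
    have hset : A ∩ convexHull ℝ (T : Set (E d)) ∩ {y | bary T z y = 1 - x} =
        AffineMap.homothety z x '' (AffineMap.homothety z x ⁻¹' A ∩ facetSet T z) := by
      rw [Set.image_preimage_inter, h.homothety_image_facet hz hx.1 hx.2]
      ext y; simp only [mem_inter_iff, mem_ofPred_eq]; tauto
    rw [hset, MeasureTheory.euclideanHausdorffMeasure_homothety_image _ _ hx0]
    have h1 : ‖v‖ₑ = ENNReal.ofReal (height T z) := by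
      rw [← hvn, ofReal_norm]
    have h2 : ∀ m : ℝ≥0∞, ‖x‖₊ ^ (d - 1) • m = ENNReal.ofReal (x ^ (d - 1)) * m := by
      intro m
      rw [ENNReal.smul_def, smul_eq_mul]
      congr 1
      rw [← Real.norm_of_nonneg hx.1.le, ← norm_pow, ofReal_norm]
      simp [enorm]
    rw [h1, h2, ← mul_assoc, ← ENNReal.ofReal_mul hp.le]
  · rw [indicator_of_notMem hx]
    have hset : A ∩ convexHull ℝ (T : Set (E d)) ∩ {y | bary T z y = 1 - x} = ∅ := by
      ext y
      simp only [mem_inter_iff, mem_ofPred_eq, mem_empty_iff_false, iff_false, not_and, and_imp]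
      intro _ hy hyx
      have h0 := h.mem_convexHull.1 hy
      have h1 : bary T z y ≤ 1 := by
        rw [← h.sum_bary y]
        exact Finset.single_le_sum (f := fun w => bary T w y) (fun w hw => h0 w hw) hz
      have h2 := h0 z hz
      exact hx ⟨lt_of_le_of_ne (by linarith) (Ne.symm hx0), by linarith⟩
    rw [hset]; simp

theorem integral_pow_pred (hd : 1 ≤ d) (c : ℝ) (hc : 0 ≤ c) :
    ∫⁻ t in Ioc (0 : ℝ) 1, ENNReal.ofReal (c * t ^ (d - 1)) = ENNReal.ofReal (c / d) := by
  rw [← ofReal_integral_eq_lintegral_ofReal]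
  · rw [← intervalIntegral.integral_of_le zero_le_one, intervalIntegral.integral_const_mul,
      integral_pow]
    have : ((d - 1 : ℕ) : ℝ) + 1 = d := by
      rw [Nat.cast_sub hd]; simp
    rw [this]
    congr 1
    have h2 : d - 1 + 1 = d := by omega
    rw [h2, one_pow, zero_pow (by omega)]; ring
  · exact (Continuous.integrableOn_Icc (by fun_prop)).mono_set Ioc_subset_Icc_self
  · filter_upwards [ae_restrict_mem measurableSet_Ioc] with t ht
    have := ht.1
    positivity

/-- `d |T| = height * |F|`. -/
theorem IsSimplex.volume_eq_facet (h : IsSimplex T) (hd : 1 ≤ d) {z : E d} (hz : z ∈ T) :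
    volume (convexHull ℝ (T : Set (E d))) = ENNReal.ofReal (height T z / d) *
      (Measure.euclideanHausdorffMeasure (d - 1) : Measure (E d)) (facetSet T z) := by
  have := h.volume_inter_eq_lintegral hd hz MeasurableSet.univ
  simp only [univ_inter, preimage_univ] at this
  rw [this, lintegral_mul_const'']
  · rw [integral_pow_pred hd _ (h.height_pos hd hz).le]
  · fun_prop

theorem IsSimplex.facet_lt_top (h : IsSimplex T) (hd : 1 ≤ d) {z : E d} (hz : z ∈ T) :
    (Measure.euclideanHausdorffMeasure (d - 1) : Measure (E d)) (facetSet T z) < ⊤ := by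
  have h1 := h.volume_eq_facet hd hz
  by_contra hc
  have h2 : (Measure.euclideanHausdorffMeasure (d - 1) : Measure (E d)) (facetSet T z) = ⊤ := by
    simpa using hc
  rw [h2, ENNReal.mul_top] at h1
  · exact (convexHull_isCompact T).measure_lt_top.ne h1
  · have := h.height_pos hd hz
    have hd' : (0 : ℝ) < d := by exact_mod_cast hd
    simp only [ne_eq, ENNReal.ofReal_eq_zero, not_le]
    positivity

theorem facetSet_isCompact (T : Finset (E d)) (z : E d) : IsCompact (facetSet T z) :=
  (T.finite_toSet.subset sdiff_subset).isCompact_convexHull ℝ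

theorem facetSet_isClosed (T : Finset (E d)) (z : E d) : IsClosed (facetSet T z) :=
  (facetSet_isCompact T z).isClosed

theorem facetSet_subset (T : Finset (E d)) (z : E d) :
    facetSet T z ⊆ convexHull ℝ (T : Set (E d)) :=
  convexHull_mono sdiff_subset

/-- The surface measure on the facet opposite to `z`. -/
noncomputable def facetMeasure (T : Finset (E d)) (z : E d) : Measure (E d) :=
  (Measure.euclideanHausdorffMeasure (d - 1)).restrict (facetSet T z)

theorem IsSimplex.isFiniteMeasure_facet (h : IsSimplex T) (hd : 1 ≤ d) {z : E d} (hz : z ∈ T) :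
    IsFiniteMeasure (facetMeasure T z) :=
  ⟨by rw [facetMeasure, Measure.restrict_apply_univ]; exact h.facet_lt_top hd hz⟩

/-- The density `height * t^(d-1)` on `(0,1]` of the radial variable. -/
noncomputable def radialMeasure (T : Finset (E d)) (z : E d) : Measure ℝ :=
  (volume.restrict (Ioc (0 : ℝ) 1)).withDensity
    fun t => ENNReal.ofReal (height T z * t ^ (d - 1))

theorem continuous_homothety_uncurry (z : E d) :
    Continuous fun p : ℝ × E d => AffineMap.homothety z p.1 p.2 := by
  simp only [AffineMap.homothety_apply, vsub_eq_sub, vadd_eq_add]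
  fun_prop

theorem IsSimplex.isFiniteMeasure_radial (h : IsSimplex T) (hd : 1 ≤ d) {z : E d} (hz : z ∈ T) :
    IsFiniteMeasure (radialMeasure T z) :=
  ⟨by
    rw [radialMeasure, withDensity_apply _ MeasurableSet.univ, Measure.restrict_univ,
      integral_pow_pred hd _ (h.height_pos hd hz).le]
    exact ENNReal.ofReal_lt_top⟩

/-- Polar coordinates with origin `z`, as an identity of measures, so that Fubini applies to signed
integrands as well. -/
theorem IsSimplex.restrict_eq_map (h : IsSimplex T) (hd : 1 ≤ d) {z : E d} (hz : z ∈ T) :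
    volume.restrict (convexHull ℝ (T : Set (E d))) =
      ((radialMeasure T z).prod (facetMeasure T z)).map
        fun p : ℝ × E d => AffineMap.homothety z p.1 p.2 := by
  have := h.isFiniteMeasure_facet hd hz
  have := h.isFiniteMeasure_radial hd hz
  have hc := (continuous_homothety_uncurry z).measurable
  ext A hA
  rw [Measure.restrict_apply hA, h.volume_inter_eq_lintegral hd hz hA,
    Measure.map_apply hc hA, Measure.prod_apply (hc hA), radialMeasure,
    lintegral_withDensity_eq_lintegral_mul _ (by fun_prop)
      (measurable_measure_prodMk_left (hc hA))]
  refine setLIntegral_congr_fun measurableSet_Ioc fun t _ => ?_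
  have hcs : Measurable fun x : E d => AffineMap.homothety z t x :=
    hc.comp (measurable_const.prodMk measurable_id)
  have hset : Prod.mk t ⁻¹' ((fun p : ℝ × E d => AffineMap.homothety z p.1 p.2) ⁻¹' A) =
      AffineMap.homothety z t ⁻¹' A := rfl
  simp only [Pi.mul_apply]
  rw [hset, facetMeasure, Measure.restrict_apply (hcs hA)]

theorem continuous_integrableOn_convexHull {F : Type*} [NormedAddCommGroup F] {g : E d → F}
    (hg : Continuous g) (T : Finset (E d)) :
    IntegrableOn g (convexHull ℝ (T : Set (E d))) :=
  hg.continuousOn.integrableOn_compact (convexHull_isCompact T)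

theorem IsSimplex.integrable_facet (h : IsSimplex T) (hd : 1 ≤ d) {z : E d} (hz : z ∈ T)
    {g : E d → ℝ} (hg : Continuous g) : Integrable g (facetMeasure T z) := by
  have := h.isFiniteMeasure_facet hd hz
  obtain ⟨C, hC⟩ := (facetSet_isCompact T z).exists_bound_of_continuousOn hg.continuousOn
  refine Integrable.of_bound hg.aestronglyMeasurable C ?_
  filter_upwards [ae_restrict_mem (facetSet_isClosed T z).measurableSet] with x hx using hC x hx

/-- The divergence theorem for the field `g(x) (x - z)` on a simplex with vertex `z`. -/
theorem IsSimplex.integral_cone (h : IsSimplex T) (hd : 1 ≤ d) {z : E d} (hz : z ∈ T)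
    {g : E d → ℝ} (hg : ContDiff ℝ 1 g) :
    ∫ x in convexHull ℝ (T : Set (E d)), (d * g x + fderiv ℝ g x (x - z)) =
      height T z * ∫ x, g x ∂facetMeasure T z := by
  have := h.isFiniteMeasure_facet hd hz
  have := h.isFiniteMeasure_radial hd hz
  have hc := continuous_homothety_uncurry z
  set G : E d → ℝ := fun x => d * g x + fderiv ℝ g x (x - z) with hG
  have hfd : Continuous (fderiv ℝ g) := hg.continuous_fderiv one_ne_zero
  have hGc : Continuous G := by
    have := hg.continuous
    fun_prop
  have hint : IntegrableOn G (convexHull ℝ (T : Set (E d))) :=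
    continuous_integrableOn_convexHull hGc T
  have hmap := h.restrict_eq_map hd hz
  rw [IntegrableOn, hmap, integrable_map_measure hGc.aestronglyMeasurable hc.aemeasurable] at hint
  rw [hmap, integral_map hc.aemeasurable hGc.aestronglyMeasurable]
  simp only [Function.comp_def] at hint
  rw [integral_prod_symm _ hint, ← integral_const_mul]
  refine integral_congr_ae (Eventually.of_forall fun x => ?_)
  simp only
  rw [radialMeasure, integral_withDensity_eq_integral_toReal_smul (by fun_prop) (by simp),
    ← intervalIntegral.integral_of_le zero_le_one]
  -- The radial integrand is the derivative of `t ^ d * g`, so only the value at `t = 1`, on the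
  -- facet, survives.
  have hder : ∀ t : ℝ, HasDerivAt
      (fun t : ℝ => height T z * (t ^ d * g (AffineMap.homothety z t x)))
      (height T z * (d * t ^ (d - 1) * g (AffineMap.homothety z t x) +
        t ^ d * fderiv ℝ g (AffineMap.homothety z t x) (x - z))) t := by
    intro t
    refine HasDerivAt.const_mul _ ((hasDerivAt_pow d t).mul ?_)
    have h1 : HasDerivAt (fun t : ℝ => AffineMap.homothety z t x) (x - z) t := by
      simp only [AffineMap.homothety_apply, vsub_eq_sub, vadd_eq_add]
      simpa using ((hasDerivAt_id t).smul_const (x - z)).add_const z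
    exact ((hg.differentiable (by simp)) _).hasFDerivAt.comp_hasDerivAt t h1
  have hct : Continuous fun t : ℝ => AffineMap.homothety z t x :=
    hc.comp (by fun_prop : Continuous fun t : ℝ => (t, x))
  have hcont : Continuous fun t : ℝ =>
      height T z * (d * t ^ (d - 1) * g (AffineMap.homothety z t x) +
        t ^ d * fderiv ℝ g (AffineMap.homothety z t x) (x - z)) := by
    have := hg.continuous.comp hct
    have := (hfd.comp hct).clm_apply (continuous_const (y := x - z))
    simp only [Function.comp_def] at *
    fun_prop
  have hFTC := intervalIntegral.integral_eq_sub_of_hasDerivAt (a := 0) (b := 1)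
    (fun t _ => hder t) (hcont.intervalIntegrable _ _)
  have hz0 : (0 : ℝ) ^ d = 0 := zero_pow (by omega)
  simp only [one_pow, one_mul, hz0, zero_mul, mul_zero, sub_zero, AffineMap.homothety_one,
    AffineMap.id_apply] at hFTC
  rw [← hFTC]
  refine intervalIntegral.integral_congr fun t ht => ?_
  rw [uIcc_of_le zero_le_one] at ht
  have hp := (h.height_pos hd hz).le
  have ht0 := ht.1
  simp only [smul_eq_mul, hG]
  rw [ENNReal.toReal_ofReal (by positivity)]
  have h3 : AffineMap.homothety z t x - z = t • (x - z) := by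
    simp [AffineMap.homothety_apply]
  have h4 : t ^ d = t ^ (d - 1) * t := by
    rw [← pow_succ]; congr 1; omega
  rw [h3, map_smul, smul_eq_mul, h4]
  ring

/-- The divergence theorem on a simplex for the field `u v` with a constant vector `v`; the outer
unit normal of the facet opposite to `z` is `-height T z • affGrad (bary T z)`. -/
theorem IsSimplex.integral_fderiv (h : IsSimplex T) (hd : 1 ≤ d) {u : E d → ℝ}
    (hu : ContDiff ℝ 1 u) (v : E d) :
    ∫ x in convexHull ℝ (T : Set (E d)), fderiv ℝ u x v =
      -∑ z ∈ T, height T z * inner ℝ (affGrad (bary T z)) v * ∫ x, u x ∂facetMeasure T z := by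
  have hfd : Continuous (fderiv ℝ u) := hu.continuous_fderiv one_ne_zero
  have huc := hu.continuous
  set c : E d → ℝ := fun z => inner ℝ (affGrad (bary T z)) v with hcdef
  have hc : ∀ z, c z = bary T z (v + 0) - bary T z 0 := fun z => by
    rw [affine_sub]; simp [hcdef]
  have hc0 : ∑ z ∈ T, c z = 0 := by
    simp_rw [hc]
    rw [Finset.sum_sub_distrib, h.sum_bary, h.sum_bary, sub_self]
  have hcv : ∑ z ∈ T, c z • z = v := by
    simp_rw [hc, sub_smul]
    rw [Finset.sum_sub_distrib, h.sum_bary_smul, h.sum_bary_smul]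
    simp
  -- As the `c z` have sum zero and `∑ c z • z = v`, the constant field is `v = -∑ c z • (x - z)`.
  -- This reduces it to the radial fields of `integral_cone`; the terms `d * u x` cancel.
  have hpt : ∀ x, fderiv ℝ u x v = -∑ z ∈ T, c z * (d * u x + fderiv ℝ u x (x - z)) := by
    intro x
    have h1 : ∑ z ∈ T, c z * (d * u x + fderiv ℝ u x (x - z)) =
        (∑ z ∈ T, c z) * (d * u x + fderiv ℝ u x x) - fderiv ℝ u x (∑ z ∈ T, c z • z) := by
      rw [map_sum, Finset.sum_mul, ← Finset.sum_sub_distrib]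
      refine Finset.sum_congr rfl fun z _ => ?_
      rw [map_sub, map_smul, smul_eq_mul]; ring
    rw [h1, hc0, hcv]; ring
  simp_rw [hpt]
  rw [integral_neg, integral_finsetSum]
  · congr 1
    refine Finset.sum_congr rfl fun z hz => ?_
    rw [integral_const_mul, h.integral_cone hd hz hu]
    ring
  · intro z _
    exact continuous_integrableOn_convexHull (by fun_prop) T

/-- Integration by parts on a simplex. -/
theorem IsSimplex.integral_inner_gradient (h : IsSimplex T) (hd : 1 ≤ d) {q : E d → E d}
    {e : E d → ℝ} (hq : ContDiff ℝ 1 q) (he : ContDiff ℝ 1 e) :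
    ∫ x in convexHull ℝ (T : Set (E d)), inner ℝ (q x) (gradient e x) =
      -(∫ x in convexHull ℝ (T : Set (E d)), divergence q x * e x) -
        ∑ z ∈ T, height T z * ∫ x, inner ℝ (q x) (affGrad (bary T z)) * e x ∂facetMeasure T z := by
  have hqi : ∀ i, ContDiff ℝ 1 fun x => q x i := fun i => by fun_prop
  have hqc : ∀ i, Continuous fun x => q x i := fun i => (hqi i).continuous
  have hfq : Continuous (fderiv ℝ q) := hq.continuous_fderiv one_ne_zero
  have hfe : Continuous (fderiv ℝ e) := he.continuous_fderiv one_ne_zero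
  have hec := he.continuous
  have hdivc : Continuous (divergence q) := by
    unfold divergence
    fun_prop
  have hgrad : ∀ x w, inner ℝ w (gradient e x) = fderiv ℝ e x w := by
    intro x w
    rw [real_inner_comm]
    simp [gradient]
  have hpt : ∀ x, inner ℝ (q x) (gradient e x) + divergence q x * e x =
      ∑ i, fderiv ℝ (fun x => q x i * e x) x (EuclideanSpace.single i 1) := by
    intro x
    have h1 : ∀ i, fderiv ℝ (fun x => q x i * e x) x (EuclideanSpace.single i 1) =
        q x i * fderiv ℝ e x (EuclideanSpace.single i 1) +
          fderiv ℝ q x (EuclideanSpace.single i 1) i * e x := by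
      intro i
      have hq' : HasFDerivAt (fun x => q x i)
          ((EuclideanSpace.proj i : E d →L[ℝ] ℝ).comp (fderiv ℝ q x)) x :=
        (EuclideanSpace.proj i : E d →L[ℝ] ℝ).hasFDerivAt.comp x
          ((hq.differentiable (by simp)) x).hasFDerivAt
      have := (hq'.mul ((he.differentiable (by simp)) x).hasFDerivAt).fderiv
      rw [show (fun x => q x i * e x) = (fun x => q x i) * e from rfl, this]
      simp [mul_comm]
    simp_rw [h1]
    rw [Finset.sum_add_distrib, hgrad, divergence, Finset.sum_mul]
    congr 1
    conv_lhs => rw [← (EuclideanSpace.basisFun (Fin d) ℝ).sum_repr (q x)]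
    rw [map_sum]
    simp
  have hI1 : IntegrableOn (fun x => inner ℝ (q x) (gradient e x)) (convexHull ℝ (T : Set (E d))) := by
    refine continuous_integrableOn_convexHull ?_ T
    simp_rw [hgrad]
    exact hfe.clm_apply hq.continuous
  have hI2 : IntegrableOn (fun x => divergence q x * e x) (convexHull ℝ (T : Set (E d))) :=
    continuous_integrableOn_convexHull (hdivc.mul hec) T
  have hsum := integral_add hI1 hI2
  simp_rw [hpt] at hsum
  rw [integral_finsetSum] at hsum
  · have h2 : ∀ i, ContDiff ℝ 1 fun x => q x i * e x := fun i => (hqi i).mul he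
    simp_rw [fun i => h.integral_fderiv hd (h2 i)] at hsum
    have h3 : ∀ z ∈ T, ∫ x, inner ℝ (q x) (affGrad (bary T z)) * e x ∂facetMeasure T z =
        ∑ i, inner ℝ (affGrad (bary T z)) (EuclideanSpace.single i (1 : ℝ)) *
          ∫ x, q x i * e x ∂facetMeasure T z := by
      intro z hz
      simp_rw [← integral_const_mul]
      rw [← integral_finsetSum]
      · congr 1
        ext x
        rw [PiLp.inner_apply, Finset.sum_mul]
        refine Finset.sum_congr rfl fun i _ => ?_
        simp [EuclideanSpace.inner_single_right]
        ring
      · intro i _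
        exact (h.integrable_facet hd hz ((hqc i).mul hec)).const_mul _
    rw [Finset.sum_congr rfl fun z hz => by rw [h3 z hz]]
    rw [Finset.sum_neg_distrib, Finset.sum_comm] at hsum
    have h4 : ∑ z ∈ T, height T z * ∑ i, inner ℝ (affGrad (bary T z)) (EuclideanSpace.single i (1 : ℝ)) *
          ∫ x, q x i * e x ∂facetMeasure T z = ∑ z ∈ T, ∑ i, height T z *
            inner ℝ (affGrad (bary T z)) (EuclideanSpace.single i (1 : ℝ)) *
          ∫ x, q x i * e x ∂facetMeasure T z := by
      refine Finset.sum_congr rfl fun z _ => ?_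
      rw [Finset.mul_sum]
      exact Finset.sum_congr rfl fun i _ => by ring
    rw [h4]
    linarith
  · intro i _
    have h2 : ContDiff ℝ 1 fun x => q x i * e x := (hqi i).mul he
    exact continuous_integrableOn_convexHull
      ((h2.continuous_fderiv one_ne_zero).clm_apply continuous_const) T

/-- The outer unit normal of the facet opposite to `z`. -/
theorem IsSimplex.outerNormal_eq [DecidableEq (E d)] (h : IsSimplex T) (hd : 1 ≤ d) {z : E d}
    (hz : z ∈ T) :
    Mesh.outerNormal T (T.erase z) = -(height T z • affGrad (bary T z)) := by
  set g := affGrad (bary T z) with hg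
  have hg0 : g ≠ 0 := h.affGrad_ne_zero hd hz
  have hgn : 0 < ‖g‖ := norm_pos_iff.2 hg0
  have hp : 0 < height T z := h.height_pos hd hz
  set P : E d → Prop := fun n => ‖n‖ = 1 ∧
    (∀ x ∈ T.erase z, ∀ y ∈ T.erase z, inner ℝ (x - y) n = 0) ∧
    ∀ x ∈ T.erase z, ∀ w ∈ T, w ∉ T.erase z → inner ℝ (w - x) n < 0 with hP
  have hex : P (-(height T z • g)) := by
    refine ⟨?_, fun x hx y hy => ?_, fun x hx w hw hwF => ?_⟩
    · rw [norm_neg, norm_smul, height, ← hg, norm_inv, norm_norm, inv_mul_cancel₀ hgn.ne']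
    · have h1 := affine_sub (bary T z) x y
      rw [h.bary_of_ne (Finset.mem_of_mem_erase hx) (Finset.ne_of_mem_erase hx),
        h.bary_of_ne (Finset.mem_of_mem_erase hy) (Finset.ne_of_mem_erase hy)] at h1
      rw [inner_neg_right, inner_smul_right, real_inner_comm, ← h1]; simp
    · have hwz : w = z := by
        by_contra hne
        exact hwF (Finset.mem_erase.2 ⟨hne, hw⟩)
      subst hwz
      have h1 := affine_sub (bary T w) w x
      rw [h.bary_of_ne (Finset.mem_of_mem_erase hx) (Finset.ne_of_mem_erase hx),
        h.bary_self hw] at h1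
      rw [inner_neg_right, inner_smul_right, real_inner_comm, ← h1]
      simpa using hp
  have hn : P (Mesh.outerNormal T (T.erase z)) := Classical.epsilon_spec (p := P) ⟨_, hex⟩
  set n := Mesh.outerNormal T (T.erase z)
  obtain ⟨hn1, hn2, hn3⟩ := hn
  obtain ⟨x0, hx0, hx0z⟩ := h.exists_ne hd z
  have hx0' : x0 ∈ T.erase z := Finset.mem_erase.2 ⟨hx0z, hx0⟩
  have hneg := hn3 x0 hx0' z hz (by simp)
  set c := inner ℝ (z - x0) n with hc
  -- The conditions on a normal determine it: `l` vanishes at the vertices of the facet, hence is a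
  -- multiple of `bary T z`, and the sign and the unit length fix the factor.
  let l : E d →ᵃ[ℝ] ℝ := (innerSL ℝ n).toLinearMap.toAffineMap -
    AffineMap.const ℝ (E d) (inner ℝ n x0)
  have hl : ∀ x, l x = inner ℝ (x - x0) n := fun x => by
    simp [l, inner_sub_left, real_inner_comm]
  have hlb : l = c • bary T z := by
    refine h.affine_ext fun w hw => ?_
    rw [hl, AffineMap.coe_smul, Pi.smul_apply, smul_eq_mul]
    by_cases hwz : w = z
    · rw [hwz, h.bary_self hz, mul_one]
    · rw [h.bary_of_ne hw hwz, mul_zero]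
      exact hn2 w (Finset.mem_erase.2 ⟨hwz, hw⟩) x0 hx0'
  have hnc : n = c • g := by
    refine ext_inner_left ℝ fun v => ?_
    have h1 : l (v + x0) = c * (bary T z (v + x0)) := by rw [hlb]; rfl
    have h0 : l x0 = c * (bary T z x0) := by rw [hlb]; rfl
    have h2 := affine_sub (bary T z) (v + x0) x0
    rw [hl] at h1 h0
    simp only [add_sub_cancel_right, sub_self, inner_zero_left] at h0 h1 h2
    rw [h1, inner_smul_right, real_inner_comm, ← h2, mul_sub, ← h0, sub_zero]
  have hcn : |c| * ‖g‖ = 1 := by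
    rw [← Real.norm_eq_abs, ← norm_smul, ← hnc, hn1]
  rw [abs_of_neg hneg] at hcn
  rw [hnc, height, ← hg, ← neg_smul]
  congr 1
  field_simp
  linarith

end Cone

end SGFEM


namespace SGFEM

/-! ### Poincaré, trace and scaling estimates on simplices -/

section Local

variable {d : ℕ}

theorem norm_gradient_eq (g : E d → ℝ) (x : E d) : ‖gradient g x‖ = ‖fderiv ℝ g x‖ := by
  simp [gradient]

theorem inner_gradient (g : E d → ℝ) (x w : E d) : inner ℝ (gradient g x) w = fderiv ℝ g x w := by
  simp [gradient]

theorem continuous_gradient {g : E d → ℝ} (hg : ContDiff ℝ 1 g) : Continuous (gradient g) :=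
  (InnerProductSpace.toDual ℝ (E d)).symm.continuous.comp (hg.continuous_fderiv one_ne_zero)

theorem integral_comp_homothety (y : E d) {s : ℝ} (hs : 0 < s) (f : E d → ℝ) :
    ∫ x, f (AffineMap.homothety y s x) = (s ^ d)⁻¹ * ∫ x, f x := by
  have h1 : ∀ x, f (AffineMap.homothety y s x) = (fun x => f (s • x + y)) (x - y) := fun x => by
    simp [AffineMap.homothety_apply]
  simp_rw [h1]
  rw [integral_sub_right_eq_self (fun x => f (s • x + y)) y,
    Measure.integral_comp_smul volume (fun x => f (x + y)) s, integral_add_right_eq_self f y]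
  rw [finrank_euclideanSpace_fin, abs_of_pos (by positivity), smul_eq_mul]

theorem homothety_mem_of_convex {C : Set (E d)} (hC : Convex ℝ C) {x y : E d} (hx : x ∈ C)
    (hy : y ∈ C) {s : ℝ} (hs : 0 ≤ s) (hs1 : s ≤ 1) : AffineMap.homothety y s x ∈ C := by
  have : AffineMap.homothety y s x = (1 - s) • y + s • x := by
    rw [AffineMap.homothety_apply, vsub_eq_sub, vadd_eq_add, smul_sub, sub_smul, one_smul]; abel
  rw [this]
  exact hC hy hx (by linarith) hs (by ring)

/-- The contraction about `y ∈ C` maps the convex set `C` into itself, so the change of variables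
only integrates over a part of `C`. -/
theorem setIntegral_comp_homothety_le {C : Set (E d)} (hC : Convex ℝ C) (hCc : IsCompact C)
    {y : E d} (hy : y ∈ C) {s : ℝ} (hs : 0 < s) (hs1 : s ≤ 1) {f : E d → ℝ} (hf : Continuous f)
    (hf0 : ∀ x, 0 ≤ f x) :
    ∫ x in C, f (AffineMap.homothety y s x) ≤ (s ^ d)⁻¹ * ∫ x in C, f x := by
  have hm := hCc.isClosed.measurableSet
  rw [← integral_indicator hm (f := f), ← integral_comp_homothety y hs, ← integral_indicator hm]
  have hcont : Continuous fun x => AffineMap.homothety y s x := by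
    simp only [AffineMap.homothety_apply, vsub_eq_sub, vadd_eq_add]; fun_prop
  have hemb : IntegrableOn f C := hf.continuousOn.integrableOn_compact hCc
  have hcl : Topology.IsClosedEmbedding fun x => AffineMap.homothety y s x := by
    have : (fun x : E d => AffineMap.homothety y s x) = fun x => s • (x - y) + y := by
      ext1 x; simp [AffineMap.homothety_apply]
    rw [this]
    exact ((Homeomorph.subRight y).trans ((Homeomorph.smulOfNeZero s hs.ne').trans
      (Homeomorph.addRight y))).isClosedEmbedding
  refine integral_mono ?_ ?_ fun x => ?_
  · rw [integrable_indicator_iff hm]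
    exact (hf.comp hcont).continuousOn.integrableOn_compact hCc
  · have : (fun x => C.indicator f (AffineMap.homothety y s x)) =
        ((fun x => AffineMap.homothety y s x) ⁻¹' C).indicator
          (fun x => f (AffineMap.homothety y s x)) := by
      ext x; simp only [indicator, mem_preimage]; rfl
    rw [this, integrable_indicator_iff (hcont.measurable hm)]
    exact (hf.comp hcont).continuousOn.integrableOn_compact (hcl.isCompact_preimage hCc)
  · by_cases hx : x ∈ C
    · rw [indicator_of_mem hx, indicator_of_mem (homothety_mem_of_convex hC hx hy hs.le hs1)]
    · rw [indicator_of_notMem hx]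
      exact indicator_nonneg (fun _ _ => hf0 _) _

/-- The fundamental theorem of calculus and Cauchy–Schwarz on an interval of length `1/2`. Stopping
at the midpoint keeps the ratio `s` away from `0`, where the Jacobian `s⁻ᵈ` of the contraction about
`y` is unbounded. -/
theorem sq_sub_midpoint_le {g : E d → ℝ} (hg : ContDiff ℝ 1 g) {x y : E d} {h : ℝ}
    (hxy : ‖x - y‖ ≤ h) :
    (g x - g (AffineMap.homothety y (1 / 2 : ℝ) x)) ^ 2 ≤
      h ^ 2 / 2 * ∫ s in (1 / 2 : ℝ)..1, ‖gradient g (AffineMap.homothety y s x)‖ ^ 2 := by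
  have hfd : Continuous (fderiv ℝ g) := hg.continuous_fderiv one_ne_zero
  have hct : Continuous fun t : ℝ => AffineMap.homothety y t x := by
    simp only [AffineMap.homothety_apply, vsub_eq_sub, vadd_eq_add]; fun_prop
  have hder : ∀ t : ℝ, HasDerivAt (fun t : ℝ => g (AffineMap.homothety y t x))
      (fderiv ℝ g (AffineMap.homothety y t x) (x - y)) t := by
    intro t
    have h1 : HasDerivAt (fun t : ℝ => AffineMap.homothety y t x) (x - y) t := by
      simp only [AffineMap.homothety_apply, vsub_eq_sub, vadd_eq_add]
      simpa using ((hasDerivAt_id t).smul_const (x - y)).add_const y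
    exact ((hg.differentiable (by simp)) _).hasFDerivAt.comp_hasDerivAt t h1
  set w : ℝ → ℝ := fun t => fderiv ℝ g (AffineMap.homothety y t x) (x - y) with hw
  have hwc : Continuous w := (hfd.comp hct).clm_apply continuous_const
  have hFTC := intervalIntegral.integral_eq_sub_of_hasDerivAt (a := 1 / 2) (b := 1)
    (fun t _ => hder t) (hwc.intervalIntegrable _ _)
  simp only [AffineMap.homothety_one, AffineMap.id_apply] at hFTC
  rw [← hFTC]
  set I := ∫ t in (1 / 2 : ℝ)..1, w t with hI
  have hCS : I ^ 2 ≤ 1 / 2 * ∫ t in (1 / 2 : ℝ)..1, w t ^ 2 := by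
    have h0 : 0 ≤ ∫ t in (1 / 2 : ℝ)..1, (w t - 2 * I) ^ 2 :=
      intervalIntegral.integral_nonneg (by norm_num) fun t _ => sq_nonneg _
    have h1 : ∫ t in (1 / 2 : ℝ)..1, (w t - 2 * I) ^ 2 =
        (∫ t in (1 / 2 : ℝ)..1, w t ^ 2) - 4 * I * I + 2 * I ^ 2 := by
      have : ∀ t, (w t - 2 * I) ^ 2 = w t ^ 2 - 4 * I * w t + 4 * I ^ 2 := fun t => by ring
      simp_rw [this]
      rw [intervalIntegral.integral_add, intervalIntegral.integral_sub,
        intervalIntegral.integral_const_mul, intervalIntegral.integral_const, smul_eq_mul]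
      · ring
      all_goals exact Continuous.intervalIntegrable (by fun_prop) _ _
    nlinarith
  refine hCS.trans ?_
  have hmono : ∫ t in (1 / 2 : ℝ)..1, w t ^ 2 ≤ ∫ s in (1 / 2 : ℝ)..1,
      h ^ 2 * ‖gradient g (AffineMap.homothety y s x)‖ ^ 2 := by
    refine intervalIntegral.integral_mono_on (by norm_num)
      (Continuous.intervalIntegrable (by fun_prop) _ _)
      (Continuous.intervalIntegrable ?_ _ _) fun t _ => ?_
    · have := (continuous_gradient hg).comp hct
      simp only [Function.comp_def] at this
      fun_prop
    · rw [← mul_pow, ← sq_abs]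
      have hle := (fderiv ℝ g (AffineMap.homothety y t x)).le_opNorm (x - y)
      rw [Real.norm_eq_abs] at hle
      refine pow_le_pow_left₀ (abs_nonneg _) (hle.trans ?_) 2
      rw [norm_gradient_eq, mul_comm]
      gcongr
  rw [intervalIntegral.integral_const_mul] at hmono
  linarith

/-- After exchanging the integrals, each contraction with `s ≥ 1/2` costs at most `2 ^ d`; the other
factor `1/4` is `1/2` from the pointwise bound times the length of the interval. -/
theorem integral_sq_sub_midpoint_le {C : Set (E d)} (hC : Convex ℝ C) (hCc : IsCompact C)
    {h : ℝ} (hh : ∀ x ∈ C, ∀ y ∈ C, ‖x - y‖ ≤ h) {g : E d → ℝ} (hg : ContDiff ℝ 1 g) {y : E d}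
    (hy : y ∈ C) :
    ∫ x in C, (g x - g (AffineMap.homothety y (1 / 2 : ℝ) x)) ^ 2 ≤
      2 ^ d / 4 * h ^ 2 * ∫ x in C, ‖gradient g x‖ ^ 2 := by
  have hgc := hg.continuous
  have hgr := continuous_gradient hg
  have hm := hCc.isClosed.measurableSet
  have hc2 : Continuous fun p : E d × ℝ => AffineMap.homothety y p.2 p.1 := by
    simp only [AffineMap.homothety_apply, vsub_eq_sub, vadd_eq_add]; fun_prop
  have hc1 : ∀ s : ℝ, Continuous fun x : E d => AffineMap.homothety y s x := fun s =>
    hc2.comp (by fun_prop : Continuous fun x : E d => (x, s))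
  have hG2 : Continuous fun p : E d × ℝ => ‖gradient g (AffineMap.homothety y p.2 p.1)‖ ^ 2 := by
    have := hgr.comp hc2
    simp only [Function.comp_def] at this
    fun_prop
  have hint : Integrable (fun p : E d × ℝ => ‖gradient g (AffineMap.homothety y p.2 p.1)‖ ^ 2)
      ((volume.restrict C).prod (volume.restrict (Ioc (1 / 2 : ℝ) 1))) := by
    rw [Measure.prod_restrict]
    have : IntegrableOn (fun p : E d × ℝ => ‖gradient g (AffineMap.homothety y p.2 p.1)‖ ^ 2)
        (C ×ˢ Icc (1 / 2 : ℝ) 1) (volume.prod volume) :=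
      hG2.continuousOn.integrableOn_compact (hCc.prod isCompact_Icc)
    exact this.mono_set (prod_mono le_rfl Ioc_subset_Icc_self)
  have hstep : ∫ x in C, (g x - g (AffineMap.homothety y (1 / 2 : ℝ) x)) ^ 2 ≤
      ∫ x in C, h ^ 2 / 2 * ∫ s in Ioc (1 / 2 : ℝ) 1,
        ‖gradient g (AffineMap.homothety y s x)‖ ^ 2 := by
    refine setIntegral_mono_on ?_ (hint.integral_prod_left.const_mul _) hm fun x hx => ?_
    · have := hgc.comp (hc1 (1 / 2))
      simp only [Function.comp_def] at this
      exact ContinuousOn.integrableOn_compact hCc (Continuous.continuousOn (by fun_prop))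
    · have := sq_sub_midpoint_le hg (hh x hx y hy)
      rwa [intervalIntegral.integral_of_le (by norm_num)] at this
  refine hstep.trans ?_
  rw [integral_const_mul, integral_integral_swap hint]
  have hb : ∫ s in Ioc (1 / 2 : ℝ) 1, ∫ x in C, ‖gradient g (AffineMap.homothety y s x)‖ ^ 2 ≤
      ∫ s in Ioc (1 / 2 : ℝ) 1, 2 ^ d * ∫ x in C, ‖gradient g x‖ ^ 2 := by
    refine setIntegral_mono_on hint.integral_prod_right (integrable_const _) measurableSet_Ioc
      fun s hs => ?_
    refine (setIntegral_comp_homothety_le hC hCc hy (by linarith [hs.1]) hs.2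
      (f := fun x => ‖gradient g x‖ ^ 2) (by fun_prop) fun x => by positivity).trans ?_
    gcongr
    rw [← inv_pow]
    refine pow_le_pow_left₀ (inv_nonneg.2 (by linarith [hs.1])) ?_ d
    rw [inv_le_comm₀ (by linarith [hs.1]) (by norm_num)]
    linarith [hs.1]
  rw [setIntegral_const, smul_eq_mul] at hb
  simp only [measureReal_def, Real.volume_Ioc] at hb
  rw [ENNReal.toReal_ofReal (by norm_num)] at hb
  nlinarith [mul_le_mul_of_nonneg_left hb (by positivity : (0 : ℝ) ≤ h ^ 2 / 2)]

/-- The Poincaré inequality on a compact convex set of diameter at most `h`. -/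
theorem poincare_convex {C : Set (E d)} (hC : Convex ℝ C) (hCc : IsCompact C)
    {h : ℝ} (hh : ∀ x ∈ C, ∀ y ∈ C, ‖x - y‖ ≤ h) (hV : 0 < volume.real C) {g : E d → ℝ}
    (hg : ContDiff ℝ 1 g) :
    ∫ x in C, (g x - (volume.real C)⁻¹ * ∫ y in C, g y) ^ 2 ≤
      2 ^ d * h ^ 2 * ∫ x in C, ‖gradient g x‖ ^ 2 := by
  have hgc := hg.continuous
  set V := volume.real C with hVdef
  set D := ∫ x in C, ‖gradient g x‖ ^ 2 with hD
  have hfin : IsFiniteMeasure (volume.restrict C) := ⟨by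
    rw [Measure.restrict_apply_univ]; exact hCc.measure_lt_top⟩
  have hm := hCc.isClosed.measurableSet
  have hI : ∀ {f : E d → ℝ}, Continuous f → Integrable f (volume.restrict C) := fun hf =>
    hf.continuousOn.integrableOn_compact hCc
  have hI2 : ∀ {f : E d × E d → ℝ}, Continuous f →
      Integrable f ((volume.restrict C).prod (volume.restrict C)) := fun hf => by
    rw [Measure.prod_restrict]
    exact hf.continuousOn.integrableOn_compact (hCc.prod hCc)
  have hc2 : Continuous fun p : E d × E d => AffineMap.homothety p.2 (1 / 2 : ℝ) p.1 := by
    simp only [AffineMap.homothety_apply, vsub_eq_sub, vadd_eq_add]; fun_prop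
  set A : E d × E d → ℝ := fun p => (g p.1 - g (AffineMap.homothety p.2 (1 / 2 : ℝ) p.1)) ^ 2
    with hA
  have hAc : Continuous A := by
    have := hgc.comp hc2
    simp only [Function.comp_def] at this
    fun_prop
  -- The midpoint is symmetric in `x` and `y`, so `g x - g y` splits there into two differences of
  -- the kind already bounded.
  have hsymm : ∀ x y : E d, AffineMap.homothety y (1 / 2 : ℝ) x =
      AffineMap.homothety x (1 / 2 : ℝ) y := by
    intro x y
    simp only [AffineMap.homothety_apply, vsub_eq_sub, vadd_eq_add]
    module
  have hAb : ∀ y ∈ C, ∫ x in C, A (x, y) ≤ 2 ^ d / 4 * h ^ 2 * D := fun y hy =>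
    integral_sq_sub_midpoint_le hC hCc hh hg hy
  have hJ : ∫ y in C, ∫ x in C, A (x, y) ≤ V * (2 ^ d / 4 * h ^ 2 * D) := by
    calc _ ≤ ∫ y in C, (2 ^ d / 4 * h ^ 2 * D) :=
          setIntegral_mono_on (hI2 hAc).integral_prod_right (integrable_const _) hm hAb
      _ = _ := by rw [setIntegral_const, smul_eq_mul]
  have hJ2 : ∫ x in C, ∫ y in C, A (x, y) ≤ V * (2 ^ d / 4 * h ^ 2 * D) := by
    rw [integral_integral_swap (f := fun x y => A (x, y)) (hI2 hAc)]
    exact hJ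
  have htot : ∫ x in C, ∫ y in C, (g x - g y) ^ 2 ≤ V * (2 ^ d * h ^ 2 * D) := by
    have hle : ∫ x in C, ∫ y in C, (g x - g y) ^ 2 ≤
        ∫ x in C, ∫ y in C, (2 * A (x, y) + 2 * A (y, x)) := by
      refine setIntegral_mono_on (hI2 (f := fun p => (g p.1 - g p.2) ^ 2)
        (by fun_prop)).integral_prod_left (hI2 (f := fun p => 2 * A p + 2 * A (p.2, p.1))
        (by fun_prop)).integral_prod_left hm fun x _ => ?_
      refine integral_mono (hI (by fun_prop)) (hI (by fun_prop)) fun y => ?_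
      simp only [hA]
      rw [hsymm x y]
      nlinarith [sq_nonneg (g x - g (AffineMap.homothety x (1 / 2 : ℝ) y) +
        (g y - g (AffineMap.homothety x (1 / 2 : ℝ) y)))]
    refine hle.trans ?_
    have hsplit : ∫ x in C, ∫ y in C, (2 * A (x, y) + 2 * A (y, x)) =
        2 * (∫ x in C, ∫ y in C, A (x, y)) + 2 * ∫ x in C, ∫ y in C, A (y, x) := by
      rw [← integral_const_mul, ← integral_const_mul, ← integral_add]
      · congr 1; ext x
        rw [← integral_const_mul, ← integral_const_mul, ← integral_add]
        · exact hI (by fun_prop)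
        · exact hI (by fun_prop)
      · exact (hI2 hAc).integral_prod_left.const_mul _
      · exact (hI2 hAc).integral_prod_right.const_mul _
    rw [hsplit]
    linarith
  -- The variance identity, which passes from pairs of points to the deviation from the mean.
  have hid : ∫ x in C, ∫ y in C, (g x - g y) ^ 2 =
      2 * V * ∫ x in C, (g x - V⁻¹ * ∫ y in C, g y) ^ 2 := by
    set m := ∫ y in C, g y with hmdef
    have e1 : ∀ x, ∫ y in C, (g x - g y) ^ 2 = V * g x ^ 2 - 2 * m * g x + ∫ y in C, g y ^ 2 := by
      intro x
      have : ∀ y, (g x - g y) ^ 2 = g x ^ 2 - 2 * g x * g y + g y ^ 2 := fun y => by ring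
      simp_rw [this]
      rw [integral_add, integral_sub, integral_const_mul, setIntegral_const, smul_eq_mul]
      · ring
      all_goals exact hI (by fun_prop)
    simp_rw [e1]
    have e2 : ∀ x, (g x - V⁻¹ * m) ^ 2 = g x ^ 2 - 2 * (V⁻¹ * m) * g x + (V⁻¹ * m) ^ 2 :=
      fun x => by ring
    simp_rw [e2]
    rw [integral_add, integral_sub, integral_const_mul, integral_const_mul, setIntegral_const,
      smul_eq_mul, integral_add, integral_sub, integral_const_mul, setIntegral_const, smul_eq_mul,
      ← hmdef, ← hVdef]
    · field_simp; ring
    all_goals exact hI (by fun_prop)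
  rw [hid] at htot
  have hnn : 0 ≤ ∫ x in C, (g x - V⁻¹ * ∫ y in C, g y) ^ 2 := integral_nonneg fun x => sq_nonneg _
  have : V * ∫ x in C, (g x - V⁻¹ * ∫ y in C, g y) ^ 2 ≤ V * (2 ^ d * h ^ 2 * D) := by
    nlinarith
  exact le_of_mul_le_mul_left this hV

end Local

end SGFEM


namespace SGFEM

/-! ### Shape-regular simplices: scaling, traces and means of neighbours -/

section Regular

variable {d : ℕ} {T T' : Finset (E d)} {K : ℝ}

/-- `T` is a nondegenerate simplex that contains a ball of radius `r` with `h_T ≤ K r`. -/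
def IsRegularSimplex (K : ℝ) (T : Finset (E d)) : Prop :=
  IsSimplex T ∧ ∃ (x : E d) (r : ℝ), 0 < r ∧
    Metric.closedBall x r ⊆ convexHull ℝ (T : Set (E d)) ∧ Mesh.size T ≤ K * r

/-- The volume of a simplex. -/
noncomputable def simplexVol (T : Finset (E d)) : ℝ := volume.real (convexHull ℝ (T : Set (E d)))

/-- The mean value over a simplex. -/
noncomputable def simplexMean (T : Finset (E d)) (g : E d → ℝ) : ℝ :=
  (simplexVol T)⁻¹ * ∫ y in convexHull ℝ (T : Set (E d)), g y

/-- The squared `L²` norm of the gradient on a simplex. -/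
noncomputable def energy (T : Finset (E d)) (g : E d → ℝ) : ℝ :=
  ∫ x in convexHull ℝ (T : Set (E d)), ‖gradient g x‖ ^ 2

theorem energy_nonneg (T : Finset (E d)) (g : E d → ℝ) : 0 ≤ energy T g :=
  integral_nonneg fun _ => by positivity

theorem norm_sub_le_size (T : Finset (E d)) {x y : E d} (hx : x ∈ convexHull ℝ (T : Set (E d)))
    (hy : y ∈ convexHull ℝ (T : Set (E d))) : ‖x - y‖ ≤ Mesh.size T := by
  rw [← dist_eq_norm]
  exact Metric.dist_le_diam_of_mem (convexHull_isCompact T).isBounded hx hy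

theorem mem_hull {z : E d} (hz : z ∈ T) : z ∈ convexHull ℝ (T : Set (E d)) :=
  subset_convexHull ℝ _ hz

theorem size_nonneg (T : Finset (E d)) : 0 ≤ Mesh.size T := Metric.diam_nonneg

theorem IsSimplex.bary_le_one (h : IsSimplex T) (z : E d) {x : E d}
    (hx : x ∈ convexHull ℝ (T : Set (E d))) : bary T z x ≤ 1 := by
  by_cases hz : z ∈ T
  · rw [← h.sum_bary x]
    exact Finset.single_le_sum (f := fun w => bary T w x)
      (fun w hw => h.mem_convexHull.1 hx w hw) hz
  · rw [bary_of_notMem hz]; simp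

theorem IsSimplex.bary_nonneg (h : IsSimplex T) (z : E d) {x : E d}
    (hx : x ∈ convexHull ℝ (T : Set (E d))) : 0 ≤ bary T z x := by
  by_cases hz : z ∈ T
  · exact h.mem_convexHull.1 hx z hz
  · rw [bary_of_notMem hz]; simp

/-- Going from the centre of the ball a distance `r` along the gradient raises the coordinate by `r`
times the gradient norm, while the coordinate stays between `0` and `1` in the simplex. -/
theorem IsSimplex.norm_affGrad_le (h : IsSimplex T) (z : E d) {x : E d} {r : ℝ} (hr : 0 < r)
    (hb : Metric.closedBall x r ⊆ convexHull ℝ (T : Set (E d))) :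
    ‖affGrad (bary T z)‖ ≤ r⁻¹ := by
  set g := affGrad (bary T z) with hg
  by_cases hg0 : g = 0
  · rw [hg0, norm_zero]; positivity
  have hgn : 0 < ‖g‖ := norm_pos_iff.2 hg0
  have hy : x + (r * ‖g‖⁻¹) • g ∈ Metric.closedBall x r := by
    rw [Metric.mem_closedBall, dist_eq_norm, add_sub_cancel_left, norm_smul, norm_mul, norm_inv,
      norm_norm, mul_assoc, inv_mul_cancel₀ hgn.ne', mul_one, Real.norm_of_nonneg hr.le]
  have h1 := affine_sub (bary T z) (x + (r * ‖g‖⁻¹) • g) x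
  rw [add_sub_cancel_left, inner_smul_right, ← hg, real_inner_self_eq_norm_sq] at h1
  have h2 := h.bary_le_one z (hb hy)
  have h3 := h.bary_nonneg z (hb (Metric.mem_closedBall_self hr.le))
  have h4 : r * ‖g‖⁻¹ * ‖g‖ ^ 2 = r * ‖g‖ := by field_simp
  rw [h4] at h1
  rw [← one_div, le_div_iff₀ hr]
  linarith

theorem IsSimplex.radius_le_height (h : IsSimplex T) (hd : 1 ≤ d) {z : E d} (hz : z ∈ T) {x : E d}
    {r : ℝ} (hr : 0 < r) (hb : Metric.closedBall x r ⊆ convexHull ℝ (T : Set (E d))) :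
    r ≤ height T z := by
  have h1 := h.norm_affGrad_le z hr hb
  rw [height, le_inv_comm₀ hr (norm_pos_iff.2 (h.affGrad_ne_zero hd hz))]
  exact h1

theorem IsSimplex.height_le_norm_sub (h : IsSimplex T) (hd : 1 ≤ d) {z w : E d} (hz : z ∈ T)
    (hw : w ∈ T) (hne : w ≠ z) : height T z ≤ ‖z - w‖ := by
  have h1 := affine_sub (bary T z) z w
  rw [h.bary_self hz, h.bary_of_ne hw hne, sub_zero] at h1
  have h2 := real_inner_le_norm (affGrad (bary T z)) (z - w)
  rw [← h1] at h2
  rw [height, inv_le_iff_one_le_mul₀' (norm_pos_iff.2 (h.affGrad_ne_zero hd hz))]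
  exact h2

theorem IsSimplex.height_le_size (h : IsSimplex T) (hd : 1 ≤ d) {z : E d} (hz : z ∈ T) :
    height T z ≤ Mesh.size T := by
  obtain ⟨w, hw, hne⟩ := h.exists_ne hd z
  exact (h.height_le_norm_sub hd hz hw hne).trans (norm_sub_le_size T (mem_hull hz) (mem_hull hw))

theorem IsSimplex.nonempty (h : IsSimplex T) : T.Nonempty := by
  rw [← Finset.card_pos, h.1]; omega

theorem IsRegularSimplex.size_pos (h : IsRegularSimplex K T) (hd : 1 ≤ d) : 0 < Mesh.size T := by
  obtain ⟨hT, x, r, hr, hb, hs⟩ := h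
  obtain ⟨z, hz⟩ := hT.nonempty
  exact (hT.height_pos hd hz).trans_le (hT.height_le_size hd hz)

theorem IsRegularSimplex.one_le (h : IsRegularSimplex K T) (hd : 1 ≤ d) : 1 ≤ K := by
  obtain ⟨hT, x, r, hr, hb, hs⟩ := h
  obtain ⟨z, hz⟩ := hT.nonempty
  have h1 := (hT.radius_le_height hd hz hr hb).trans (hT.height_le_size hd hz)
  have : 1 * r ≤ K * r := by linarith
  exact le_of_mul_le_mul_right this hr

theorem IsRegularSimplex.norm_affGrad_le (h : IsRegularSimplex K T) (hd : 1 ≤ d) (z : E d) :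
    ‖affGrad (bary T z)‖ ≤ K / Mesh.size T := by
  have hs0 := h.size_pos hd
  obtain ⟨hT, x, r, hr, hb, hs⟩ := h
  refine (hT.norm_affGrad_le z hr hb).trans ?_
  rw [inv_le_iff_one_le_mul₀ hr, div_mul_eq_mul_div, le_div_iff₀ hs0]
  linarith

theorem IsRegularSimplex.size_le_height (h : IsRegularSimplex K T) (hd : 1 ≤ d) {z : E d}
    (hz : z ∈ T) : Mesh.size T ≤ K * height T z := by
  have hK := h.one_le hd
  obtain ⟨hT, x, r, hr, hb, hs⟩ := h
  exact hs.trans (mul_le_mul_of_nonneg_left (hT.radius_le_height hd hz hr hb) (by linarith))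

theorem IsRegularSimplex.size_le_norm_sub (h : IsRegularSimplex K T) (hd : 1 ≤ d) {z w : E d}
    (hz : z ∈ T) (hw : w ∈ T) (hne : w ≠ z) : Mesh.size T ≤ K * ‖z - w‖ :=
  (h.size_le_height hd hz).trans (mul_le_mul_of_nonneg_left (h.1.height_le_norm_sub hd hz hw hne)
    (by linarith [h.one_le hd]))

/-- The size of a regular simplex is bounded by the size of any edge. -/
theorem IsRegularSimplex.size_le_of_edge (h : IsRegularSimplex K T) (hd : 1 ≤ d)
    {S : Finset (E d)} {z w : E d} (hz : z ∈ T) (hw : w ∈ T) (hne : w ≠ z) (hz' : z ∈ S)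
    (hw' : w ∈ S) : Mesh.size T ≤ K * Mesh.size S :=
  (h.size_le_norm_sub hd hz hw hne).trans (mul_le_mul_of_nonneg_left
    (norm_sub_le_size S (mem_hull hz') (mem_hull hw')) (by linarith [h.one_le hd]))

theorem IsSimplex.vol_pos (h : IsSimplex T) : 0 < simplexVol T := by
  have h1 : 0 < volume (convexHull ℝ (T : Set (E d))) :=
    ((openSimplex_isOpen T).measure_pos volume h.openSimplex_nonempty).trans_le
      (measure_mono (openSimplex_subset T))
  exact ENNReal.toReal_pos h1.ne' (convexHull_isCompact T).measure_lt_top.ne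

/-- The volume of the unit ball. -/
noncomputable def ballVol (d : ℕ) : ℝ := volume.real (Metric.ball (0 : E d) 1)

theorem ballVol_pos (d : ℕ) : 0 < ballVol d :=
  ENNReal.toReal_pos (Metric.measure_ball_pos _ _ one_pos).ne' measure_ball_lt_top.ne

theorem simplexVol_le (T : Finset (E d)) (hT : T.Nonempty) :
    simplexVol T ≤ ballVol d * Mesh.size T ^ d := by
  obtain ⟨z, hz⟩ := hT
  have hsub : convexHull ℝ (T : Set (E d)) ⊆ Metric.closedBall z (Mesh.size T) := fun x hx => by
    rw [Metric.mem_closedBall, dist_eq_norm]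
    exact norm_sub_le_size T hx (mem_hull hz)
  have h1 := measureReal_mono (μ := volume) hsub measure_closedBall_lt_top.ne
  rw [Measure.addHaar_real_closedBall _ _ (size_nonneg T), finrank_euclideanSpace_fin] at h1
  rw [simplexVol, ballVol]
  linarith

theorem IsRegularSimplex.le_simplexVol (h : IsRegularSimplex K T) (hd : 1 ≤ d) :
    ballVol d * Mesh.size T ^ d ≤ K ^ d * simplexVol T := by
  have hK := h.one_le hd
  obtain ⟨hT, x, r, hr, hb, hs⟩ := h
  have h1 := measureReal_mono (μ := volume) hb (convexHull_isCompact T).measure_lt_top.ne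
  rw [Measure.addHaar_real_closedBall _ _ hr.le, finrank_euclideanSpace_fin] at h1
  have h2 : Mesh.size T ^ d ≤ (K * r) ^ d := pow_le_pow_left₀ (size_nonneg T) hs d
  have hb0 := ballVol_pos d
  calc ballVol d * Mesh.size T ^ d ≤ ballVol d * (K * r) ^ d := by gcongr
    _ = K ^ d * (r ^ d * ballVol d) := by rw [mul_pow]; ring
    _ ≤ _ := by rw [ballVol, simplexVol]; gcongr

/-- Poincaré inequality on a simplex. -/
theorem IsSimplex.poincare (h : IsSimplex T) {g : E d → ℝ} (hg : ContDiff ℝ 1 g) :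
    ∫ x in convexHull ℝ (T : Set (E d)), (g x - simplexMean T g) ^ 2 ≤
      2 ^ d * Mesh.size T ^ 2 * energy T g :=
  poincare_convex (convex_convexHull ℝ _) (convexHull_isCompact T)
    (fun _ hx _ hy => norm_sub_le_size T hx hy) h.vol_pos hg

/-- Trace inequality on a facet. -/
theorem IsSimplex.trace (h : IsSimplex T) (hd : 1 ≤ d) {z : E d} (hz : z ∈ T) {g : E d → ℝ}
    (hg : ContDiff ℝ 1 g) :
    height T z * ∫ x, g x ^ 2 ∂facetMeasure T z ≤
      (d + 1) * (∫ x in convexHull ℝ (T : Set (E d)), g x ^ 2) + Mesh.size T ^ 2 * energy T g := by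
  have hgc := hg.continuous
  have hgr := continuous_gradient hg
  have hfd : Continuous (fderiv ℝ g) := hg.continuous_fderiv one_ne_zero
  have hg2 : ContDiff ℝ 1 fun x => g x ^ 2 := hg.pow 2
  have hder : ∀ x v, fderiv ℝ (fun x => g x ^ 2) x v = 2 * g x * fderiv ℝ g x v := by
    intro x v
    have := ((hg.differentiable (by simp)) x).hasFDerivAt.pow 2
    rw [this.fderiv]
    simp
  -- The cone formula for `g ^ 2` turns the facet integral into a volume integral. Its radial
  -- derivative `2 * g * fderiv ℝ g x (x - z)` is split by Young's inequality, which raises the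
  -- coefficient `d` of `g ^ 2` to `d + 1`.
  rw [← h.integral_cone hd hz hg2, energy, ← integral_const_mul, ← integral_const_mul,
    ← integral_add (continuous_integrableOn_convexHull (by fun_prop) T)
      (continuous_integrableOn_convexHull (by fun_prop) T)]
  have hfd2 : Continuous (fderiv ℝ fun x => g x ^ 2) := hg2.continuous_fderiv one_ne_zero
  refine setIntegral_mono_on (continuous_integrableOn_convexHull (by fun_prop) T)
    (continuous_integrableOn_convexHull (by fun_prop) T) (convexHull_isClosed T).measurableSet
    fun x hx => ?_
  rw [hder]
  have h1 := (le_abs_self _).trans ((fderiv ℝ g x).le_opNorm (x - z))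
  have h1' := (neg_le_abs _).trans ((fderiv ℝ g x).le_opNorm (x - z))
  rw [← norm_gradient_eq] at h1 h1'
  have h2 := norm_sub_le_size T hx (mem_hull hz)
  have h3 : |fderiv ℝ g x (x - z)| ≤ Mesh.size T * ‖gradient g x‖ := by
    rw [abs_le]
    have : ‖gradient g x‖ * ‖x - z‖ ≤ Mesh.size T * ‖gradient g x‖ := by
      rw [mul_comm]; gcongr
    constructor <;> linarith
  have h4 : (fderiv ℝ g x (x - z)) ^ 2 ≤ Mesh.size T ^ 2 * ‖gradient g x‖ ^ 2 := by
    rw [← mul_pow, ← sq_abs]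
    exact pow_le_pow_left₀ (abs_nonneg _) h3 2
  nlinarith [sq_nonneg (g x - fderiv ℝ g x (x - z))]

/-- The surface area of a facet. -/
noncomputable def facetArea (T : Finset (E d)) (z : E d) : ℝ := (facetMeasure T z).real univ

theorem IsSimplex.vol_le_facetArea (h : IsSimplex T) (hd : 1 ≤ d) {z : E d} (hz : z ∈ T) :
    simplexVol T ≤ Mesh.size T * facetArea T z := by
  have h1 := h.volume_eq_facet hd hz
  have h2 : simplexVol T = height T z / d * facetArea T z := by
    have hp := h.height_pos hd hz
    rw [simplexVol, measureReal_def, h1, ENNReal.toReal_mul, ENNReal.toReal_ofReal (by positivity),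
      facetArea, measureReal_def, facetMeasure, Measure.restrict_apply_univ]
  rw [h2]
  have h3 : height T z / d ≤ Mesh.size T := by
    refine (div_le_self (h.height_pos hd hz).le (by exact_mod_cast hd)).trans (h.height_le_size hd hz)
  exact mul_le_mul_of_nonneg_right h3 measureReal_nonneg

/-- The constant of the estimate `facet_deviation`. -/
noncomputable def traceConst (d : ℕ) (K : ℝ) : ℝ := K * ((d + 1) * 2 ^ d + 1)

theorem traceConst_nonneg (d : ℕ) (hK : 1 ≤ K) : 0 ≤ traceConst d K := by
  unfold traceConst; positivity

theorem gradient_sub_const (g : E d → ℝ) (m : ℝ) :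
    gradient (fun x => g x - m) = gradient g := by
  ext1 x
  simp [gradient, fderiv_sub_const]

/-- The trace inequality for `g` minus its mean, with the volume term bounded by Poincaré. Replacing
the height by the diameter costs the factor `K`. -/
theorem IsRegularSimplex.facet_deviation (h : IsRegularSimplex K T) (hd : 1 ≤ d) {z : E d}
    (hz : z ∈ T) {g : E d → ℝ} (hg : ContDiff ℝ 1 g) :
    ∫ x, (g x - simplexMean T g) ^ 2 ∂facetMeasure T z ≤
      traceConst d K * Mesh.size T * energy T g := by
  have hs0 := h.size_pos hd
  have h1 := h.1.trace hd hz (hg.sub contDiff_const : ContDiff ℝ 1 fun x => g x - simplexMean T g)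
  have h2 := h.1.poincare hg
  have h3 : energy T (fun x => g x - simplexMean T g) = energy T g := by
    rw [energy, energy, gradient_sub_const]
  rw [h3] at h1
  set J := ∫ x, (g x - simplexMean T g) ^ 2 ∂facetMeasure T z
  have hJ : 0 ≤ J := integral_nonneg fun _ => sq_nonneg _
  have h4 : height T z * J ≤ ((d + 1) * 2 ^ d + 1) * Mesh.size T ^ 2 * energy T g := by
    have : ((d : ℝ) + 1) * (∫ x in convexHull ℝ (T : Set (E d)), (g x - simplexMean T g) ^ 2) ≤
      (d + 1) * (2 ^ d * Mesh.size T ^ 2 * energy T g) := by gcongr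
    linarith
  have h5 := h.size_le_height hd hz
  have hK := h.one_le hd
  have h6 : Mesh.size T * J ≤ Mesh.size T * (traceConst d K * Mesh.size T * energy T g) := by
    calc Mesh.size T * J ≤ K * height T z * J := by gcongr
      _ = K * (height T z * J) := by ring
      _ ≤ K * (((d + 1) * 2 ^ d + 1) * Mesh.size T ^ 2 * energy T g) := by gcongr
      _ = _ := by rw [traceConst]; ring
  exact le_of_mul_le_mul_left h6 hs0

/-- Mean values on neighbouring simplices. -/
theorem IsRegularSimplex.mean_sub_mean (h : IsRegularSimplex K T) (h' : IsRegularSimplex K T')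
    (hd : 1 ≤ d) {z z' : E d} (hz : z ∈ T) (hz' : z' ∈ T')
    (hF : facetMeasure T z = facetMeasure T' z') (hs : Mesh.size T' ≤ K * Mesh.size T)
    {g : E d → ℝ} (hg : ContDiff ℝ 1 g) :
    simplexVol T * (simplexMean T g - simplexMean T' g) ^ 2 ≤
      2 * K * traceConst d K * Mesh.size T ^ 2 * (energy T g + energy T' g) := by
  have hK := h.one_le hd
  have hgc := hg.continuous
  have := h.1.isFiniteMeasure_facet hd hz
  set m := simplexMean T g with hm
  set m' := simplexMean T' g with hm'
  -- The difference of the means is integrated over the common facet, where both are close to the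
  -- same trace of `g`.
  have hle : ∫ x, (m - m') ^ 2 ∂facetMeasure T z ≤
      ∫ x, (2 * (g x - m) ^ 2 + 2 * (g x - m') ^ 2) ∂facetMeasure T z := by
    refine integral_mono (integrable_const _) (h.1.integrable_facet hd hz (by fun_prop)) fun x => ?_
    nlinarith [sq_nonneg (g x - m + (g x - m'))]
  rw [integral_const, smul_eq_mul, integral_add (h.1.integrable_facet hd hz (by fun_prop))
    (h.1.integrable_facet hd hz (by fun_prop)), integral_const_mul, integral_const_mul] at hle
  have h1 := h.facet_deviation hd hz hg
  have h2 := h'.facet_deviation hd hz' hg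
  rw [← hF] at h2
  have h3 := h.1.vol_le_facetArea hd hz
  have hC := traceConst_nonneg d hK
  have he := energy_nonneg T g
  have he' := energy_nonneg T' g
  have hs0 := size_nonneg T
  have h4 : facetArea T z * (m - m') ^ 2 ≤
      2 * K * traceConst d K * Mesh.size T * (energy T g + energy T' g) := by
    have a1 : traceConst d K * Mesh.size T * energy T g ≤
        K * (traceConst d K * Mesh.size T * energy T g) :=
      le_mul_of_one_le_left (by positivity) hK
    have a2 : traceConst d K * Mesh.size T' * energy T' g ≤
        traceConst d K * (K * Mesh.size T) * energy T' g := by gcongr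
    rw [facetArea]
    linarith
  calc _ ≤ Mesh.size T * facetArea T z * (m - m') ^ 2 := by gcongr
    _ = Mesh.size T * (facetArea T z * (m - m') ^ 2) := by ring
    _ ≤ Mesh.size T * (2 * K * traceConst d K * Mesh.size T * (energy T g + energy T' g)) := by
        gcongr
    _ = _ := by ring

/-- The mean value of a function that vanishes on a facet. -/
theorem IsRegularSimplex.mean_of_facet_eq_zero (h : IsRegularSimplex K T) (hd : 1 ≤ d) {z : E d}
    (hz : z ∈ T) {g : E d → ℝ} (hg : ContDiff ℝ 1 g) (hg0 : ∀ x ∈ facetSet T z, g x = 0) :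
    simplexVol T * simplexMean T g ^ 2 ≤ traceConst d K * Mesh.size T ^ 2 * energy T g := by
  have := h.1.isFiniteMeasure_facet hd hz
  have h1 := h.facet_deviation hd hz hg
  have h2 : ∫ x, (g x - simplexMean T g) ^ 2 ∂facetMeasure T z =
      facetArea T z * simplexMean T g ^ 2 := by
    have : ∫ x, (g x - simplexMean T g) ^ 2 ∂facetMeasure T z =
        ∫ x, (simplexMean T g) ^ 2 ∂facetMeasure T z := by
      refine integral_congr_ae ?_
      filter_upwards [ae_restrict_mem (facetSet_isClosed T z).measurableSet] with x hx
      rw [hg0 x hx]; ring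
    rw [this, integral_const, smul_eq_mul, facetArea]
  rw [h2] at h1
  have h3 := h.1.vol_le_facetArea hd hz
  have hs0 := size_nonneg T
  calc _ ≤ Mesh.size T * facetArea T z * simplexMean T g ^ 2 := by gcongr
    _ = Mesh.size T * (facetArea T z * simplexMean T g ^ 2) := by ring
    _ ≤ Mesh.size T * (traceConst d K * Mesh.size T * energy T g) := by gcongr
    _ = _ := by ring

/-- Comparison of the volumes of regular simplices of comparable size. -/
theorem IsRegularSimplex.vol_le_vol (h : IsRegularSimplex K T) (h' : IsRegularSimplex K T')
    (hd : 1 ≤ d) {c : ℝ} (hs : Mesh.size T ≤ c * Mesh.size T') :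
    simplexVol T ≤ (c * K) ^ d * simplexVol T' := by
  have h1 := simplexVol_le T h.1.nonempty
  have h2 := h'.le_simplexVol hd
  have hs' := h'.size_pos hd
  have hc : 0 ≤ c := by
    have := h.size_pos hd
    by_contra hc
    nlinarith
  calc simplexVol T ≤ ballVol d * Mesh.size T ^ d := h1
    _ ≤ ballVol d * (c * Mesh.size T') ^ d := by
        have := (ballVol_pos d).le
        have := size_nonneg T
        gcongr
    _ = c ^ d * (ballVol d * Mesh.size T' ^ d) := by rw [mul_pow]; ring
    _ ≤ c ^ d * (K ^ d * simplexVol T') := by gcongr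
    _ = _ := by rw [mul_pow]; ring

end Regular

end SGFEM


namespace SGFEM

/-! ### Combinatorics of simplicial meshes -/

section MeshGeometry

open scoped Topology Classical

variable {d : ℕ} {M : Mesh d} {T T' : Finset (E d)}

/-- The pigeonhole principle for filters. It selects one element, or one cone, that is met
arbitrarily close to a limit point. -/
theorem exists_frequently_finset {α β : Type*} {l : Filter α} {S : Finset β} {P : β → α → Prop}
    (h : ∃ᶠ x in l, ∃ b ∈ S, P b x) : ∃ b ∈ S, ∃ᶠ x in l, P b x := by
  by_contra! hc
  refine h ?_
  have : ∀ᶠ x in l, ∀ b ∈ S, ¬ P b x :=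
    (eventually_all_finset S).2 fun b hb => hc b hb
  filter_upwards [this] with x hx
  simpa using hx

theorem mem_elements : T ∈ M.elements ↔ T ∈ M.faces ∧ T.card = d + 1 := by
  simp [Mesh.elements]

theorem isSimplex_of_mem (hT : T ∈ M.elements) : IsSimplex T :=
  ⟨(mem_elements.1 hT).2, M.indep (mem_elements.1 hT).1⟩

theorem mem_space_iff_elements {x : E d} :
    x ∈ M.toSimplicialComplex.space ↔ ∃ T ∈ M.elements, x ∈ convexHull ℝ (T : Set (E d)) := by
  rw [Geometry.SimplicialComplex.mem_space_iff]
  constructor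
  · rintro ⟨s, hs, hx⟩
    obtain ⟨t, ht, hst, hc⟩ := M.pure s hs
    exact ⟨t, mem_elements.2 ⟨ht, hc⟩, convexHull_mono (by exact_mod_cast hst) hx⟩
  · rintro ⟨T, hT, hx⟩
    exact ⟨T, (mem_elements.1 hT).1, hx⟩

/-- Barycentric coordinates agree on the intersection of two elements. -/
theorem bary_eq_bary (hT : T ∈ M.elements) (hT' : T' ∈ M.elements) {x : E d}
    (hx : x ∈ convexHull ℝ (T : Set (E d))) (hx' : x ∈ convexHull ℝ (T' : Set (E d))) (z : E d) :
    bary T z x = bary T' z x := by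
  have h := isSimplex_of_mem hT
  have h' := isSimplex_of_mem hT'
  -- Conformity of the mesh: a common point lies in the hull of the common vertices, where both
  -- coordinates take the same values.
  have hmem := M.inter_subset_convexHull (mem_elements.1 hT).1 (mem_elements.1 hT').1 ⟨hx, hx'⟩
  have hsub : convexHull ℝ ((T : Set (E d)) ∩ T') ⊆ {y | (bary T z - bary T' z) y = 0} := by
    refine convexHull_min (fun y hy => ?_)
      ((convex_singleton (0 : ℝ)).affine_preimage (bary T z - bary T' z))
    have h1 : bary T z y = bary T' z y := by
      by_cases hyz : y = z
      · subst hyz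
        rw [h.bary_self hy.1, h'.bary_self hy.2]
      · rw [h.bary_of_ne hy.1 hyz, h'.bary_of_ne hy.2 hyz]
    simp [h1]
  have := hsub hmem
  simpa [sub_eq_zero] using this

/-- All coordinates of `x` in `T` are positive and agree with those in `T'`, which vanish for points
that are not vertices of `T'`. Hence every vertex of `T` belongs to `T'`. -/
theorem eq_of_mem_openSimplex (hT : T ∈ M.elements) (hT' : T' ∈ M.elements) {x : E d}
    (hx : x ∈ Mesh.openSimplex T) (hx' : x ∈ convexHull ℝ (T' : Set (E d))) : T = T' := by
  have h := isSimplex_of_mem hT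
  refine Finset.eq_of_subset_of_card_le (fun w hw => ?_)
    (by rw [h.1, (isSimplex_of_mem hT').1])
  by_contra hw'
  have h1 := bary_eq_bary hT hT' (openSimplex_subset T hx) hx' w
  rw [bary_of_notMem hw'] at h1
  exact (h.mem_openSimplex.1 hx w hw).ne' h1

/-- There is a point in the relative interior of every facet. -/
theorem IsSimplex.exists_facet_point (h : IsSimplex T) (hd : 1 ≤ d) (z : E d) (hz : z ∈ T) :
    ∃ c, bary T z c = 0 ∧ ∀ w ∈ T, w ≠ z → 0 < bary T w c := by
  obtain ⟨y, hy⟩ := h.openSimplex_nonempty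
  rw [h.mem_openSimplex] at hy
  obtain ⟨w, hw, hwz⟩ := h.exists_ne hd z
  have hlt : bary T z y < 1 := by
    have h1 := h.sum_bary y
    have h2 : bary T z y + bary T w y ≤ ∑ v ∈ T, bary T v y := by
      have hsub : ({z, w} : Finset (E d)) ⊆ T := by
        intro v hv; simp at hv; rcases hv with rfl | rfl <;> assumption
      have := Finset.sum_le_sum_of_subset_of_nonneg hsub (f := fun v => bary T v y)
        fun v hv _ => (hy v hv).le
      rwa [Finset.sum_pair hwz.symm] at this
    linarith [hy w hw]
  -- An interior point is projected radially from `z`; the ratio makes the coordinate of `z` vanish.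
  refine ⟨AffineMap.homothety z (1 - bary T z y)⁻¹ y, ?_, fun v hv hvz => ?_⟩
  · rw [bary_homothety, h.bary_self hz]
    have : 1 - bary T z y ≠ 0 := by linarith
    field_simp; ring
  · rw [bary_homothety, h.bary_of_ne hz hvz.symm]
    have h1 := hy v hv
    have : 0 < (1 - bary T z y)⁻¹ := inv_pos.2 (by linarith)
    simp only [sub_zero, zero_add]
    positivity

theorem tendsto_homothety (c y : E d) :
    Tendsto (fun ε : ℝ => AffineMap.homothety c ε y) (𝓝[>] 0) (𝓝 c) := by
  have : Continuous fun ε : ℝ => AffineMap.homothety c ε y := by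
    simp only [AffineMap.homothety_apply, vsub_eq_sub, vadd_eq_add]; fun_prop
  have h := this.tendsto 0
  simp only [AffineMap.homothety_zero] at h
  exact h.mono_left nhdsWithin_le_nhds

/-- Two elements that share a facet and lie on the same side of it are equal. -/
theorem eq_of_same_side (hd : 1 ≤ d) (hT : T ∈ M.elements) (hT' : T' ∈ M.elements) {z z' : E d}
    (hz : z ∈ T) (hz' : z' ∈ T') (hF : T.erase z = T'.erase z') (hpos : 0 < bary T z z') :
    T = T' := by
  have h := isSimplex_of_mem hT
  have h' := isSimplex_of_mem hT'
  obtain ⟨c, hc0, hc⟩ := h.exists_facet_point hd z hz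
  have hcF : c ∈ facetSet T z :=
    (h.mem_facetSet hz).2 ⟨fun w hw => by
      by_cases hwz : w = z
      · rw [hwz, hc0]
      · exact (hc w hw hwz).le, hc0⟩
  have hcT' : c ∈ convexHull ℝ (T' : Set (E d)) := by
    rw [facetSet_eq_erase, hF, ← facetSet_eq_erase] at hcF
    exact facetSet_subset T' z' hcF
  -- A small move from the facet point `c` towards `z'` enters the open simplex `T`, because the
  -- coordinate of `z` becomes positive and the others stay so; by convexity it remains in `T'`.
  have hev : ∀ᶠ ε in 𝓝[>] (0 : ℝ), ∀ w ∈ T, 0 < bary T w (AffineMap.homothety c ε z') := by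
    refine (eventually_all_finset T).2 fun w hw => ?_
    by_cases hwz : w = z
    · subst hwz
      filter_upwards [self_mem_nhdsWithin] with ε hε
      rw [bary_homothety, hc0]
      have : (0 : ℝ) < ε := hε
      simp only [sub_zero, zero_add]
      positivity
    · have h1 := ((affine_continuous (bary T w)).tendsto c).comp (tendsto_homothety c z')
      exact h1.eventually (lt_mem_nhds (hc w hw hwz))
  have hev2 : ∀ᶠ ε in 𝓝[>] (0 : ℝ), ε ∈ Ioc (0 : ℝ) 1 := Ioc_mem_nhdsGT one_pos
  obtain ⟨ε, hε1, hε2⟩ := (hev.and hev2).exists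
  refine eq_of_mem_openSimplex hT hT' (h.mem_openSimplex.2 hε1) ?_
  exact homothety_mem_of_convex (convex_convexHull ℝ _) (mem_hull hz') hcT' hε2.1.le hε2.2

/-- The position of a neighbour of an element. -/
theorem exists_neighbour (hd : 1 ≤ d) (hT : T ∈ M.elements) (hT' : T' ∈ M.elements) {w : E d}
    (hw : w ∈ T) (hF : T.erase w ⊆ T') (hne : T' ≠ T) :
    ∃ w' ∈ T', T.erase w = T'.erase w' ∧ bary T w w' < 0 ∧
      ∀ x, bary T w x = bary T w w' * bary T' w' x := by
  have h := isSimplex_of_mem hT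
  have h' := isSimplex_of_mem hT'
  have hcard : (T' \ T.erase w).card = 1 := by
    rw [Finset.card_sdiff_of_subset hF, h'.1, Finset.card_erase_of_mem hw, h.1]; omega
  obtain ⟨w', hw'⟩ := Finset.card_eq_one.1 hcard
  have hw'T : w' ∈ T' ∧ w' ∉ T.erase w := by
    rw [← Finset.mem_sdiff, hw']; simp
  have hFF : T.erase w = T'.erase w' := by
    ext v
    rw [Finset.mem_erase (s := T')]
    constructor
    · intro hv
      exact ⟨fun e => hw'T.2 (e ▸ hv), hF hv⟩
    · rintro ⟨hv1, hv2⟩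
      by_contra hv
      have : v ∈ T' \ T.erase w := Finset.mem_sdiff.2 ⟨hv2, hv⟩
      rw [hw', Finset.mem_singleton] at this
      exact hv1 this
  -- Both sides are affine, vanish on the common facet and agree at the remaining vertex `w'` of
  -- `T'`.
  have hrel : bary T w = bary T w w' • bary T' w' := by
    refine h'.affine_ext fun v hv => ?_
    rw [AffineMap.coe_smul, Pi.smul_apply, smul_eq_mul]
    by_cases hvw : v = w'
    · rw [hvw, h'.bary_self hw'T.1, mul_one]
    · rw [h'.bary_of_ne hv hvw, mul_zero]
      have : v ∈ T.erase w := by rw [hFF]; exact Finset.mem_erase.2 ⟨hvw, hv⟩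
      exact h.bary_of_ne (Finset.mem_of_mem_erase this) (Finset.ne_of_mem_erase this)
  have hrel' : ∀ x, bary T w x = bary T w w' * bary T' w' x := fun x => by
    conv_lhs => rw [hrel]
    simp
  refine ⟨w', hw'T.1, hFF, ?_, hrel'⟩
  -- The value zero would make `bary T w` vanish identically, and a positive value would put both
  -- elements on the same side of the facet.
  rcases lt_trichotomy (bary T w w') 0 with h0 | h0 | h0
  · exact h0
  · have := hrel' w
    rw [h0, zero_mul, h.bary_self hw] at this
    norm_num at this
  · exact absurd (eq_of_same_side hd hT hT' hw hw'T.1 hFF h0).symm hne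

/-- Three elements that share a facet are not distinct. -/
theorem eq_of_three (hd : 1 ≤ d) {T₁ T₂ T₃ : Finset (E d)} (h1 : T₁ ∈ M.elements)
    (h2 : T₂ ∈ M.elements) (h3 : T₃ ∈ M.elements) {w : E d} (hw : w ∈ T₁)
    (hF2 : T₁.erase w ⊆ T₂) (hF3 : T₁.erase w ⊆ T₃) (h21 : T₂ ≠ T₁) (h31 : T₃ ≠ T₁) :
    T₂ = T₃ := by
  obtain ⟨w2, hw2, hf2, hneg2, hrel2⟩ := exists_neighbour hd h1 h2 hw hF2 h21
  obtain ⟨w3, hw3, hf3, hneg3, hrel3⟩ := exists_neighbour hd h1 h3 hw hF3 h31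
  -- Both opposite vertices have negative coordinates in `T₁`, so they lie on the same side of the
  -- facet.
  refine eq_of_same_side hd h2 h3 hw2 hw3 (hf2.symm.trans hf3) ?_
  have := hrel2 w3
  by_contra hc
  have : 0 ≤ bary T₁ w w2 * bary T₂ w2 w3 := mul_nonneg_of_nonpos_of_nonpos hneg2.le (not_lt.1 hc)
  linarith

/-- The facet of `T` opposite to `w` belongs to no other element. -/
def IsBoundaryFacet (M : Mesh d) (T : Finset (E d)) (w : E d) : Prop :=
  ∀ T' ∈ M.elements, T.erase w ⊆ T' → T' = T

/-- If `c` were in the domain, points just beyond the facet would lie in mesh elements, and a single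
closed element would contain such points arbitrarily close to `c`. It contains `c`, hence all
vertices of the facet, so it equals `T`; but beyond its facet the coordinate of `w` is negative. -/
theorem notMem_domain_of_isBoundaryFacet (hT : T ∈ M.elements) {w : E d} (hw : w ∈ T)
    (hb : IsBoundaryFacet M T w) {c : E d} (hc0 : bary T w c = 0)
    (hc : ∀ v ∈ T, v ≠ w → 0 < bary T v c) : c ∉ M.domain := by
  have h := isSimplex_of_mem hT
  intro hcD
  have htend : Tendsto (fun ε : ℝ => AffineMap.homothety c (-ε) w) (𝓝[>] 0) (𝓝 c) := by
    have : Continuous fun ε : ℝ => AffineMap.homothety c (-ε) w := by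
      simp only [AffineMap.homothety_apply, vsub_eq_sub, vadd_eq_add]; fun_prop
    have h := this.tendsto 0
    simp only [neg_zero, AffineMap.homothety_zero] at h
    exact h.mono_left nhdsWithin_le_nhds
  have hev : ∀ᶠ ε in 𝓝[>] (0 : ℝ), ∃ T' ∈ M.elements,
      AffineMap.homothety c (-ε) w ∈ convexHull ℝ (T' : Set (E d)) := by
    have := htend.eventually (mem_interior_iff_mem_nhds.1 hcD)
    filter_upwards [this] with ε hε
    exact mem_space_iff_elements.1 hε
  obtain ⟨T', hT', hfr⟩ := exists_frequently_finset (hev.and self_mem_nhdsWithin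
    |>.frequently.mono fun ε (hε : _ ∧ ε ∈ Ioi (0 : ℝ)) => (by
      obtain ⟨T', hT', hx⟩ := hε.1
      exact ⟨T', hT', hx, hε.2⟩ : ∃ T' ∈ M.elements,
        AffineMap.homothety c (-ε) w ∈ convexHull ℝ (T' : Set (E d)) ∧ 0 < ε))
  have hcT' : c ∈ convexHull ℝ (T' : Set (E d)) :=
    (convexHull_isClosed T').mem_of_frequently_of_tendsto (hfr.mono fun _ h => h.1) htend
  have hcT : c ∈ convexHull ℝ (T : Set (E d)) := h.mem_convexHull.2 fun v hv => by
    by_cases hvw : v = w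
    · rw [hvw, hc0]
    · exact (hc v hv hvw).le
  have hsub : T.erase w ⊆ T' := fun v hv => by
    by_contra hvT'
    have h1 := bary_eq_bary hT hT' hcT hcT' v
    rw [bary_of_notMem hvT'] at h1
    exact (hc v (Finset.mem_of_mem_erase hv) (Finset.ne_of_mem_erase hv)).ne' h1
  obtain rfl := hb T' hT' hsub
  obtain ⟨ε, hε, hε0⟩ := hfr.exists
  have h1 := h.mem_convexHull.1 hε w hw
  rw [bary_homothety, hc0, h.bary_self hw] at h1
  linarith

/-- A smooth function that vanishes outside of the domain vanishes on boundary facets. -/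
theorem eq_zero_of_isBoundaryFacet (hd : 1 ≤ d) (hT : T ∈ M.elements) {w : E d} (hw : w ∈ T)
    (hb : IsBoundaryFacet M T w) {g : E d → ℝ} (hg : Continuous g) (hg0 : ∀ x ∉ M.domain, g x = 0)
    {x : E d} (hx : x ∈ facetSet T w) : g x = 0 := by
  have h := isSimplex_of_mem hT
  obtain ⟨c, hc0, hc⟩ := h.exists_facet_point hd w hw
  rw [h.mem_facetSet hw] at hx
  -- The exclusion from the domain is known for relatively interior points of the facet; an
  -- arbitrary facet point is approached along the segment towards `c`.
  have hev : ∀ᶠ ε in 𝓝[>] (0 : ℝ), g (AffineMap.homothety x ε c) = 0 := by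
    filter_upwards [Ioc_mem_nhdsGT (one_pos : (0 : ℝ) < 1)] with ε hε
    refine hg0 _ (notMem_domain_of_isBoundaryFacet hT hw hb ?_ fun v hv hvw => ?_)
    · rw [bary_homothety, hx.2, hc0]; ring
    · rw [bary_homothety]
      have h1 := hx.1 v hv
      have h2 := hc v hv hvw
      have : bary T v x + ε * (bary T v c - bary T v x) =
        (1 - ε) * bary T v x + ε * bary T v c := by ring
      rw [this]
      have h3 := mul_nonneg (by linarith [hε.2] : 0 ≤ 1 - ε) h1
      have h4 := mul_pos hε.1 h2
      linarith
  have ht : Tendsto (fun ε : ℝ => g (AffineMap.homothety x ε c)) (𝓝[>] 0) (𝓝 (g x)) :=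
    (hg.tendsto x).comp (tendsto_homothety x c)
  exact tendsto_nhds_unique ht (tendsto_const_nhds.congr' (hev.mono fun _ h => h.symm))

/-- A facet that has a vertex in the domain is not a boundary facet. -/
theorem not_isBoundaryFacet (hd : 1 ≤ d) (hT : T ∈ M.elements) {w z : E d} (hw : w ∈ T)
    (hz : z ∈ T) (hzw : z ≠ w) (hzD : z ∈ M.domain) : ¬ IsBoundaryFacet M T w := by
  intro hb
  have h := isSimplex_of_mem hT
  obtain ⟨c, hc0, hc⟩ := h.exists_facet_point hd w hw
  -- Points near `z` on the segment to `c` would be in the open domain and in the relative interior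
  -- of a boundary facet.
  have hev := (tendsto_homothety z c).eventually (isOpen_interior.mem_nhds hzD)
  obtain ⟨ε, hε1, hε2⟩ := (hev.and (Ioc_mem_nhdsGT (one_pos : (0 : ℝ) < 1))).exists
  refine notMem_domain_of_isBoundaryFacet hT hw hb ?_ (fun v hv hvw => ?_) hε1
  · rw [bary_homothety, h.bary_of_ne hz hzw, hc0]; ring
  · rw [bary_homothety]
    have h1 : 0 ≤ bary T v z := h.bary_nonneg v (mem_hull hz)
    have h2 := hc v hv hvw
    have : bary T v z + ε * (bary T v c - bary T v z) =
      (1 - ε) * bary T v z + ε * bary T v c := by ring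
    rw [this]
    have h3 := mul_nonneg (by linarith [hε2.2] : 0 ≤ 1 - ε) h1
    have h4 := mul_pos hε2.1 h2
    linarith

/-! ### Vertex stars -/

/-- The elements with the vertex `z`. -/
noncomputable def star (M : Mesh d) (z : E d) : Finset (Finset (E d)) :=
  M.elements.filter fun T => z ∈ T

theorem mem_star {z : E d} : T ∈ star M z ↔ T ∈ M.elements ∧ z ∈ T := by simp [star]

/-- The cone with apex `z` spanned by the element `T`. -/
def vertexCone (T : Finset (E d)) (z : E d) : Set (E d) :=
  {x | ∀ w ∈ T, w ≠ z → 0 ≤ bary T w x}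

theorem vertexCone_isClosed (T : Finset (E d)) (z : E d) : IsClosed (vertexCone T z) := by
  have : vertexCone T z = ⋂ w ∈ T, ⋂ (_ : w ≠ z), {x | 0 ≤ bary T w x} := by
    ext; simp [vertexCone]
  rw [this]
  exact isClosed_biInter fun w _ => isClosed_iInter fun _ =>
    isClosed_le continuous_const (affine_continuous _)

theorem IsSimplex.convexHull_subset_vertexCone (h : IsSimplex T) (z : E d) :
    convexHull ℝ (T : Set (E d)) ⊆ vertexCone T z := fun _ hx w hw _ => h.mem_convexHull.1 hx w hw

/-- Near the apex the coordinate of `z` is close to `1`, so there the cone and the simplex coincide.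
-/
theorem IsSimplex.eventually_mem_of_vertexCone (h : IsSimplex T) {z : E d} (hz : z ∈ T) {x : E d}
    (hx : x ∈ vertexCone T z) :
    ∀ᶠ ε in 𝓝[>] (0 : ℝ), AffineMap.homothety z ε x ∈ convexHull ℝ (T : Set (E d)) := by
  have h1 : ∀ᶠ ε in 𝓝[>] (0 : ℝ), 0 < bary T z (AffineMap.homothety z ε x) := by
    have := ((affine_continuous (bary T z)).tendsto z).comp (tendsto_homothety z x)
    rw [h.bary_self hz] at this
    exact this.eventually (lt_mem_nhds one_pos)
  filter_upwards [h1, self_mem_nhdsWithin] with ε h1 hε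
  have hε' : (0 : ℝ) < ε := hε
  rw [h.mem_convexHull]
  intro w hw
  by_cases hwz : w = z
  · rw [hwz]; exact h1.le
  · rw [bary_homothety, h.bary_of_ne hz (Ne.symm hwz)]
    have := hx w hw hwz
    simp only [sub_zero, zero_add]
    positivity

theorem bary_apply_vertex_eq {z : E d} (hT : T ∈ star M z) (hT' : T' ∈ star M z) (w : E d) :
    bary T w z = bary T' w z :=
  bary_eq_bary (mem_star.1 hT).1 (mem_star.1 hT').1 (mem_hull (mem_star.1 hT).2)
    (mem_hull (mem_star.1 hT').2) w

/-- Barycentric coordinates agree on the intersection of two cones with the same apex. -/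
theorem bary_eq_bary_of_cone {z : E d} (hT : T ∈ star M z) (hT' : T' ∈ star M z) {x : E d}
    (hx : x ∈ vertexCone T z) (hx' : x ∈ vertexCone T' z) (w : E d) :
    bary T w x = bary T' w x := by
  obtain ⟨hTe, hz⟩ := mem_star.1 hT
  obtain ⟨hTe', hz'⟩ := mem_star.1 hT'
  -- The point is shrunk towards `z` into both simplices, where the coordinates agree; affinity
  -- along the ray carries the equality back.
  obtain ⟨ε, ⟨h1, h2⟩, hε⟩ := (((isSimplex_of_mem hTe).eventually_mem_of_vertexCone hz hx).and
    ((isSimplex_of_mem hTe').eventually_mem_of_vertexCone hz' hx')).and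
      self_mem_nhdsWithin |>.exists
  have hε' : (0 : ℝ) < ε := hε
  have h3 := bary_eq_bary hTe hTe' h1 h2 w
  rw [bary_homothety, bary_homothety, bary_apply_vertex_eq hT hT' w] at h3
  have h4 : ε * (bary T w x - bary T' w z) = ε * (bary T' w x - bary T' w z) := by linarith
  have := mul_left_cancel₀ hε'.ne' h4
  linarith

theorem eq_of_mem_interior_cone {z : E d} (hT : T ∈ star M z) (hT' : T' ∈ star M z) {x : E d}
    (hx : ∀ w ∈ T, w ≠ z → 0 < bary T w x) (hx' : x ∈ vertexCone T' z) : T = T' := by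
  obtain ⟨hTe, hz⟩ := mem_star.1 hT
  obtain ⟨hTe', hz'⟩ := mem_star.1 hT'
  refine Finset.eq_of_subset_of_card_le (fun w hw => ?_)
    (by rw [(isSimplex_of_mem hTe).1, (isSimplex_of_mem hTe').1])
  by_cases hwz : w = z
  · rwa [hwz]
  by_contra hw'
  have h1 := bary_eq_bary_of_cone hT hT' (fun w hw hwz => (hx w hw hwz).le) hx' w
  rw [bary_of_notMem hw'] at h1
  exact (hx w hw hwz).ne' h1

theorem IsSimplex.bary_ne_zero (h : IsSimplex T) {z : E d} (hz : z ∈ T) : bary T z ≠ 0 := by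
  intro h0
  have := h.bary_self hz
  rw [h0] at this
  simp at this

/-- A finite family of nonzero affine functions has a common non-zero in every open set. -/
theorem exists_generic {U : Set (E d)} (hU : IsOpen U) (hne : U.Nonempty) {ι : Type*}
    (S : Finset ι) (l : ι → E d →ᵃ[ℝ] ℝ) (hl : ∀ i ∈ S, l i ≠ 0) :
    ∃ x ∈ U, ∀ i ∈ S, l i x ≠ 0 := by
  induction S using Finset.induction_on generalizing U with
  | empty => exact ⟨hne.some, hne.some_mem, by simp⟩
  | insert i S hi ih =>
    have hU' : (U ∩ {x | l i x ≠ 0}).Nonempty := by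
      by_contra hc
      rw [not_nonempty_iff_eq_empty] at hc
      have hz : ∀ x ∈ U, l i x = 0 := fun x hx => by
        by_contra h
        have : x ∈ U ∩ {x | l i x ≠ 0} := ⟨hx, h⟩
        rw [hc] at this; exact this
      obtain ⟨x0, hx0⟩ := hne
      refine hl i (by simp) ?_
      ext y
      obtain ⟨ε, h1, h2⟩ := (((tendsto_homothety x0 y).eventually (hU.mem_nhds hx0)).and
        self_mem_nhdsWithin).exists
      have h3 := hz _ h1
      rw [bary_homothety, hz x0 hx0] at h3
      have h2' : (0 : ℝ) < ε := h2
      simp only [sub_zero, zero_add, mul_eq_zero, h2'.ne', false_or] at h3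
      simpa using h3
    obtain ⟨x, hx, hxS⟩ := ih (hU.inter (isOpen_ne_fun (affine_continuous _) continuous_const)) hU'
      fun j hj => hl j (Finset.mem_insert_of_mem hj)
    refine ⟨x, hx.1, fun j hj => ?_⟩
    rcases Finset.mem_insert.1 hj with rfl | hj
    · exact hx.2
    · exact hxS j hj

/-- The cones of a set of elements with the vertex `z` cover the whole space, if the set is closed
under passing to neighbours across facets that contain `z`. -/
theorem exists_mem_vertexCone (hd : 1 ≤ d) {z : E d} {C : Finset (Finset (E d))}
    (hC : C ⊆ star M z) (hne : C.Nonempty)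
    (hcl : ∀ T ∈ C, ∀ w ∈ T, w ≠ z → ∃ T' ∈ C, T' ≠ T ∧ T.erase w ⊆ T') (y : E d) :
    ∃ T ∈ C, y ∈ vertexCone T z := by
  have hsimp : ∀ T ∈ C, IsSimplex T := fun T hT => isSimplex_of_mem (mem_star.1 (hC hT)).1
  set U : Set (E d) := ⋃ T ∈ C, vertexCone T z with hUdef
  have hUc : IsClosed U := C.finite_toSet.isClosed_biUnion fun T _ => vertexCone_isClosed T z
  suffices hU : U = univ by
    have : y ∈ U := by rw [hU]; trivial
    simpa [hUdef] using this
  by_contra hUne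
  obtain ⟨T0, hT0⟩ := hne
  set I : Finset (Finset (E d) × E d) := C.biUnion fun T => T.image fun w => (T, w) with hIdef
  have hI : ∀ {T w}, (T, w) ∈ I ↔ T ∈ C ∧ w ∈ T := by
    intro T w
    simp only [hIdef, Finset.mem_biUnion, Finset.mem_image, Prod.mk.injEq]
    constructor
    · rintro ⟨T', hT', w', hw', rfl, rfl⟩; exact ⟨hT', hw'⟩
    · rintro ⟨h1, h2⟩; exact ⟨T, h1, w, h2, rfl, rfl⟩
  obtain ⟨x0, hx0, hgen⟩ := exists_generic (openSimplex_isOpen T0)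
    (hsimp T0 hT0).openSimplex_nonempty I (fun i => bary i.1 i.2) fun i hi =>
      (hsimp i.1 (hI.1 hi).1).bary_ne_zero (hI.1 hi).2
  have hgen' : ∀ T ∈ C, ∀ w ∈ T, bary T w x0 ≠ 0 := fun T hT w hw => hgen (T, w) (hI.2 ⟨hT, hw⟩)
  set J : Finset ((Finset (E d) × E d) × (Finset (E d) × E d)) :=
    (I ×ˢ I).filter fun p => p.1.1 = p.2.1 ∧ p.1.2 ≠ p.2.2 with hJdef
  -- If two coordinates of one element vanished at the same point of the segment from `x0` to `y'`,
  -- the corresponding determinant would be zero or that point would be `x0`. The generic choice of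
  -- both ends excludes this, so the segment crosses facets only in their relative interior.
  obtain ⟨y', hy', hgeny⟩ := exists_generic hUc.isOpen_compl
    (nonempty_compl.2 hUne) J
    (fun p => bary p.1.1 p.1.2 x0 • bary p.2.1 p.2.2 - bary p.2.1 p.2.2 x0 • bary p.1.1 p.1.2)
    fun p hp h0 => by
      obtain ⟨⟨T, w⟩, ⟨T', w'⟩⟩ := p
      simp only [hJdef, Finset.mem_filter, Finset.mem_product] at hp
      obtain ⟨⟨h1, h2⟩, h3, h4⟩ := hp
      subst h3
      have hT := (hI.1 h1).1
      have := congrArg (fun l : E d →ᵃ[ℝ] ℝ => l w') h0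
      simp only [AffineMap.coe_sub, AffineMap.coe_smul, Pi.sub_apply, Pi.smul_apply,
        smul_eq_mul] at this
      rw [(hsimp T hT).bary_self (hI.1 h2).2, (hsimp T hT).bary_of_ne (hI.1 h2).2 (Ne.symm h4)] at this
      simp only [mul_one, mul_zero, sub_zero] at this
      exact hgen' T hT w (hI.1 h1).2 (by simpa using this)
  have hgeny' : ∀ T ∈ C, ∀ w ∈ T, ∀ w' ∈ T, w ≠ w' →
      bary T w x0 * bary T w' y' - bary T w' x0 * bary T w y' ≠ 0 := by
    intro T hT w hw w' hw' hne
    have := hgeny ((T, w), (T, w')) (by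
      simp only [hJdef, Finset.mem_filter, Finset.mem_product]
      exact ⟨⟨hI.2 ⟨hT, hw⟩, hI.2 ⟨hT, hw'⟩⟩, trivial, hne⟩)
    simpa using this
  set p : ℝ → E d := fun t => AffineMap.lineMap x0 y' t with hp
  have hpc : Continuous p := AffineMap.lineMap_continuous
  have hbp : ∀ T w t, bary T w (p t) = (1 - t) * bary T w x0 + t * bary T w y' := by
    intro T w t
    simp only [hp]
    rw [AffineMap.apply_lineMap, AffineMap.lineMap_apply_module]
    simp
  -- Continuous induction along the segment: the covered parameters form a closed set, and from each
  -- of them the segment stays covered a little further. This would reach `y'`, which is not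
  -- covered.
  have hsub : Icc (0 : ℝ) 1 ⊆ p ⁻¹' U := by
    refine IsClosed.Icc_subset_of_forall_exists_gt ((hUc.preimage hpc).inter isClosed_Icc) ?_ ?_
    · simp only [mem_preimage, hp, AffineMap.lineMap_apply_zero, hUdef, mem_iUnion]
      exact ⟨T0, hT0, (hsimp T0 hT0).convexHull_subset_vertexCone z (openSimplex_subset T0 hx0)⟩
    · rintro t ⟨htU, ht⟩ t' ht'
      simp only [mem_preimage, hUdef, mem_iUnion] at htU
      obtain ⟨T, hT, htT⟩ := htU
      have hev : ∀ᶠ s in 𝓝[>] t, p s ∈ U := by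
        have hnear : ∀ (T₁ : Finset (E d)) (v : E d), 0 < bary T₁ v (p t) →
            ∀ᶠ s in 𝓝[>] t, 0 < bary T₁ v (p s) := fun T₁ v hv =>
          (((affine_continuous (bary T₁ v)).comp hpc).tendsto t).mono_left nhdsWithin_le_nhds
            |>.eventually (lt_mem_nhds hv)
        by_cases hall : ∀ w ∈ T, w ≠ z → 0 < bary T w (p t)
        · have : ∀ᶠ s in 𝓝[>] t, ∀ w ∈ T, w ≠ z → 0 < bary T w (p s) :=
            (eventually_all_finset T).2 fun w hw => by
              by_cases hwz : w = z
              · simp [hwz]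
              · filter_upwards [hnear T w (hall w hw hwz)] with s hs _ using hs
          filter_upwards [this] with s hs
          simp only [hUdef, mem_iUnion]
          exact ⟨T, hT, fun w hw hwz => (hs w hw hwz).le⟩
        · push Not at hall
          obtain ⟨w, hw, hwz, hw0⟩ := hall
          have hw0' : bary T w (p t) = 0 := le_antisymm hw0 (htT w hw hwz)
          have hoth : ∀ v ∈ T, v ≠ z → v ≠ w → 0 < bary T v (p t) := by
            intro v hv hvz hvw
            refine lt_of_le_of_ne (htT v hv hvz) fun hv0 => ?_
            have e1 := hbp T w t
            have e2 := hbp T v t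
            rw [hw0'] at e1
            rw [← hv0] at e2
            have e3 : t * (bary T v x0 * bary T w y' - bary T w x0 * bary T v y') = 0 := by
              linear_combination bary T w x0 * e2 - bary T v x0 * e1
            rcases mul_eq_zero.1 e3 with ht0 | h0
            · rw [ht0] at e1
              simp only [sub_zero, one_mul, zero_mul, add_zero] at e1
              exact hgen' T hT w hw e1.symm
            · exact hgeny' T hT v hv w hw hvw h0
          -- Exactly one relevant coordinate vanishes. Beyond this point the segment is in the cone
          -- of `T` or of its neighbour, depending on the sign of `bary T w`.
          obtain ⟨T', hT', hne', hF⟩ := hcl T hT w hw hwz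
          obtain ⟨w', hw', hFF, hneg, hrel⟩ := exists_neighbour hd (mem_star.1 (hC hT)).1
            (mem_star.1 (hC hT')).1 hw hF hne'
          have hT's := hsimp T' hT'
          have hTs := hsimp T hT
          -- On the plane of the common facet the coordinates of both elements coincide, so
          -- positivity transfers to the neighbour.
          have hcoord : ∀ v ∈ T', v ≠ w' → bary T' v (p t) = bary T v (p t) := by
            intro v hv hvw'
            have hvF : v ∈ T.erase w := by rw [hFF]; exact Finset.mem_erase.2 ⟨hvw', hv⟩
            rw [hTs.affine_apply (bary T' v) (p t),
              Finset.sum_eq_single_of_mem v (Finset.mem_of_mem_erase hvF)]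
            · rw [hT's.bary_self hv, mul_one]
            · intro u hu huv
              by_cases huw : u = w
              · rw [huw, hw0', zero_mul]
              · rw [hT's.bary_of_ne (hF (Finset.mem_erase.2 ⟨huw, hu⟩)) huv, mul_zero]
          have hA : ∀ᶠ s in 𝓝[>] t, ∀ v ∈ T, v ≠ z → v ≠ w → 0 < bary T v (p s) :=
            (eventually_all_finset T).2 fun v hv => by
              by_cases hvz : v = z
              · simp [hvz]
              by_cases hvw : v = w
              · simp [hvw]
              filter_upwards [hnear T v (hoth v hv hvz hvw)] with s hs _ _ using hs
          have hB : ∀ᶠ s in 𝓝[>] t, ∀ v ∈ T', v ≠ z → v ≠ w' → 0 < bary T' v (p s) :=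
            (eventually_all_finset T').2 fun v hv => by
              by_cases hvz : v = z
              · simp [hvz]
              by_cases hvw : v = w'
              · simp [hvw]
              have hvF : v ∈ T.erase w := by rw [hFF]; exact Finset.mem_erase.2 ⟨hvw, hv⟩
              have := hoth v (Finset.mem_of_mem_erase hvF) hvz (Finset.ne_of_mem_erase hvF)
              rw [← hcoord v hv hvw] at this
              filter_upwards [hnear T' v this] with s hs _ _ using hs
          filter_upwards [hA, hB] with s hsA hsB
          simp only [hUdef, mem_iUnion]
          by_cases hs : 0 ≤ bary T w (p s)
          · refine ⟨T, hT, fun v hv hvz => ?_⟩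
            by_cases hvw : v = w
            · rwa [hvw]
            · exact (hsA v hv hvz hvw).le
          · refine ⟨T', hT', fun v hv hvz => ?_⟩
            by_cases hvw : v = w'
            · rw [hvw]
              have := hrel (p s)
              push Not at hs
              by_contra hc
              push Not at hc
              have : 0 ≤ bary T w w' * bary T' w' (p s) :=
                mul_nonneg_of_nonpos_of_nonpos hneg.le hc.le
              linarith
            · exact (hsB v hv hvz hvw).le
      obtain ⟨s, hs1, hs2⟩ := (hev.and (Ioc_mem_nhdsGT ht')).exists
      exact ⟨s, hs1, hs2⟩
  have h1 : p 1 ∈ U := hsub ⟨zero_le_one, le_rfl⟩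
  simp only [hp, AffineMap.lineMap_apply_one] at h1
  exact hy' h1

/-- A vertex whose element cones cover the space is an interior vertex. -/
theorem mem_domain_of_cover {z : E d} {C : Finset (Finset (E d))} (hC : C ⊆ star M z)
    (hcov : ∀ y, ∃ T ∈ C, y ∈ vertexCone T z) : z ∈ M.domain := by
  rw [Mesh.domain, mem_interior_iff_mem_nhds]
  have hev : ∀ᶠ y in 𝓝 z, ∀ T ∈ C, 0 < bary T z y := (eventually_all_finset C).2 fun T hT => by
    obtain ⟨h1, h2⟩ := mem_star.1 (hC hT)
    have := (affine_continuous (bary T z)).tendsto z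
    rw [(isSimplex_of_mem h1).bary_self h2] at this
    exact this.eventually (lt_mem_nhds one_pos)
  filter_upwards [hev] with y hy
  obtain ⟨T, hT, hyT⟩ := hcov y
  obtain ⟨h1, h2⟩ := mem_star.1 (hC hT)
  refine mem_space_iff_elements.2 ⟨T, h1, (isSimplex_of_mem h1).mem_convexHull.2 fun w hw => ?_⟩
  by_cases hwz : w = z
  · rw [hwz]; exact (hy T hT).le
  · exact hyT w hw hwz

end MeshGeometry

end SGFEM


namespace SGFEM

/-! ### Chains of elements in vertex stars and comparison of means -/

section StarEstimates

open scoped Topology Classical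

variable {d : ℕ} {M : Mesh d} {T T' : Finset (E d)} {K : ℝ} {z : E d}

/-- The graph of the elements with vertex `z`, with edges between the elements that share a facet
containing `z`. -/
def starGraph (M : Mesh d) (z : E d) : SimpleGraph {T // T ∈ star M z} where
  Adj T T' := T ≠ T' ∧ ∃ w ∈ T.1, ∃ w' ∈ T'.1, w ≠ z ∧ w' ≠ z ∧ T.1.erase w = T'.1.erase w'
  symm := ⟨by
    rintro T T' ⟨h, w, hw, w', hw', h1, h2, h3⟩
    exact ⟨h.symm, w', hw', w, hw, h2, h1, h3.symm⟩⟩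
  loopless := ⟨fun _ h => h.1 rfl⟩

/-- If the facet-connected component of `T` has no boundary facet through `z`, it is closed under
crossing facets through `z`, so its cones cover the space. Then `z` is interior, and an interior
point of any element of the star lies in one of these cones, which places that element in the
component. The star of a boundary vertex may be disconnected, but each component reaches a boundary
facet. -/
theorem starGraph_connected (hd : 1 ≤ d) (hT : T ∈ star M z) :
    (∃ S : {T // T ∈ star M z}, (starGraph M z).Reachable ⟨T, hT⟩ S ∧
      ∃ w ∈ S.1, w ≠ z ∧ IsBoundaryFacet M S.1 w) ∨
    (z ∈ M.domain ∧ ∀ S : {T // T ∈ star M z}, (starGraph M z).Reachable ⟨T, hT⟩ S) := by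
  by_cases hcase : ∃ S : {T // T ∈ star M z}, (starGraph M z).Reachable ⟨T, hT⟩ S ∧
      ∃ w ∈ S.1, w ≠ z ∧ IsBoundaryFacet M S.1 w
  · exact Or.inl hcase
  right
  push Not at hcase
  set C := (star M z).filter fun S => ∃ hS : S ∈ star M z, (starGraph M z).Reachable ⟨T, hT⟩ ⟨S, hS⟩
    with hCdef
  have hC : C ⊆ star M z := Finset.filter_subset _ _
  have hCT : T ∈ C := by
    rw [hCdef, Finset.mem_filter]
    exact ⟨hT, hT, SimpleGraph.Reachable.refl _⟩
  have hcov := exists_mem_vertexCone hd hC ⟨T, hCT⟩ fun S hS w hw hwz => by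
    obtain ⟨hS1, hS2, hreach⟩ := Finset.mem_filter.1 hS
    have hnb := hcase ⟨S, hS2⟩ hreach w hw hwz
    rw [IsBoundaryFacet] at hnb
    push Not at hnb
    obtain ⟨S', hS', hF, hne⟩ := hnb
    obtain ⟨w', hw', hFF, -⟩ := exists_neighbour hd (mem_star.1 hS1).1 hS' hw hF hne
    have hzF : z ∈ S.erase w := Finset.mem_erase.2 ⟨hwz.symm, (mem_star.1 hS1).2⟩
    have hS's : S' ∈ star M z := mem_star.2 ⟨hS', hF hzF⟩
    refine ⟨S', Finset.mem_filter.2 ⟨hS's, hS's, hreach.trans (SimpleGraph.Adj.reachable ?_)⟩,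
      hne, hF⟩
    refine ⟨fun e => hne (congrArg Subtype.val e).symm, w, hw, w', hw', hwz, ?_, hFF⟩
    rintro rfl
    rw [hFF] at hzF
    exact (Finset.notMem_erase _ _) hzF
  refine ⟨mem_domain_of_cover hC hcov, fun S => ?_⟩
  obtain ⟨y, hy⟩ := (isSimplex_of_mem (mem_star.1 S.2).1).openSimplex_nonempty
  obtain ⟨S', hS', hyS'⟩ := hcov y
  have heq : S.1 = S' := eq_of_mem_interior_cone S.2 (hC hS')
    (fun w hw _ => (isSimplex_of_mem (mem_star.1 S.2).1).mem_openSimplex.1 hy w hw) hyS'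
  obtain ⟨hS'', hr⟩ := (Finset.mem_filter.1 hS').2
  have : S = ⟨S', hC hS'⟩ := Subtype.ext heq
  rw [this]; exact hr

/-- The number of elements with a common vertex is bounded in terms of the shape regularity. -/
theorem card_star_le (hd : 1 ≤ d) (hK : 0 ≤ K) (hM : ∀ T ∈ M.elements, IsRegularSimplex K T)
    (z : E d) : ((star M z).card : ℝ) ≤ K ^ d := by
  -- Packing: rescaled about `z` by their diameters, the elements stay in disjoint cones, fit into
  -- the unit ball and by regularity fill at least the fraction `K⁻ᵈ` of it each.
  set A : Finset (E d) → Set (E d) := fun T =>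
    AffineMap.homothety z (Mesh.size T)⁻¹ '' Mesh.openSimplex T with hA
  have hmem : ∀ T ∈ star M z, T ∈ M.elements := fun T hT => (mem_star.1 hT).1
  have hs0 : ∀ T ∈ star M z, 0 < Mesh.size T := fun T hT => (hM T (hmem T hT)).size_pos hd
  have hcone : ∀ T ∈ star M z, ∀ x ∈ A T, ∀ w ∈ T, w ≠ z → 0 < bary T w x := by
    rintro T hT _ ⟨p, hp, rfl⟩ w hw hwz
    have hsi := isSimplex_of_mem (hmem T hT)
    rw [bary_homothety, hsi.bary_of_ne (mem_star.1 hT).2 hwz.symm]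
    have h1 := hsi.mem_openSimplex.1 hp w hw
    have h2 := hs0 T hT
    simp only [sub_zero, zero_add]
    positivity
  have hdisj : ((star M z : Finset (Finset (E d))) : Set (Finset (E d))).PairwiseDisjoint A := by
    intro T hT T' hT' hne
    refine Set.disjoint_left.2 fun x hx hx' => hne ?_
    exact eq_of_mem_interior_cone hT hT' (hcone T hT x hx)
      fun w hw hwz => (hcone T' hT' x hx' w hw hwz).le
  have hopen : ∀ T ∈ star M z, IsOpen (A T) := fun T hT =>
    AffineMap.homothety_isOpenMap z _ (inv_ne_zero (hs0 T hT).ne') _ (openSimplex_isOpen T)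
  have hball : ∀ T ∈ star M z, A T ⊆ Metric.closedBall z 1 := by
    rintro T hT _ ⟨p, hp, rfl⟩
    have h1 := norm_sub_le_size T (openSimplex_subset T hp) (mem_hull (mem_star.1 hT).2)
    have h2 := hs0 T hT
    rw [Metric.mem_closedBall, dist_eq_norm, AffineMap.homothety_apply]
    simp only [vsub_eq_sub, vadd_eq_add, add_sub_cancel_right, norm_smul, norm_inv]
    rw [Real.norm_of_nonneg h2.le, inv_mul_le_iff₀ h2, mul_one]
    exact h1
  have hfin : ∀ T ∈ star M z, volume (A T) ≠ ⊤ := fun T hT =>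
    ((measure_mono (hball T hT)).trans_lt measure_closedBall_lt_top).ne
  have hvol : ∀ T ∈ star M z, ballVol d ≤ K ^ d * volume.real (A T) := by
    intro T hT
    have h1 := (hM T (hmem T hT)).le_simplexVol hd
    have h2 : volume.real (A T) = (Mesh.size T ^ d)⁻¹ * simplexVol T := by
      have h0 := hs0 T hT
      rw [measureReal_def, hA, Measure.addHaar_image_homothety, finrank_euclideanSpace_fin,
        ENNReal.toReal_mul, ENNReal.toReal_ofReal (abs_nonneg _), abs_of_pos (by positivity),
        inv_pow, simplexVol, measureReal_def, measure_congr (openSimplex_ae_eq T)]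
    have h0 : 0 < Mesh.size T ^ d := pow_pos (hs0 T hT) d
    rw [h2]
    calc ballVol d = (Mesh.size T ^ d)⁻¹ * (ballVol d * Mesh.size T ^ d) := by field_simp
      _ ≤ (Mesh.size T ^ d)⁻¹ * (K ^ d * simplexVol T) := by gcongr
      _ = _ := by ring
  have hsum : ∑ T ∈ star M z, volume.real (A T) ≤ ballVol d := by
    rw [← measureReal_biUnion_finset hdisj (fun T hT => (hopen T hT).measurableSet) hfin]
    refine (measureReal_mono (iUnion₂_subset hball) measure_closedBall_lt_top.ne).trans ?_
    rw [Measure.addHaar_real_closedBall _ _ zero_le_one, one_pow, one_mul]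
    exact le_rfl
  have h3 : ((star M z).card : ℝ) * ballVol d ≤ K ^ d * ballVol d := by
    calc ((star M z).card : ℝ) * ballVol d = ∑ T ∈ star M z, ballVol d := by
          rw [Finset.sum_const, nsmul_eq_mul]
      _ ≤ ∑ T ∈ star M z, K ^ d * volume.real (A T) := Finset.sum_le_sum hvol
      _ = K ^ d * ∑ T ∈ star M z, volume.real (A T) := by rw [Finset.mul_sum]
      _ ≤ _ := by gcongr
  exact le_of_mul_le_mul_right h3 (ballVol_pos d)

theorem star_subset (M : Mesh d) (z : E d) : star M z ⊆ M.elements := Finset.filter_subset _ _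

/-- The energy of a function on a vertex star. -/
noncomputable def starEnergy (M : Mesh d) (z : E d) (g : E d → ℝ) : ℝ :=
  ∑ S ∈ star M z, energy S g

theorem starEnergy_nonneg (M : Mesh d) (z : E d) (g : E d → ℝ) : 0 ≤ starEnergy M z g :=
  Finset.sum_nonneg fun _ _ => energy_nonneg _ _

theorem energy_le_starEnergy (hT : T ∈ star M z) (g : E d → ℝ) : energy T g ≤ starEnergy M z g :=
  Finset.single_le_sum (f := fun S => energy S g) (fun _ _ => energy_nonneg _ _) hT

/-- Constants for the propagation of mean value estimates along chains of elements. -/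
noncomputable def chainConst (d : ℕ) (K : ℝ) : ℕ → ℝ
  | 0 => traceConst d K
  | n + 1 => 4 * K * traceConst d K + 2 * (K * K) ^ d * K ^ 2 * chainConst d K n

theorem chainConst_nonneg (d : ℕ) (hK : 1 ≤ K) (n : ℕ) : 0 ≤ chainConst d K n := by
  have h := traceConst_nonneg d hK
  induction n with
  | zero => exact h
  | succ n ih => rw [chainConst]; positivity

theorem chainConst_mono (d : ℕ) (hK : 1 ≤ K) : Monotone (chainConst d K) := by
  refine monotone_nat_of_le_succ fun n => ?_
  have h := traceConst_nonneg d hK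
  have h1 := chainConst_nonneg d hK n
  rw [chainConst]
  have h2 : 1 ≤ 2 * (K * K) ^ d * K ^ 2 := by
    have a1 : 1 ≤ (K * K) ^ d := one_le_pow₀ (by nlinarith)
    have a2 : 1 ≤ K ^ 2 := one_le_pow₀ hK
    nlinarith
  have h3 : chainConst d K n ≤ 2 * (K * K) ^ d * K ^ 2 * chainConst d K n :=
    le_mul_of_one_le_left h1 h2
  have h4 : 0 ≤ 4 * K * traceConst d K := by positivity
  linarith

/-- Induction along the walk. The deviation from `c` is the jump of the mean across a facet plus the
deviation of the next element, and `(a + b) ^ 2 ≤ 2 * a ^ 2 + 2 * b ^ 2` gives the recursion of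
`chainConst`. The number `c` is left free: it will be the mean over another element, or zero. -/
theorem chain_estimate (hd : 2 ≤ d) (hM : ∀ T ∈ M.elements, IsRegularSimplex K T) {g : E d → ℝ}
    (hg : ContDiff ℝ 1 g) (c : ℝ) {S S' : {T // T ∈ star M z}} (p : (starGraph M z).Walk S S')
    (hbase : simplexVol S'.1 * (simplexMean S'.1 g - c) ^ 2 ≤
      traceConst d K * Mesh.size S'.1 ^ 2 * starEnergy M z g) :
    simplexVol S.1 * (simplexMean S.1 g - c) ^ 2 ≤
      chainConst d K p.length * Mesh.size S.1 ^ 2 * starEnergy M z g := by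
  have hd1 : 1 ≤ d := by omega
  induction p with
  | nil => simpa [chainConst] using hbase
  | @cons S R S' hadj p ih =>
    have ih := ih hbase
    have hS := hM S.1 (mem_star.1 S.2).1
    have hR := hM R.1 (mem_star.1 R.2).1
    have hK := hS.one_le hd1
    have hadj' := hadj
    obtain ⟨hne, w, hw, w', hw', hwz, hwz', hF⟩ := hadj'
    have hfm : facetMeasure S.1 w = facetMeasure R.1 w' := by
      rw [facetMeasure, facetMeasure, facetSet_eq_erase, facetSet_eq_erase, hF]
    -- Since `d ≥ 2`, the common facet has a second vertex besides `z`; this common edge makes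
    -- diameters and volumes comparable.
    obtain ⟨v, hv, hvz⟩ : ∃ v ∈ S.1.erase w, v ≠ z := by
      by_contra! hc
      have : S.1.erase w ⊆ {z} := fun v hv => by simp [hc v hv]
      have := Finset.card_le_card this
      rw [Finset.card_erase_of_mem hw, hS.1.1] at this
      simp at this; omega
    have hvS := Finset.mem_of_mem_erase hv
    have hvR : v ∈ R.1 := by rw [hF] at hv; exact Finset.mem_of_mem_erase hv
    have hSR := hS.size_le_of_edge hd1 (mem_star.1 S.2).2 hvS hvz (mem_star.1 R.2).2 hvR
    have hRS := hR.size_le_of_edge hd1 (mem_star.1 R.2).2 hvR hvz (mem_star.1 S.2).2 hvS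
    have h1 := hS.mean_sub_mean hR hd1 hw hw' hfm hRS hg
    have h2 := hS.vol_le_vol hR hd1 hSR
    have hE := starEnergy_nonneg M z g
    have hE2 : energy S.1 g + energy R.1 g ≤ starEnergy M z g := by
      have hne' : S.1 ≠ R.1 := fun e => hne (Subtype.ext e)
      have hsub : ({S.1, R.1} : Finset (Finset (E d))) ⊆ star M z := by
        intro x hx; simp at hx; rcases hx with rfl | rfl
        · exact S.2
        · exact R.2
      have := Finset.sum_le_sum_of_subset_of_nonneg hsub (f := fun S => energy S g)
        fun _ _ _ => energy_nonneg _ _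
      rwa [Finset.sum_pair hne'] at this
    have htc := traceConst_nonneg d hK
    have hcc := chainConst_nonneg d hK p.length
    have hs := size_nonneg S.1
    have hr := size_nonneg R.1
    have hvS0 := hS.1.vol_pos
    set a := simplexMean S.1 g - simplexMean R.1 g
    set b := simplexMean R.1 g - c
    have hab : simplexMean S.1 g - c = a + b := by simp only [a, b]; ring
    rw [hab, SimpleGraph.Walk.length_cons, chainConst]
    calc simplexVol S.1 * (a + b) ^ 2
        ≤ 2 * (simplexVol S.1 * a ^ 2) + 2 * (simplexVol S.1 * b ^ 2) := by
          nlinarith [mul_nonneg hvS0.le (sq_nonneg (a - b))]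
      _ ≤ 2 * (2 * K * traceConst d K * Mesh.size S.1 ^ 2 * starEnergy M z g) +
          2 * ((K * K) ^ d * (chainConst d K p.length * (K * Mesh.size S.1) ^ 2 *
            starEnergy M z g)) := by
          have e1 : simplexVol S.1 * a ^ 2 ≤
              2 * K * traceConst d K * Mesh.size S.1 ^ 2 * starEnergy M z g :=
            h1.trans (by gcongr)
          have e2 : simplexVol S.1 * b ^ 2 ≤ (K * K) ^ d * (chainConst d K p.length *
              (K * Mesh.size S.1) ^ 2 * starEnergy M z g) := by
            calc simplexVol S.1 * b ^ 2 ≤ (K * K) ^ d * simplexVol R.1 * b ^ 2 := by gcongr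
              _ = (K * K) ^ d * (simplexVol R.1 * b ^ 2) := by ring
              _ ≤ (K * K) ^ d * (chainConst d K p.length * Mesh.size R.1 ^ 2 *
                  starEnergy M z g) := by gcongr
              _ ≤ _ := by gcongr
          linarith
      _ = _ := by ring

/-- The constant of the mean value estimates on vertex stars. -/
noncomputable def starConst (d : ℕ) (K : ℝ) : ℝ := chainConst d K ⌊K ^ d⌋₊

theorem starConst_nonneg (d : ℕ) (hK : 1 ≤ K) : 0 ≤ starConst d K := chainConst_nonneg d hK _

/-- A path visits no element twice, so its length is below the cardinality of the star, which is at
most `⌊K ^ d⌋₊`; this makes the constant independent of the mesh. -/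
theorem chain_estimate_of_reachable (hd : 2 ≤ d) (hM : ∀ T ∈ M.elements, IsRegularSimplex K T)
    {g : E d → ℝ} (hg : ContDiff ℝ 1 g) (c : ℝ) {S S' : {T // T ∈ star M z}}
    (hr : (starGraph M z).Reachable S S')
    (hbase : simplexVol S'.1 * (simplexMean S'.1 g - c) ^ 2 ≤
      traceConst d K * Mesh.size S'.1 ^ 2 * starEnergy M z g) :
    simplexVol S.1 * (simplexMean S.1 g - c) ^ 2 ≤
      starConst d K * Mesh.size S.1 ^ 2 * starEnergy M z g := by
  have hK := (hM S.1 (mem_star.1 S.2).1).one_le (by omega)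
  obtain ⟨p, hp⟩ := hr.exists_isPath
  refine (chain_estimate hd hM hg c p hbase).trans ?_
  have h1 := hp.length_lt
  rw [Fintype.card_coe] at h1
  have h2 : (star M z).card ≤ ⌊K ^ d⌋₊ :=
    Nat.le_floor (card_star_le (by omega) (by linarith) hM z)
  have h3 : chainConst d K p.length ≤ starConst d K := chainConst_mono d hK (by omega)
  have hE := starEnergy_nonneg M z g
  gcongr

/-- Mean values of elements with a common interior vertex. -/
theorem mean_sub_mean_of_interior (hd : 2 ≤ d) (hM : ∀ T ∈ M.elements, IsRegularSimplex K T)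
    {g : E d → ℝ} (hg : ContDiff ℝ 1 g) (hz : z ∈ M.domain) (hT : T ∈ star M z)
    (hT' : T' ∈ star M z) :
    simplexVol T * (simplexMean T g - simplexMean T' g) ^ 2 ≤
      starConst d K * Mesh.size T ^ 2 * starEnergy M z g := by
  have hd1 : 1 ≤ d := by omega
  have hK := (hM T (mem_star.1 hT).1).one_le hd1
  rcases starGraph_connected hd1 hT with ⟨S, -, w, hw, hwz, hb⟩ | ⟨-, hr⟩
  · exact absurd hb (not_isBoundaryFacet hd1 (mem_star.1 S.2).1 hw (mem_star.1 S.2).2 hwz.symm hz)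
  · refine chain_estimate_of_reachable hd hM hg (simplexMean T' g) (S := ⟨T, hT⟩) (hr ⟨T', hT'⟩) ?_
    have h1 := traceConst_nonneg d hK
    have h2 := starEnergy_nonneg M z g
    simp only [sub_self]
    have : 0 ≤ traceConst d K * Mesh.size T' ^ 2 * starEnergy M z g := by positivity
    simpa using this

/-- Mean values of elements with a vertex on the boundary. -/
theorem mean_of_boundary (hd : 2 ≤ d) (hM : ∀ T ∈ M.elements, IsRegularSimplex K T)
    {g : E d → ℝ} (hg : ContDiff ℝ 1 g) (hg0 : ∀ x ∉ M.domain, g x = 0) (hz : z ∉ M.domain)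
    (hT : T ∈ star M z) :
    simplexVol T * simplexMean T g ^ 2 ≤
      starConst d K * Mesh.size T ^ 2 * starEnergy M z g := by
  have hd1 : 1 ≤ d := by omega
  have hK := (hM T (mem_star.1 hT).1).one_le hd1
  rcases starGraph_connected hd1 hT with ⟨S, hr, w, hw, hwz, hb⟩ | ⟨hzD, -⟩
  · have h1 := (hM S.1 (mem_star.1 S.2).1).mean_of_facet_eq_zero hd1 hw hg fun x hx =>
      eq_zero_of_isBoundaryFacet hd1 (mem_star.1 S.2).1 hw hb hg.continuous hg0 hx
    have h2 := chain_estimate_of_reachable hd hM hg 0 (S := ⟨T, hT⟩) hr (by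
      rw [sub_zero]
      refine h1.trans ?_
      have h1 := traceConst_nonneg d hK
      have h2 := energy_le_starEnergy S.2 g
      gcongr)
    simpa using h2
  · exact absurd hzD hz

theorem setIntegral_openSimplex (T : Finset (E d)) (g : E d → ℝ) :
    ∫ x in Mesh.openSimplex T, g x = ∫ x in convexHull ℝ (T : Set (E d)), g x :=
  setIntegral_congr_set (openSimplex_ae_eq T)

theorem openSimplex_pairwiseDisjoint (S : Finset (Finset (E d))) (hS : S ⊆ M.elements) :
    (S : Set (Finset (E d))).PairwiseDisjoint Mesh.openSimplex := by
  intro T hT T' hT' hne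
  refine Set.disjoint_left.2 fun x hx hx' => hne ?_
  exact eq_of_mem_openSimplex (hS hT) (hS hT') hx (openSimplex_subset T' hx')

theorem patch_eq (M : Mesh d) (z : E d) : M.patch z = ⋃ T ∈ star M z, Mesh.openSimplex T := by
  ext x
  simp only [Mesh.patch, mem_iUnion, mem_star, exists_prop]
  constructor
  · rintro ⟨T, h1, h2, h3⟩; exact ⟨T, ⟨h1, h2⟩, h3⟩
  · rintro ⟨T, ⟨h1, h2⟩, h3⟩; exact ⟨T, h1, h2, h3⟩

theorem integral_patch {g : E d → ℝ} (hg : Continuous g) (z : E d) :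
    ∫ x in M.patch z, g x = ∑ T ∈ star M z, simplexVol T * simplexMean T g := by
  rw [patch_eq, integral_biUnion_finset _ (fun T _ => (openSimplex_isOpen T).measurableSet)
    (openSimplex_pairwiseDisjoint _ (star_subset M z)) fun T _ =>
      (continuous_integrableOn_convexHull hg T).mono_set (openSimplex_subset T)]
  refine Finset.sum_congr rfl fun T hT => ?_
  have := (isSimplex_of_mem (mem_star.1 hT).1).vol_pos
  rw [simplexMean, ← mul_assoc, mul_inv_cancel₀ this.ne', one_mul, setIntegral_openSimplex]

theorem volume_patch (z : E d) : volume.real (M.patch z) = ∑ S ∈ star M z, simplexVol S := by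
  have := integral_patch (M := M) (continuous_const (y := (1 : ℝ))) z
  rw [setIntegral_const, smul_eq_mul, mul_one] at this
  rw [this]
  refine Finset.sum_congr rfl fun S hS => ?_
  have := (isSimplex_of_mem (mem_star.1 hS).1).vol_pos
  rw [simplexMean, setIntegral_const, smul_eq_mul, mul_one, ← simplexVol, inv_mul_cancel₀ this.ne',
    mul_one]

theorem weighted_sq_sum_le {ι : Type*} (s : Finset ι) (w p : ι → ℝ) (hw : ∀ i ∈ s, 0 ≤ w i)
    (hw1 : ∑ i ∈ s, w i = 1) : (∑ i ∈ s, w i * p i) ^ 2 ≤ ∑ i ∈ s, w i * p i ^ 2 := by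
  have := (even_two.convexOn_pow (𝕜 := ℝ)).map_sum_le (t := s) (w := w) (p := p) hw hw1
    (fun _ _ => mem_univ _)
  simpa only [smul_eq_mul] using this

/-- Mean value over a vertex patch compared with the mean value over an element. -/
theorem mean_sub_patch_mean (hd : 2 ≤ d) (hM : ∀ T ∈ M.elements, IsRegularSimplex K T)
    {g : E d → ℝ} (hg : ContDiff ℝ 1 g) (hz : z ∈ M.domain) (hT : T ∈ star M z) :
    simplexVol T * (simplexMean T g - ⨍ x in M.patch z, g x) ^ 2 ≤
      starConst d K * Mesh.size T ^ 2 * starEnergy M z g := by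
  obtain ⟨V, hV⟩ : ∃ V, V = ∑ S ∈ star M z, simplexVol S := ⟨_, rfl⟩
  have hpos : ∀ S ∈ star M z, 0 < simplexVol S := fun S hS =>
    (isSimplex_of_mem (mem_star.1 hS).1).vol_pos
  have hVpos : 0 < V := hV ▸ Finset.sum_pos hpos ⟨T, hT⟩
  have hvol : volume.real (M.patch z) = V := hV ▸ volume_patch z
  -- The patch mean is the volume-weighted average of the element means, so Jensen's inequality
  -- reduces to pairs of elements.
  have hmean : simplexMean T g - ⨍ x in M.patch z, g x =
      ∑ S ∈ star M z, (V⁻¹ * simplexVol S) * (simplexMean T g - simplexMean S g) := by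
    rw [setAverage_eq, hvol, integral_patch hg.continuous, smul_eq_mul]
    simp_rw [mul_sub]
    rw [Finset.sum_sub_distrib, ← Finset.sum_mul, ← Finset.mul_sum, ← hV, inv_mul_cancel₀ hVpos.ne',
      one_mul, Finset.mul_sum]
    congr 1
    exact Finset.sum_congr rfl fun S _ => by ring
  have hw1 : ∑ S ∈ star M z, V⁻¹ * simplexVol S = 1 := by
    rw [← Finset.mul_sum, ← hV, inv_mul_cancel₀ hVpos.ne']
  have hconv := weighted_sq_sum_le (star M z) (fun S => V⁻¹ * simplexVol S)
    (fun S => simplexMean T g - simplexMean S g)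
    (fun S hS => by have := hpos S hS; positivity) hw1
  rw [hmean]
  have hT0 := hpos T hT
  calc _ ≤ simplexVol T * ∑ S ∈ star M z, V⁻¹ * simplexVol S *
        (simplexMean T g - simplexMean S g) ^ 2 := by gcongr
    _ = ∑ S ∈ star M z, V⁻¹ * simplexVol S *
        (simplexVol T * (simplexMean T g - simplexMean S g) ^ 2) := by
        rw [Finset.mul_sum]; exact Finset.sum_congr rfl fun S _ => by ring
    _ ≤ ∑ S ∈ star M z, V⁻¹ * simplexVol S *
        (starConst d K * Mesh.size T ^ 2 * starEnergy M z g) := by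
        refine Finset.sum_le_sum fun S hS => ?_
        have h1 := hpos S hS
        have h2 := mean_sub_mean_of_interior hd hM hg hz hT hS
        gcongr
    _ = _ := by rw [← Finset.sum_mul, hw1, one_mul]

end StarEstimates

end SGFEM


namespace SGFEM

section Clement

open scoped Topology Classical

variable {d : ℕ} {M : Mesh d} {T T' : Finset (E d)} {K : ℝ} {z : E d} {g : E d → ℝ}

/-! ### The Clément interpolation error of smooth functions -/

/-- The nodal values of the Clément interpolant. -/
noncomputable def nodeVal (M : Mesh d) (g : E d → ℝ) (z : E d) : ℝ :=
  if z ∈ M.domain then ⨍ x in M.patch z, g x else 0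

/-- The interpolation error on an element, extended to the whole space. -/
noncomputable def localError (M : Mesh d) (g : E d → ℝ) (T : Finset (E d)) (x : E d) : ℝ :=
  g x - ∑ z ∈ T, nodeVal M g z * bary T z x

theorem contDiff_localError {n : WithTop ℕ∞} (hg : ContDiff ℝ n g) (T : Finset (E d)) :
    ContDiff ℝ n (localError M g T) :=
  hg.sub (ContDiff.sum fun z _ => contDiff_const.mul (contDiff_affine (bary T z)))

/-- The sum of the energies on the stars of the vertices of an element. -/
noncomputable def nbhdEnergy (M : Mesh d) (T : Finset (E d)) (g : E d → ℝ) : ℝ :=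
  ∑ z ∈ T, starEnergy M z g

theorem nbhdEnergy_nonneg (M : Mesh d) (T : Finset (E d)) (g : E d → ℝ) : 0 ≤ nbhdEnergy M T g :=
  Finset.sum_nonneg fun _ _ => starEnergy_nonneg _ _ _

theorem energy_le_nbhdEnergy (hT : T ∈ M.elements) (g : E d → ℝ) :
    energy T g ≤ nbhdEnergy M T g := by
  obtain ⟨z, hz⟩ := (isSimplex_of_mem hT).nonempty
  exact (energy_le_starEnergy (mem_star.2 ⟨hT, hz⟩) g).trans
    (Finset.single_le_sum (f := fun z => starEnergy M z g)
      (fun _ _ => starEnergy_nonneg _ _ _) hz)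

/-- At a vertex outside the domain the nodal value is zero, and the mean itself is small because `g`
vanishes on a boundary facet reached by a chain in the star. -/
theorem mean_sub_nodeVal (hd : 2 ≤ d) (hM : ∀ T ∈ M.elements, IsRegularSimplex K T)
    (hg : ContDiff ℝ 1 g) (hg0 : ∀ x ∉ M.domain, g x = 0) (hT : T ∈ M.elements) (hz : z ∈ T) :
    simplexVol T * (simplexMean T g - nodeVal M g z) ^ 2 ≤
      starConst d K * Mesh.size T ^ 2 * starEnergy M z g := by
  rw [nodeVal]
  split_ifs with hzD
  · exact mean_sub_patch_mean hd hM hg hzD (mem_star.2 ⟨hT, hz⟩)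
  · rw [sub_zero]
    exact mean_of_boundary hd hM hg hg0 hzD (mem_star.2 ⟨hT, hz⟩)

theorem sum_mean_sub_nodeVal (hd : 2 ≤ d) (hM : ∀ T ∈ M.elements, IsRegularSimplex K T)
    (hg : ContDiff ℝ 1 g) (hg0 : ∀ x ∉ M.domain, g x = 0) (hT : T ∈ M.elements) :
    simplexVol T * ∑ z ∈ T, (simplexMean T g - nodeVal M g z) ^ 2 ≤
      starConst d K * Mesh.size T ^ 2 * nbhdEnergy M T g := by
  rw [nbhdEnergy, Finset.mul_sum, Finset.mul_sum]
  exact Finset.sum_le_sum fun z hz => mean_sub_nodeVal hd hM hg hg0 hT hz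

/-- The coordinates sum to `1`, so the element mean can be subtracted from `g` and from the
interpolant alike; both parts are then controlled by gradients. -/
theorem localError_eq (hT : IsSimplex T) (x : E d) :
    localError M g T x = (g x - simplexMean T g) +
      ∑ z ∈ T, bary T z x * (simplexMean T g - nodeVal M g z) := by
  simp_rw [mul_sub]
  rw [Finset.sum_sub_distrib, ← Finset.sum_mul, hT.sum_bary, localError]
  have : ∑ z ∈ T, nodeVal M g z * bary T z x = ∑ z ∈ T, bary T z x * nodeVal M g z :=
    Finset.sum_congr rfl fun _ _ => mul_comm _ _
  rw [this]; ring

/-- The `L²` interpolation error. -/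
theorem integral_localError_sq_le (hd : 2 ≤ d) (hM : ∀ T ∈ M.elements, IsRegularSimplex K T)
    (hg : ContDiff ℝ 1 g) (hg0 : ∀ x ∉ M.domain, g x = 0) (hT : T ∈ M.elements) :
    ∫ x in convexHull ℝ (T : Set (E d)), localError M g T x ^ 2 ≤
      (2 * 2 ^ d + 2 * starConst d K) * Mesh.size T ^ 2 * nbhdEnergy M T g := by
  have hTs := isSimplex_of_mem hT
  have hgc := hg.continuous
  have hec := (contDiff_localError (M := M) hg T).continuous
  set c : E d → ℝ := fun z => simplexMean T g - nodeVal M g z with hc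
  have hpt : ∀ x ∈ convexHull ℝ (T : Set (E d)), localError M g T x ^ 2 ≤
      2 * (g x - simplexMean T g) ^ 2 + 2 * ∑ z ∈ T, c z ^ 2 := by
    intro x hx
    have h1 := weighted_sq_sum_le T (fun z => bary T z x) c (hTs.mem_convexHull.1 hx)
      (hTs.sum_bary x)
    have h2 : ∑ z ∈ T, bary T z x * c z ^ 2 ≤ ∑ z ∈ T, c z ^ 2 :=
      Finset.sum_le_sum fun z _ => mul_le_of_le_one_left (sq_nonneg _) (hTs.bary_le_one z hx)
    rw [localError_eq hTs]
    set s := ∑ z ∈ T, bary T z x * c z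
    nlinarith [sq_nonneg (g x - simplexMean T g - s)]
  have hle : ∫ x in convexHull ℝ (T : Set (E d)), localError M g T x ^ 2 ≤
      ∫ x in convexHull ℝ (T : Set (E d)),
        (2 * (g x - simplexMean T g) ^ 2 + 2 * ∑ z ∈ T, c z ^ 2) :=
    setIntegral_mono_on (continuous_integrableOn_convexHull (by fun_prop) T)
      (continuous_integrableOn_convexHull (by fun_prop) T) (convexHull_isClosed T).measurableSet hpt
  rw [integral_add (continuous_integrableOn_convexHull (by fun_prop) T)
    (continuous_integrableOn_convexHull (by fun_prop) T), integral_const_mul, setIntegral_const,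
    smul_eq_mul] at hle
  have h1 := hTs.poincare hg
  have h2 := sum_mean_sub_nodeVal hd hM hg hg0 hT
  have h3 := energy_le_nbhdEnergy hT g
  have h4 : (2 : ℝ) ^ d * Mesh.size T ^ 2 * energy T g ≤
    2 ^ d * Mesh.size T ^ 2 * nbhdEnergy M T g := by gcongr
  rw [simplexVol] at h2
  linarith

/-- The `H¹` interpolation error. -/
theorem energy_localError_le (hd : 2 ≤ d) (hM : ∀ T ∈ M.elements, IsRegularSimplex K T)
    (hg : ContDiff ℝ 1 g) (hg0 : ∀ x ∉ M.domain, g x = 0) (hT : T ∈ M.elements) :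
    energy T (localError M g T) ≤
      (2 + 2 * (d + 1) * K ^ 2 * starConst d K) * nbhdEnergy M T g := by
  have hd1 : 1 ≤ d := by omega
  have hTs := isSimplex_of_mem hT
  have hs := (hM T hT).size_pos hd1
  have hgr := continuous_gradient hg
  have her := continuous_gradient (contDiff_localError (M := M) hg T)
  set c : E d → ℝ := fun z => simplexMean T g - nodeVal M g z with hc
  have hgrad : ∀ x, gradient (localError M g T) x =
      gradient g x + ∑ z ∈ T, c z • affGrad (bary T z) := by
    intro x
    have h1 : HasGradientAt g (gradient g x) x :=
      ((hg.differentiable (by simp)) x).hasGradientAt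
    have h2 : localError M g T = fun x => (g x - simplexMean T g) +
        ∑ z ∈ T, c z * bary T z x := by
      ext1 x
      rw [localError_eq hTs]
      congr 1
      exact Finset.sum_congr rfl fun _ _ => mul_comm _ _
    refine HasGradientAt.gradient ?_
    rw [h2, hasGradientAt_iff_hasFDerivAt, map_add, map_sum]
    refine (h1.hasFDerivAt.sub_const _).add (HasFDerivAt.fun_sum fun z _ => ?_)
    have := ((hasGradientAt_affine (bary T z) x).hasFDerivAt.const_mul (c z))
    simpa using this
  set B : ℝ := 2 * ((d + 1) * (K / Mesh.size T) ^ 2 * ∑ z ∈ T, c z ^ 2) with hB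
  have hpt : ∀ x, ‖gradient (localError M g T) x‖ ^ 2 ≤ 2 * ‖gradient g x‖ ^ 2 + B := by
    intro x
    rw [hgrad]
    have h1 : ‖∑ z ∈ T, c z • affGrad (bary T z)‖ ≤ ∑ z ∈ T, |c z| * (K / Mesh.size T) := by
      refine (norm_sum_le _ _).trans (Finset.sum_le_sum fun z _ => ?_)
      rw [norm_smul, Real.norm_eq_abs]
      exact mul_le_mul_of_nonneg_left ((hM T hT).norm_affGrad_le hd1 z) (abs_nonneg _)
    have h2 : (∑ z ∈ T, |c z| * (K / Mesh.size T)) ^ 2 ≤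
        (d + 1) * (K / Mesh.size T) ^ 2 * ∑ z ∈ T, c z ^ 2 := by
      rw [← Finset.sum_mul, mul_pow]
      have := sq_sum_le_card_mul_sum_sq (s := T) (f := fun z => |c z|)
      simp only [sq_abs] at this
      rw [hTs.1] at this
      push_cast at this
      calc _ ≤ ((d + 1) * ∑ z ∈ T, c z ^ 2) * (K / Mesh.size T) ^ 2 := by gcongr
        _ = _ := by ring
    have h3 := pow_le_pow_left₀ (norm_nonneg _) h1 2
    have h4 := norm_add_le (gradient g x) (∑ z ∈ T, c z • affGrad (bary T z))
    have h5 := pow_le_pow_left₀ (norm_nonneg _) h4 2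
    nlinarith [sq_nonneg (‖gradient g x‖ - ‖∑ z ∈ T, c z • affGrad (bary T z)‖)]
  have hle : energy T (localError M g T) ≤ ∫ x in convexHull ℝ (T : Set (E d)),
        (2 * ‖gradient g x‖ ^ 2 + B) :=
    setIntegral_mono_on (continuous_integrableOn_convexHull (by fun_prop) T)
      (continuous_integrableOn_convexHull (by fun_prop) T) (convexHull_isClosed T).measurableSet
      fun x _ => hpt x
  rw [integral_add (continuous_integrableOn_convexHull (by fun_prop) T)
    (continuous_integrableOn_convexHull (by fun_prop) T), integral_const_mul, setIntegral_const,
    smul_eq_mul] at hle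
  have h2 := sum_mean_sub_nodeVal hd hM hg hg0 hT
  have h3 := energy_le_nbhdEnergy hT g
  have h5 : simplexVol T * B ≤ 2 * (d + 1) * K ^ 2 * starConst d K * nbhdEnergy M T g := by
    calc simplexVol T * B = 2 * (d + 1) * (K / Mesh.size T) ^ 2 *
          (simplexVol T * ∑ z ∈ T, c z ^ 2) := by rw [hB]; ring
      _ ≤ 2 * (d + 1) * (K / Mesh.size T) ^ 2 *
          (starConst d K * Mesh.size T ^ 2 * nbhdEnergy M T g) := by gcongr
      _ = _ := by field_simp
  rw [← energy, ← simplexVol] at hle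
  linarith

/-- The constant of the facet estimate. -/
noncomputable def facetConst (d : ℕ) (K : ℝ) : ℝ :=
  K * ((d + 1) * (2 * 2 ^ d + 2 * starConst d K) + (2 + 2 * (d + 1) * K ^ 2 * starConst d K))

/-- The interpolation error on facets. -/
theorem facet_localError_le (hd : 2 ≤ d) (hM : ∀ T ∈ M.elements, IsRegularSimplex K T)
    (hg : ContDiff ℝ 1 g) (hg0 : ∀ x ∉ M.domain, g x = 0) (hT : T ∈ M.elements) (hz : z ∈ T) :
    ∫ x, localError M g T x ^ 2 ∂facetMeasure T z ≤
      facetConst d K * Mesh.size T * nbhdEnergy M T g := by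
  have hd1 : 1 ≤ d := by omega
  have hTs := isSimplex_of_mem hT
  have hs := (hM T hT).size_pos hd1
  have hK := (hM T hT).one_le hd1
  have h1 := hTs.trace hd1 hz (contDiff_localError (M := M) hg T)
  have h2 := integral_localError_sq_le hd hM hg hg0 hT
  have h3 := energy_localError_le hd hM hg hg0 hT
  have h4 := (hM T hT).size_le_height hd1 hz
  set J := ∫ x, localError M g T x ^ 2 ∂facetMeasure T z
  have hJ : 0 ≤ J := integral_nonneg fun _ => sq_nonneg _
  have h5 : Mesh.size T * J ≤ Mesh.size T * (facetConst d K * Mesh.size T * nbhdEnergy M T g) := by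
    calc Mesh.size T * J ≤ K * height T z * J := by gcongr
      _ = K * (height T z * J) := by ring
      _ ≤ K * ((d + 1) * ((2 * 2 ^ d + 2 * starConst d K) * Mesh.size T ^ 2 * nbhdEnergy M T g) +
          Mesh.size T ^ 2 * ((2 + 2 * (d + 1) * K ^ 2 * starConst d K) * nbhdEnergy M T g)) := by
          refine mul_le_mul_of_nonneg_left (h1.trans ?_) (by linarith)
          gcongr
      _ = _ := by rw [facetConst]; ring
  exact le_of_mul_le_mul_left h5 hs

/-- Finite overlap. -/
theorem sum_nbhdEnergy_le (hd : 2 ≤ d) (hK : 0 ≤ K) (hM : ∀ T ∈ M.elements, IsRegularSimplex K T)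
    (g : E d → ℝ) :
    ∑ T ∈ M.elements, nbhdEnergy M T g ≤ (d + 1) * K ^ d * ∑ T ∈ M.elements, energy T g := by
  have h1 : ∀ T ∈ M.elements, nbhdEnergy M T g =
      ∑ S ∈ M.elements, ∑ z ∈ S, if z ∈ T then energy S g else 0 := by
    intro T hT
    have h2 : nbhdEnergy M T g = ∑ z ∈ T, ∑ S ∈ M.elements, if z ∈ S then energy S g else 0 :=
      Finset.sum_congr rfl fun z _ => by rw [starEnergy, star, Finset.sum_filter]
    rw [h2, Finset.sum_comm]
    refine Finset.sum_congr rfl fun S _ => ?_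
    rw [← Finset.sum_filter, ← Finset.sum_filter]
    refine Finset.sum_congr ?_ fun _ _ => rfl
    ext z; simp [and_comm]
  -- The energy of `S` is counted once for each vertex `z` of `S` and each element of the star of
  -- `z`, at most `(d + 1) * K ^ d` times.
  rw [Finset.sum_congr rfl h1, Finset.sum_comm, Finset.mul_sum]
  refine Finset.sum_le_sum fun S hS => ?_
  rw [Finset.sum_comm]
  have h3 : ∀ z ∈ S, ∑ T ∈ M.elements, (if z ∈ T then energy S g else 0) ≤ K ^ d * energy S g := by
    intro z _
    rw [← Finset.sum_filter, Finset.sum_const, nsmul_eq_mul]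
    exact mul_le_mul_of_nonneg_right (card_star_le (by omega) hK hM z) (energy_nonneg _ _)
  refine (Finset.sum_le_sum h3).trans ?_
  rw [Finset.sum_const, nsmul_eq_mul, (isSimplex_of_mem hS).1]
  push_cast
  exact le_of_eq (by ring)

/-! ### Elementwise integration by parts -/

/-- Continuity of the interpolant across faces. As `bary` is zero off the vertex set, both sums may
be taken over the union of the vertices, where the coordinates agree at `x`. -/
theorem localError_eq_on_inter (hT : T ∈ M.elements) (hT' : T' ∈ M.elements) {x : E d}
    (hx : x ∈ convexHull ℝ (T : Set (E d))) (hx' : x ∈ convexHull ℝ (T' : Set (E d))) :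
    localError M g T x = localError M g T' x := by
  have h1 : ∀ S S' : Finset (E d), ∑ z ∈ S, nodeVal M g z * bary S z x =
      ∑ z ∈ S ∪ S', nodeVal M g z * bary S z x := fun S S' =>
    Finset.sum_subset Finset.subset_union_left fun z _ hz => by
      rw [bary_of_notMem hz]; simp
  rw [localError, localError, h1 T T', h1 T' T, Finset.union_comm]
  congr 1
  exact Finset.sum_congr rfl fun z _ => by rw [bary_eq_bary hT hT' hx hx' z]

/-- Here `g` vanishes by continuity, the vertices of the facet are not interior and have nodal value
zero, and the coordinate of the opposite vertex vanishes. -/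
theorem localError_eq_zero_on_boundary (hd : 2 ≤ d) (hg : Continuous g)
    (hg0 : ∀ x ∉ M.domain, g x = 0) (hT : T ∈ M.elements) {w : E d} (hw : w ∈ T)
    (hb : IsBoundaryFacet M T w) {x : E d} (hx : x ∈ facetSet T w) : localError M g T x = 0 := by
  have hd1 : 1 ≤ d := by omega
  rw [localError, eq_zero_of_isBoundaryFacet hd1 hT hw hb hg hg0 hx, Finset.sum_eq_zero, sub_zero]
  intro z hz
  by_cases hzw : z = w
  · rw [hzw, (((isSimplex_of_mem hT).mem_facetSet hw).1 hx).2, mul_zero]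
  · have : z ∉ M.domain := fun h => not_isBoundaryFacet hd1 hT hw hz hzw h hb
    rw [nodeVal, if_neg this, zero_mul]

theorem mem_interiorFaces {F : Finset (E d)} : F ∈ M.interiorFaces ↔
    F ∈ M.faces ∧ F.card = d ∧ (M.elements.filter fun T => F ⊆ T).card = 2 := by
  simp [Mesh.interiorFaces]

/-- At most two elements share a facet (`eq_of_three`), so having some other neighbour is the same
as having exactly two adjacent elements. -/
theorem erase_mem_interiorFaces (hd : 1 ≤ d) (hT : T ∈ M.elements) (hz : z ∈ T) :
    T.erase z ∈ M.interiorFaces ↔ ¬ IsBoundaryFacet M T z := by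
  have hTF : T ∈ M.elements.filter fun S => T.erase z ⊆ S :=
    Finset.mem_filter.2 ⟨hT, Finset.erase_subset _ _⟩
  have hcard : (T.erase z).card = d := by
    rw [Finset.card_erase_of_mem hz, (isSimplex_of_mem hT).1]; omega
  rw [mem_interiorFaces]
  constructor
  · rintro ⟨-, -, h2⟩ hb
    have : M.elements.filter (fun S => T.erase z ⊆ S) ⊆ {T} := fun S hS => by
      rw [Finset.mem_filter] at hS
      rw [Finset.mem_singleton]
      exact hb S hS.1 hS.2
    have := Finset.card_le_card this
    rw [h2] at this; simp at this
  · intro hb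
    rw [IsBoundaryFacet] at hb
    push Not at hb
    obtain ⟨T', hT', hF, hne⟩ := hb
    refine ⟨M.toSimplicialComplex.down_closed (mem_elements.1 hT).1 (Finset.erase_subset _ _) ?_,
      hcard, ?_⟩
    · rw [← Finset.card_pos, hcard]; omega
    · have : M.elements.filter (fun S => T.erase z ⊆ S) = {T, T'} := by
        ext S
        rw [Finset.mem_filter, Finset.mem_insert, Finset.mem_singleton]
        constructor
        · rintro ⟨hS, hFS⟩
          by_cases hST : S = T
          · exact Or.inl hST
          · exact Or.inr (eq_of_three hd hT hS hT' hz hFS hF hST hne)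
        · rintro (rfl | rfl)
          · exact Finset.mem_filter.1 hTF
          · exact ⟨hT', hF⟩
      rw [this, Finset.card_pair hne.symm]

theorem exists_eq_erase {F : Finset (E d)} (hT : T ∈ M.elements) (hF : F.card = d) (hFT : F ⊆ T) :
    ∃ z ∈ T, F = T.erase z := by
  have hcard : (T \ F).card = 1 := by
    rw [Finset.card_sdiff_of_subset hFT, hF, (isSimplex_of_mem hT).1]; omega
  obtain ⟨z, hz⟩ := Finset.card_eq_one.1 hcard
  have hz' : z ∈ T \ F := by rw [hz]; simp
  rw [Finset.mem_sdiff] at hz'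
  refine ⟨z, hz'.1, Finset.eq_of_subset_of_card_le (fun x hx => Finset.mem_erase.2
    ⟨fun e => hz'.2 (e ▸ hx), hFT hx⟩) ?_⟩
  rw [hF, Finset.card_erase_of_mem hz'.1, (isSimplex_of_mem hT).1]; omega

/-- Passes from facets indexed by their opposite vertices to interior faces of the mesh, which makes
the exchange of the two summations possible. -/
theorem sum_facets (hd : 1 ≤ d) (hT : T ∈ M.elements) (J : Finset (E d) → ℝ)
    (hJ : ∀ z ∈ T, IsBoundaryFacet M T z → J (T.erase z) = 0) :
    ∑ z ∈ T, J (T.erase z) = ∑ F ∈ M.interiorFaces.filter (fun F => F ⊆ T), J F := by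
  have himg : M.interiorFaces.filter (fun F => F ⊆ T) ⊆ T.image fun z => T.erase z := by
    intro F hF
    rw [Finset.mem_filter] at hF
    obtain ⟨z, hz, rfl⟩ := exists_eq_erase hT (mem_interiorFaces.1 hF.1).2.1 hF.2
    exact Finset.mem_image_of_mem _ hz
  rw [Finset.sum_subset himg, Finset.sum_image]
  · exact fun z hz w hw h => Finset.erase_injOn T hz hw h
  · intro F hF hF'
    obtain ⟨z, hz, rfl⟩ := Finset.mem_image.1 hF
    refine hJ z hz ?_
    by_contra hb
    exact hF' (Finset.mem_filter.2 ⟨(erase_mem_interiorFaces hd hT hz).2 hb,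
      Finset.erase_subset _ _⟩)

/-- The surface measure on a face. -/
noncomputable def faceMeasure (F : Finset (E d)) : Measure (E d) :=
  (Measure.euclideanHausdorffMeasure (d - 1)).restrict (convexHull ℝ (F : Set (E d)))

theorem facetMeasure_eq (T : Finset (E d)) (z : E d) :
    facetMeasure T z = faceMeasure (T.erase z) := by
  rw [facetMeasure, faceMeasure, facetSet_eq_erase]

/-- The boundary terms of all elements are regrouped by faces. Boundary facets drop out because the
error is zero there, and an interior face collects the contributions of its two sides. -/
theorem elements_sum_by_parts (hd : 2 ≤ d) {q : Finset (E d) → E d → E d}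
    (hq : ∀ T ∈ M.elements, ContDiff ℝ 1 (q T)) (hg : ContDiff ℝ 1 g)
    (hg0 : ∀ x ∉ M.domain, g x = 0) :
    ∑ T ∈ M.elements, ∫ x in convexHull ℝ (T : Set (E d)),
        inner ℝ (q T x) (gradient (localError M g T) x) =
      -(∑ T ∈ M.elements, ∫ x in convexHull ℝ (T : Set (E d)),
          divergence (q T) x * localError M g T x) +
        ∑ F ∈ M.interiorFaces, ∑ T ∈ M.elements.filter (fun T => F ⊆ T),
          ∫ x, inner ℝ (q T x) (Mesh.outerNormal T F) * localError M g T x ∂faceMeasure F := by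
  have hd1 : 1 ≤ d := by omega
  have hT : ∀ T ∈ M.elements, ∫ x in convexHull ℝ (T : Set (E d)),
        inner ℝ (q T x) (gradient (localError M g T) x) =
      -(∫ x in convexHull ℝ (T : Set (E d)), divergence (q T) x * localError M g T x) +
        ∑ F ∈ M.interiorFaces.filter (fun F => F ⊆ T),
          ∫ x, inner ℝ (q T x) (Mesh.outerNormal T F) * localError M g T x ∂faceMeasure F := by
    intro T hT
    have hTs := isSimplex_of_mem hT
    rw [hTs.integral_inner_gradient hd1 (hq T hT) (contDiff_localError hg T), sub_eq_add_neg]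
    congr 1
    rw [← sum_facets hd1 hT (fun F => ∫ x, inner ℝ (q T x) (Mesh.outerNormal T F) *
      localError M g T x ∂faceMeasure F), ← Finset.sum_neg_distrib]
    · refine Finset.sum_congr rfl fun z hz => ?_
      rw [facetMeasure_eq, ← integral_const_mul, ← integral_neg]
      congr 1
      ext x
      rw [hTs.outerNormal_eq hd1 hz, inner_neg_right, inner_smul_right]
      ring
    · intro z hz hb
      rw [← facetMeasure_eq]
      refine integral_eq_zero_of_ae ?_
      filter_upwards [ae_restrict_mem (facetSet_isClosed T z).measurableSet] with x hx
      rw [localError_eq_zero_on_boundary hd hg.continuous hg0 hT hz hb hx]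
      simp
  rw [Finset.sum_congr rfl hT, Finset.sum_add_distrib, Finset.sum_neg_distrib]
  congr 1
  refine Finset.sum_comm' fun T F => ?_
  simp only [Finset.mem_filter]
  tauto

end Clement

end SGFEM


namespace SGFEM

/-! ### The residual estimate for smooth functions -/

section SmoothBound

open scoped Topology Classical

variable {d : ℕ} {M : Mesh d} {T T' : Finset (E d)} {K : ℝ} {z : E d} {g : E d → ℝ}

/-- The Cauchy-Schwarz inequality for integrals. -/
theorem integral_mul_sq_le {α : Type*} [MeasurableSpace α] {μ : Measure α} {f g : α → ℝ}
    (hf : MemLp f 2 μ) (hg : MemLp g 2 μ) :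
    (∫ x, f x * g x ∂μ) ^ 2 ≤ (∫ x, f x ^ 2 ∂μ) * ∫ x, g x ^ 2 ∂μ := by
  have h1 := hf.integrable_sq
  have h2 := hg.integrable_sq
  have h3 : Integrable (fun x => f x * g x) μ := hf.integrable_mul hg
  have hq : ∀ t : ℝ, 0 ≤ (∫ x, g x ^ 2 ∂μ) * (t * t) + (2 * ∫ x, f x * g x ∂μ) * t +
      ∫ x, f x ^ 2 ∂μ := by
    intro t
    have h0 : 0 ≤ ∫ x, (f x + t * g x) ^ 2 ∂μ := integral_nonneg fun _ => sq_nonneg _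
    have : ∀ x, (f x + t * g x) ^ 2 = t * t * g x ^ 2 + 2 * t * (f x * g x) + f x ^ 2 :=
      fun x => by ring
    simp_rw [this] at h0
    have h4 : Integrable (fun x => t * t * g x ^ 2 + 2 * t * (f x * g x)) μ :=
      (h2.const_mul _).add (h3.const_mul _)
    rw [integral_add h4 h1, integral_add (h2.const_mul _) (h3.const_mul _), integral_const_mul, integral_const_mul] at h0
    linarith
  have := discrim_le_zero hq
  rw [discrim] at this
  nlinarith

/-- The discrete Cauchy–Schwarz inequality, for terms that are themselves bounded by a
Cauchy–Schwarz product. -/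
theorem abs_sum_le_sqrt {ι : Type*} (s : Finset ι) {x A B : ι → ℝ} (hA : ∀ i ∈ s, 0 ≤ A i)
    (hB : ∀ i ∈ s, 0 ≤ B i) (h : ∀ i ∈ s, x i ^ 2 ≤ A i * B i) :
    |∑ i ∈ s, x i| ≤ √(∑ i ∈ s, A i) * √(∑ i ∈ s, B i) := by
  rw [← Real.sqrt_mul (Finset.sum_nonneg hA)]
  apply Real.abs_le_sqrt
  have h1 : |∑ i ∈ s, x i| ≤ ∑ i ∈ s, √(A i) * √(B i) := by
    refine (Finset.abs_sum_le_sum_abs _ _).trans (Finset.sum_le_sum fun i hi => ?_)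
    rw [← Real.sqrt_mul (hA i hi)]
    exact Real.abs_le_sqrt (h i hi)
  have h2 := Finset.sum_mul_sq_le_sq_mul_sq s (fun i => √(A i)) fun i => √(B i)
  have h3 : ∑ i ∈ s, √(A i) ^ 2 = ∑ i ∈ s, A i :=
    Finset.sum_congr rfl fun i hi => Real.sq_sqrt (hA i hi)
  have h4 : ∑ i ∈ s, √(B i) ^ 2 = ∑ i ∈ s, B i :=
    Finset.sum_congr rfl fun i hi => Real.sq_sqrt (hB i hi)
  rw [h3, h4] at h2
  rw [← sq_abs]
  exact (pow_le_pow_left₀ (abs_nonneg _) h1 2).trans h2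

/-- The squared residual estimator of a piecewise smooth flux `q` and a right-hand side `f`. -/
noncomputable def etaSq (M : Mesh d) (f : E d → ℝ) (q : Finset (E d) → E d → E d) : ℝ :=
  (∑ T ∈ M.elements, Mesh.size T ^ 2 *
    ∫ x in convexHull ℝ (T : Set (E d)), (f x + divergence (q T) x) ^ 2) +
  ∑ F ∈ M.interiorFaces, Mesh.size F *
    ∫ x, (∑ T ∈ M.elements.filter (fun T => F ⊆ T),
      inner ℝ (q T x) (Mesh.outerNormal T F)) ^ 2 ∂faceMeasure F

/-- The constant of the residual estimate. -/
noncomputable def detConst (d : ℕ) (K : ℝ) : ℝ :=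
  √((2 * 2 ^ d + 2 * starConst d K) * ((d + 1) * K ^ d)) +
    √(K * facetConst d K * ((d + 1) * ((d + 1) * K ^ d)))

theorem facetConst_nonneg (d : ℕ) (hK : 1 ≤ K) : 0 ≤ facetConst d K := by
  have := starConst_nonneg d hK
  unfold facetConst
  positivity

theorem continuous_divergence {q : E d → E d} (hq : ContDiff ℝ 1 q) : Continuous (divergence q) := by
  have hfq : Continuous (fderiv ℝ q) := hq.continuous_fderiv one_ne_zero
  unfold divergence
  fun_prop

theorem memLp_convexHull {f : E d → ℝ} (hf : Continuous f) (T : Finset (E d)) :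
    MemLp f 2 (volume.restrict (convexHull ℝ (T : Set (E d)))) := by
  have : IsFiniteMeasure (volume.restrict (convexHull ℝ (T : Set (E d)))) := ⟨by
    rw [Measure.restrict_apply_univ]; exact (convexHull_isCompact T).measure_lt_top⟩
  obtain ⟨C, hC⟩ := (convexHull_isCompact T).exists_bound_of_continuousOn hf.continuousOn
  refine MemLp.of_bound hf.aestronglyMeasurable C ?_
  filter_upwards [ae_restrict_mem (convexHull_isClosed T).measurableSet] with x hx using hC x hx

theorem exists_element_of_interiorFace {F : Finset (E d)} (hF : F ∈ M.interiorFaces) :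
    ∃ T ∈ M.elements, F ⊆ T ∧ ∃ z ∈ T, F = T.erase z := by
  obtain ⟨-, h1, h2⟩ := mem_interiorFaces.1 hF
  obtain ⟨T, hT⟩ := Finset.card_pos.1 (by rw [h2]; norm_num :
    0 < (M.elements.filter fun T => F ⊆ T).card)
  rw [Finset.mem_filter] at hT
  exact ⟨T, hT.1, hT.2, exists_eq_erase hT.1 h1 hT.2⟩

theorem isFiniteMeasure_faceMeasure (hd : 1 ≤ d) {F : Finset (E d)} (hF : F ∈ M.interiorFaces) :
    IsFiniteMeasure (faceMeasure F) := by
  obtain ⟨T, hT, -, z, hz, rfl⟩ := exists_element_of_interiorFace hF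
  rw [← facetMeasure_eq]
  exact (isSimplex_of_mem hT).isFiniteMeasure_facet hd hz

theorem memLp_face (hd : 1 ≤ d) {F : Finset (E d)} (hF : F ∈ M.interiorFaces) {f : E d → ℝ}
    (hf : Continuous f) : MemLp f 2 (faceMeasure F) := by
  have := isFiniteMeasure_faceMeasure hd hF
  obtain ⟨C, hC⟩ := (convexHull_isCompact F).exists_bound_of_continuousOn hf.continuousOn
  refine MemLp.of_bound hf.aestronglyMeasurable C ?_
  filter_upwards [ae_restrict_mem (convexHull_isClosed F).measurableSet] with x hx using hC x hx

theorem card_faces_le (hT : T ∈ M.elements) :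
    ((M.interiorFaces.filter fun F => F ⊆ T).card : ℝ) ≤ d + 1 := by
  have hsub : M.interiorFaces.filter (fun F => F ⊆ T) ⊆ T.image fun z => T.erase z := by
    intro F hF
    rw [Finset.mem_filter] at hF
    obtain ⟨z, hz, rfl⟩ := exists_eq_erase hT (mem_interiorFaces.1 hF.1).2.1 hF.2
    exact Finset.mem_image_of_mem _ hz
  have h1 := (Finset.card_le_card hsub).trans Finset.card_image_le
  rw [(isSimplex_of_mem hT).1] at h1
  exact_mod_cast h1

/-- A face has at least two vertices because `d ≥ 2`, and every edge of a regular simplex is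
comparable to its diameter. -/
theorem size_le_size_face (hd : 2 ≤ d) (hT : IsRegularSimplex K T) {F : Finset (E d)}
    (hF : F.card = d) (hFT : F ⊆ T) : Mesh.size T ≤ K * Mesh.size F := by
  obtain ⟨a, ha, b, hb, hab⟩ := Finset.one_lt_card.1 (by omega : 1 < F.card)
  exact hT.size_le_of_edge (by omega) (hFT ha) (hFT hb) hab.symm ha hb

/-- The residual estimate for the Clément interpolation error of a smooth function. -/
theorem smooth_residual_bound (hd : 2 ≤ d) (hK : 1 ≤ K)
    (hM : ∀ T ∈ M.elements, IsRegularSimplex K T)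
    {q : Finset (E d) → E d → E d} (hq : ∀ T ∈ M.elements, ContDiff ℝ 1 (q T)) {f : E d → ℝ}
    (hf : ∀ T ∈ M.elements, MemLp f 2 (volume.restrict (convexHull ℝ (T : Set (E d)))))
    (hg : ContDiff ℝ 1 g) (hg0 : ∀ x ∉ M.domain, g x = 0) :
    |∑ T ∈ M.elements, ∫ x in convexHull ℝ (T : Set (E d)),
        (f x * localError M g T x - inner ℝ (q T x) (gradient (localError M g T) x))| ≤
      detConst d K * √(etaSq M f q) * √(∑ T ∈ M.elements, energy T g) := by
  have hd1 : 1 ≤ d := by omega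
  have hsc := starConst_nonneg d hK
  have hfc := facetConst_nonneg d hK
  have hec : ∀ T, Continuous (localError M g T) := fun T => (contDiff_localError hg T).continuous
  have hmem : ∀ T ∈ M.elements, MemLp (fun x => f x + divergence (q T) x) 2
      (volume.restrict (convexHull ℝ (T : Set (E d)))) := fun T hT =>
    (hf T hT).add (memLp_convexHull (continuous_divergence (hq T hT)) T)
  -- One adjacent element is fixed for every face. The error has the same trace from both sides, so
  -- the whole jump is tested with the error of this element.
  choose! TF hTF hFT hTFz using fun F (hF : F ∈ M.interiorFaces) => exists_element_of_interiorFace hF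
  set RT : Finset (E d) → ℝ := fun T => ∫ x in convexHull ℝ (T : Set (E d)),
    (f x + divergence (q T) x) * localError M g T x with hRT
  set jump : Finset (E d) → E d → ℝ := fun F x => ∑ T ∈ M.elements.filter (fun T => F ⊆ T),
      inner ℝ (q T x) (Mesh.outerNormal T F) with hjump
  set RF : Finset (E d) → ℝ := fun F => ∫ x, jump F x * localError M g (TF F) x ∂faceMeasure F
    with hRF
  have hjc : ∀ F, Continuous (jump F) := fun F => by
    refine continuous_finsetSum _ fun T hT => ?_
    exact (hq T (Finset.mem_filter.1 hT).1).continuous.inner continuous_const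
  have hid : ∑ T ∈ M.elements, ∫ x in convexHull ℝ (T : Set (E d)),
        (f x * localError M g T x - inner ℝ (q T x) (gradient (localError M g T) x)) =
      ∑ T ∈ M.elements, RT T - ∑ F ∈ M.interiorFaces, RF F := by
    have e1 : ∀ T ∈ M.elements, Integrable (fun x => f x * localError M g T x)
        (volume.restrict (convexHull ℝ (T : Set (E d)))) := fun T hT =>
      (hf T hT).integrable_mul (memLp_convexHull (hec T) T)
    have e2 : ∀ T ∈ M.elements, IntegrableOn
        (fun x => inner ℝ (q T x) (gradient (localError M g T) x))
        (convexHull ℝ (T : Set (E d))) := fun T hT =>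
      continuous_integrableOn_convexHull ((hq T hT).continuous.inner
        (continuous_gradient (contDiff_localError hg T))) T
    have e3 : ∀ T ∈ M.elements, IntegrableOn (fun x => divergence (q T) x * localError M g T x)
        (convexHull ℝ (T : Set (E d))) := fun T hT =>
      continuous_integrableOn_convexHull ((continuous_divergence (hq T hT)).mul (hec T)) T
    rw [Finset.sum_congr rfl fun T hT => integral_sub (e1 T hT) (e2 T hT),
      Finset.sum_sub_distrib, elements_sum_by_parts hd hq hg hg0]
    have e4 : ∑ T ∈ M.elements, RT T = ∑ T ∈ M.elements,
        (∫ x in convexHull ℝ (T : Set (E d)), f x * localError M g T x) +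
        ∑ T ∈ M.elements, ∫ x in convexHull ℝ (T : Set (E d)),
          divergence (q T) x * localError M g T x := by
      rw [← Finset.sum_add_distrib]
      refine Finset.sum_congr rfl fun T hT => ?_
      rw [← integral_add (e1 T hT) (e3 T hT)]
      refine integral_congr_ae (Eventually.of_forall fun x => ?_)
      beta_reduce; ring
    have e5 : ∑ F ∈ M.interiorFaces, RF F =
        ∑ F ∈ M.interiorFaces, ∑ T ∈ M.elements.filter (fun T => F ⊆ T),
          ∫ x, inner ℝ (q T x) (Mesh.outerNormal T F) * localError M g T x ∂faceMeasure F := by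
      refine Finset.sum_congr rfl fun F hF => ?_
      have : ∀ T ∈ M.elements.filter (fun T => F ⊆ T),
          ∫ x, inner ℝ (q T x) (Mesh.outerNormal T F) * localError M g T x ∂faceMeasure F =
          ∫ x, inner ℝ (q T x) (Mesh.outerNormal T F) * localError M g (TF F) x ∂faceMeasure F := by
        intro T hT
        obtain ⟨hT, hFT'⟩ := Finset.mem_filter.1 hT
        refine integral_congr_ae ?_
        filter_upwards [ae_restrict_mem (convexHull_isClosed F).measurableSet] with x hx
        rw [localError_eq_on_inter hT (hTF F hF) (convexHull_mono (by exact_mod_cast hFT') hx)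
          (convexHull_mono (by exact_mod_cast hFT F hF) hx)]
      rw [Finset.sum_congr rfl this, ← integral_finsetSum]
      · refine integral_congr_ae (Eventually.of_forall fun x => ?_)
        simp only [hjump, Finset.sum_mul]
      · intro T hT
        have hc := (hq T (Finset.mem_filter.1 hT).1).continuous.inner
          (continuous_const (y := Mesh.outerNormal T F)) (𝕜 := ℝ)
        exact (memLp_face hd1 hF hc).integrable_mul (memLp_face hd1 hF (hec _))
    rw [e4, e5]; ring
  rw [hid]
  set N := ∑ T ∈ M.elements, energy T g with hN
  have hN0 : 0 ≤ N := Finset.sum_nonneg fun _ _ => energy_nonneg _ _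
  have hover := sum_nbhdEnergy_le hd (by linarith : 0 ≤ K) hM g
  set A := ∑ T ∈ M.elements, Mesh.size T ^ 2 *
    ∫ x in convexHull ℝ (T : Set (E d)), (f x + divergence (q T) x) ^ 2 with hA
  set B := ∑ F ∈ M.interiorFaces, Mesh.size F * ∫ x, jump F x ^ 2 ∂faceMeasure F with hB
  have hA0 : ∀ T ∈ M.elements, 0 ≤ Mesh.size T ^ 2 *
    ∫ x in convexHull ℝ (T : Set (E d)), (f x + divergence (q T) x) ^ 2 := fun T _ =>
    mul_nonneg (sq_nonneg _) (integral_nonneg fun _ => sq_nonneg _)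
  have hB0 : ∀ F ∈ M.interiorFaces, 0 ≤ Mesh.size F * ∫ x, jump F x ^ 2 ∂faceMeasure F :=
    fun F _ => mul_nonneg (size_nonneg F) (integral_nonneg fun _ => sq_nonneg _)
  have heta : etaSq M f q = A + B := rfl
  -- The power of the diameter in the interpolation estimate is moved to the residual, which
  -- produces the weights of the estimator.
  have hel : |∑ T ∈ M.elements, RT T| ≤ √A *
      √(∑ T ∈ M.elements, (2 * 2 ^ d + 2 * starConst d K) * nbhdEnergy M T g) := by
    refine abs_sum_le_sqrt _ hA0 (fun T _ => mul_nonneg (by positivity) (nbhdEnergy_nonneg _ _ _))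
      fun T hT => ?_
    refine (integral_mul_sq_le (hmem T hT) (memLp_convexHull (hec T) T)).trans ?_
    have h1 := integral_localError_sq_le hd hM hg hg0 hT
    calc _ ≤ (∫ x in convexHull ℝ (T : Set (E d)), (f x + divergence (q T) x) ^ 2) *
          ((2 * 2 ^ d + 2 * starConst d K) * Mesh.size T ^ 2 * nbhdEnergy M T g) := by
          gcongr
      _ = _ := by ring
  have hfa : |∑ F ∈ M.interiorFaces, RF F| ≤ √B *
      √(∑ F ∈ M.interiorFaces, K * facetConst d K * nbhdEnergy M (TF F) g) := by
    refine abs_sum_le_sqrt _ hB0 (fun F _ => mul_nonneg (by positivity) (nbhdEnergy_nonneg _ _ _))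
      fun F hF => ?_
    refine (integral_mul_sq_le (memLp_face hd1 hF (hjc F)) (memLp_face hd1 hF (hec _))).trans ?_
    obtain ⟨z, hz, hFz⟩ := hTFz F hF
    have h1 := facet_localError_le hd hM hg hg0 (hTF F hF) hz
    rw [facetMeasure_eq, ← hFz] at h1
    have h2 := size_le_size_face hd (hM _ (hTF F hF)) (mem_interiorFaces.1 hF).2.1 (hFT F hF)
    have h3 := nbhdEnergy_nonneg M (TF F) g
    calc _ ≤ (∫ x, jump F x ^ 2 ∂faceMeasure F) *
          (facetConst d K * (K * Mesh.size F) * nbhdEnergy M (TF F) g) := by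
          refine mul_le_mul_of_nonneg_left (h1.trans ?_) (integral_nonneg fun _ => sq_nonneg _)
          gcongr
      _ = _ := by ring
  -- An element is selected by at most its `d + 1` faces.
  have hsumF : ∑ F ∈ M.interiorFaces, nbhdEnergy M (TF F) g ≤
      (d + 1) * ∑ T ∈ M.elements, nbhdEnergy M T g := by
    calc _ ≤ ∑ F ∈ M.interiorFaces, ∑ T ∈ M.elements.filter (fun T => F ⊆ T),
            nbhdEnergy M T g := Finset.sum_le_sum fun F hF =>
          Finset.single_le_sum (f := fun T => nbhdEnergy M T g)
            (fun _ _ => nbhdEnergy_nonneg _ _ _) (Finset.mem_filter.2 ⟨hTF F hF, hFT F hF⟩)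
      _ = ∑ T ∈ M.elements, ∑ F ∈ M.interiorFaces.filter (fun F => F ⊆ T),
            nbhdEnergy M T g := Finset.sum_comm' fun F T => by
              simp only [Finset.mem_filter]; tauto
      _ ≤ ∑ T ∈ M.elements, (d + 1) * nbhdEnergy M T g := by
          refine Finset.sum_le_sum fun T hT => ?_
          rw [Finset.sum_const, nsmul_eq_mul]
          exact mul_le_mul_of_nonneg_right (card_faces_le hT) (nbhdEnergy_nonneg _ _ _)
      _ = _ := by rw [Finset.mul_sum]
  rw [← Finset.mul_sum] at hel hfa
  have hAs : √A ≤ √(etaSq M f q) := Real.sqrt_le_sqrt (by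
    rw [heta]; linarith [Finset.sum_nonneg hB0])
  have hBs : √B ≤ √(etaSq M f q) := Real.sqrt_le_sqrt (by
    rw [heta]; linarith [Finset.sum_nonneg hA0])
  have hs1 : √((2 * 2 ^ d + 2 * starConst d K) * ∑ T ∈ M.elements, nbhdEnergy M T g) ≤
      √((2 * 2 ^ d + 2 * starConst d K) * ((d + 1) * K ^ d)) * √N := by
    rw [← Real.sqrt_mul (by positivity)]
    refine Real.sqrt_le_sqrt ?_
    rw [mul_assoc (2 * 2 ^ d + 2 * starConst d K)]
    gcongr
  have hs2 : √(K * facetConst d K * ∑ F ∈ M.interiorFaces, nbhdEnergy M (TF F) g) ≤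
      √(K * facetConst d K * ((d + 1) * ((d + 1) * K ^ d))) * √N := by
    rw [← Real.sqrt_mul (by positivity)]
    refine Real.sqrt_le_sqrt ?_
    rw [mul_assoc (K * facetConst d K), mul_assoc ((d : ℝ) + 1)]
    have : (d + 1 : ℝ) * ∑ T ∈ M.elements, nbhdEnergy M T g ≤ (d + 1) * ((d + 1) * K ^ d * N) := by
      gcongr
    have h := hsumF.trans this
    gcongr
  calc _ ≤ |∑ T ∈ M.elements, RT T| + |∑ F ∈ M.interiorFaces, RF F| := abs_sub _ _
    _ ≤ √(etaSq M f q) * (√((2 * 2 ^ d + 2 * starConst d K) * ((d + 1) * K ^ d)) * √N) +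
        √(etaSq M f q) * (√(K * facetConst d K * ((d + 1) * ((d + 1) * K ^ d))) * √N) := by
        refine add_le_add (hel.trans ?_) (hfa.trans ?_)
        · exact mul_le_mul hAs hs1 (Real.sqrt_nonneg _) (Real.sqrt_nonneg _)
        · exact mul_le_mul hBs hs2 (Real.sqrt_nonneg _) (Real.sqrt_nonneg _)
    _ = _ := by rw [detConst]; ring

end SmoothBound

end SGFEM


namespace SGFEM

/-! ### The domain as a union of elements up to null sets -/

section Domain

open scoped Topology Classical

variable {d : ℕ} {M : Mesh d} {T : Finset (E d)}

theorem domain_isOpen (M : Mesh d) : IsOpen M.domain := isOpen_interior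

theorem openSimplex_subset_domain (hT : T ∈ M.elements) : Mesh.openSimplex T ⊆ M.domain :=
  interior_mono fun _ hx => mem_space_iff_elements.2 ⟨T, hT, hx⟩

theorem domain_subset : M.domain ⊆ ⋃ T ∈ M.elements, convexHull ℝ (T : Set (E d)) := fun x hx => by
  obtain ⟨T, hT, h⟩ := mem_space_iff_elements.1 (interior_subset hx)
  exact mem_biUnion (x := T) hT h

theorem domain_ae_eq (M : Mesh d) :
    M.domain =ᵐ[volume] ⋃ T ∈ M.elements, Mesh.openSimplex T := by
  have h : (⋃ T ∈ M.elements, Mesh.openSimplex T) =ᵐ[volume]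
      ⋃ T ∈ M.elements, convexHull ℝ (T : Set (E d)) := by
    refine eventuallyEq_set.2 ?_
    have : ∀ᵐ x ∂(volume : Measure (E d)), ∀ T ∈ M.elements,
        (x ∈ Mesh.openSimplex T ↔ x ∈ convexHull ℝ (T : Set (E d))) :=
      (eventually_all_finset _).2 fun T _ => eventuallyEq_set.1 (openSimplex_ae_eq T)
    filter_upwards [this] with x hx
    simp only [mem_iUnion, exists_prop]
    exact exists_congr fun T => and_congr_right fun hT => hx T hT
  refine (LE.le.eventuallyLE domain_subset |>.trans h.symm.le).antisymm ?_
  exact LE.le.eventuallyLE (iUnion₂_subset fun T hT => openSimplex_subset_domain hT)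

theorem domain_isBounded (M : Mesh d) : Bornology.IsBounded M.domain := by
  refine Bornology.IsBounded.subset ?_ (domain_subset (M := M))
  exact (Bornology.isBounded_biUnion_finset _).2 fun T _ => (convexHull_isCompact T).isBounded

instance isFiniteMeasure_domain (M : Mesh d) : IsFiniteMeasure (volume.restrict M.domain) :=
  ⟨by simpa using (domain_isBounded M).measure_lt_top⟩

theorem setIntegral_domain {h : E d → ℝ} (hh : IntegrableOn h M.domain) :
    ∫ x in M.domain, h x = ∑ T ∈ M.elements, ∫ x in convexHull ℝ (T : Set (E d)), h x := by
  rw [setIntegral_congr_set (domain_ae_eq M),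
    integral_biUnion_finset _ (fun T _ => (openSimplex_isOpen T).measurableSet)
    (openSimplex_pairwiseDisjoint _ subset_rfl) fun T hT =>
      hh.mono_set (openSimplex_subset_domain hT)]
  exact Finset.sum_congr rfl fun T _ => setIntegral_openSimplex T h

theorem ae_domain_iff {P : E d → Prop} :
    (∀ᵐ x ∂volume.restrict M.domain, P x) ↔
      ∀ T ∈ M.elements, ∀ᵐ x ∂volume.restrict (Mesh.openSimplex T), P x := by
  rw [Measure.restrict_congr_set (domain_ae_eq M),
    ae_restrict_biUnion_finset_iff]

end Domain

/-! ### Weak gradients and the Friedrichs inequality -/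

section Sobolev

open scoped Topology Classical

variable {d : ℕ} {D : Set (E d)}

theorem gradient_add' {f g : E d → ℝ} {x : E d} (hf : DifferentiableAt ℝ f x)
    (hg : DifferentiableAt ℝ g x) :
    gradient (fun x => f x + g x) x = gradient f x + gradient g x := by
  simp only [gradient]
  rw [← map_add, ← fderiv_add hf hg]; rfl

theorem gradient_smul' {f : E d → ℝ} {x : E d} (c : ℝ) (hf : DifferentiableAt ℝ f x) :
    gradient (fun x => c * f x) x = c • gradient f x := by
  simp only [gradient]
  rw [fderiv_const_mul hf, map_smul]

/-- The test pairs already form a subspace, so `H10 D` is the closure of the test pairs, and closed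
properties need checking only for single test functions. -/
theorem mem_testPairs_of_mem_span {w : L2Pair D} (hw : w ∈ Submodule.span ℝ (testPairs D)) :
    w ∈ testPairs D := by
  induction hw using Submodule.span_induction with
  | mem x h => exact h
  | zero =>
    refine ⟨0, contDiff_const, HasCompactSupport.zero, by simp [tsupport], ?_, ?_⟩
    · exact Lp.coeFn_zero _ _ _
    · refine (Lp.coeFn_zero _ _ _).trans (Eventually.of_forall fun x => ?_)
      simp [gradient]
  | add w w' _ _ h h' =>
    obtain ⟨φ, h1, h2, h3, h4, h5⟩ := h
    obtain ⟨φ', h1', h2', h3', h4', h5'⟩ := h'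
    refine ⟨fun x => φ x + φ' x, h1.add h1', h2.add h2',
      (tsupport_add φ φ').trans (union_subset h3 h3'), ?_, ?_⟩
    · filter_upwards [Lp.coeFn_add w.1 w'.1, h4, h4'] with x ha hb hc
      rw [Prod.fst_add, ha, Pi.add_apply, hb, hc]
    · filter_upwards [Lp.coeFn_add w.2 w'.2, h5, h5'] with x ha hb hc
      rw [Prod.snd_add, ha, Pi.add_apply, hb, hc,
        gradient_add' (h1.differentiable (by simp) x) (h1'.differentiable (by simp) x)]
  | smul c w _ h =>
    obtain ⟨φ, h1, h2, h3, h4, h5⟩ := h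
    refine ⟨fun x => c * φ x, contDiff_const.mul h1, h2.mul_left,
      (tsupport_mul_subset_right (f := fun _ => c) (g := φ)).trans h3, ?_, ?_⟩
    · filter_upwards [Lp.coeFn_smul c w.1, h4] with x ha hb
      rw [Prod.smul_fst, ha, Pi.smul_apply, hb, smul_eq_mul]
    · filter_upwards [Lp.coeFn_smul c w.2, h5] with x ha hb
      rw [Prod.smul_snd, ha, Pi.smul_apply, hb, gradient_smul' c (h1.differentiable (by simp) x)]

/-- A closed property of pairs that holds for all test functions holds on `H¹₀`. -/
theorem H10_induction {p : L2Pair D → Prop} (hp : IsClosed {w | p w}) (ht : ∀ w ∈ testPairs D, p w)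
    (u : H10 D) : p u.1 := by
  have : u.1 ∈ closure (Submodule.span ℝ (testPairs D) : Set (L2Pair D)) := u.2
  exact closure_minimal (fun w hw => ht w (mem_testPairs_of_mem_span hw)) hp this

theorem test_mem_H10 {w : L2Pair D} (hw : w ∈ testPairs D) : w ∈ H10 D :=
  Submodule.le_topologicalClosure _ (Submodule.subset_span hw)

theorem norm_sq_eq_integral {α F : Type*} [MeasurableSpace α] {μ : Measure α}
    [NormedAddCommGroup F] [InnerProductSpace ℝ F] (f : Lp F 2 μ) :
    ‖f‖ ^ 2 = ∫ x, ‖f x‖ ^ 2 ∂μ := by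
  rw [← real_inner_self_eq_norm_sq, L2.inner_def]
  simp only [real_inner_self_eq_norm_sq]

/-- The weak gradient of an element of `H¹₀(D)`. -/
theorem integral_val_mul_fderiv (u : H10 D) {ψ : E d → ℝ} (hψ : ContDiff ℝ 1 ψ)
    (hc : HasCompactSupport ψ) (v : E d) :
    ∫ x in D, val u x * fderiv ℝ ψ x v = - ∫ x in D, inner ℝ (grad u x) v * ψ x := by
  have hcd : Continuous fun x => fderiv ℝ ψ x v :=
    (hψ.continuous_fderiv one_ne_zero).clm_apply continuous_const
  have hsd : HasCompactSupport fun x => fderiv ℝ ψ x v := hc.fderiv_apply (𝕜 := ℝ) v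
  have hA : MemLp (fun x => fderiv ℝ ψ x v) 2 (volume.restrict D) :=
    (hcd.memLp_of_hasCompactSupport hsd).restrict D
  have hB : MemLp (fun x => ψ x • v) 2 (volume.restrict D) :=
    ((hψ.continuous.smul continuous_const).memLp_of_hasCompactSupport hc.smul_right).restrict D
  -- Both integrals are inner products with fixed `L²` functions, hence continuous in the pair; this
  -- makes the identity a closed condition.
  have key : ∀ w : L2Pair D, (inner ℝ w.1 (hA.toLp _) = ∫ x in D, w.1 x * fderiv ℝ ψ x v) ∧
      inner ℝ w.2 (hB.toLp _) = ∫ x in D, inner ℝ (w.2 x) v * ψ x := fun w => by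
    constructor
    · rw [L2.inner_def]
      refine integral_congr_ae ?_
      filter_upwards [hA.coeFn_toLp] with x hx
      rw [hx]; simp [mul_comm]
    · rw [L2.inner_def]
      refine integral_congr_ae ?_
      filter_upwards [hB.coeFn_toLp] with x hx
      rw [hx, inner_smul_right, mul_comm]
  have := H10_induction (D := D)
    (p := fun w => (inner ℝ w.1 (hA.toLp _) : ℝ) = - inner ℝ w.2 (hB.toLp _))
    (isClosed_eq (by fun_prop) (by fun_prop)) (fun w hw => ?_) u
  · rw [(key u.1).1, (key u.1).2] at this
    exact this
  · rw [(key w).1, (key w).2]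
    obtain ⟨φ, h1, h2, h3, h4, h5⟩ := hw
    have e1 : ∫ x in D, w.1 x * fderiv ℝ ψ x v = ∫ x, φ x * fderiv ℝ ψ x v :=
      (integral_congr_ae (by filter_upwards [h4] with x hx; rw [hx])).trans
        (setIntegral_eq_integral_of_forall_compl_eq_zero fun x hx => by
          rw [image_eq_zero_of_notMem_tsupport fun h => hx (h3 h), zero_mul])
    have e2 : ∫ x in D, inner ℝ (w.2 x) v * ψ x = ∫ x, fderiv ℝ φ x v * ψ x :=
      (integral_congr_ae (by filter_upwards [h5] with x hx; rw [hx, inner_gradient])).trans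
        (setIntegral_eq_integral_of_forall_compl_eq_zero fun x hx => by
          rw [fderiv_of_notMem_tsupport (𝕜 := ℝ) fun h => hx (h3 h)]; simp)
    rw [e1, e2]
    have h1' : ContDiff ℝ 1 φ := h1.of_le (by exact_mod_cast le_top)
    have hcφ : Continuous fun x => fderiv ℝ φ x v :=
      (h1'.continuous_fderiv one_ne_zero).clm_apply continuous_const
    refine integral_mul_fderiv_eq_neg_fderiv_mul_of_integrable ?_ ?_ ?_
      (fun x _ => h1'.differentiable (by simp) x) fun x _ => hψ.differentiable (by simp) x
    · exact (hcφ.mul hψ.continuous).integrable_of_hasCompactSupport hc.mul_left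
    · exact (h1.continuous.mul hcd).integrable_of_hasCompactSupport h2.mul_right
    · exact (h1.continuous.mul hψ.continuous).integrable_of_hasCompactSupport h2.mul_right

/-- The weak gradient is determined locally by the function. -/
theorem grad_ae_eq_gradient (hD : MeasurableSet D) (u : H10 D) {U : Set (E d)} (hU : IsOpen U) (hUD : U ⊆ D)
    {p : E d → ℝ} (hp : ContDiff ℝ 1 p) (h : val u =ᵐ[volume.restrict U] p) :
    grad u =ᵐ[volume.restrict U] gradient p := by
  have hle : volume.restrict U ≤ volume.restrict D := Measure.restrict_mono_set _ hUD
  have hgu : LocallyIntegrableOn (grad u) U volume := by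
    have : LocallyIntegrable (grad u) (volume.restrict U) :=
      ((Lp.memLp (grad u)).mono_measure hle).locallyIntegrable (by norm_num)
    intro x hx
    obtain ⟨V, hV, hi⟩ := this x
    refine ⟨U ∩ V, inter_mem self_mem_nhdsWithin (mem_nhdsWithin_of_mem_nhds hV), ?_⟩
    rw [IntegrableOn, inter_comm, ← Measure.restrict_restrict₀']
    · exact hi
    · exact hU.measurableSet.nullMeasurableSet
  -- For `ψ` supported in `U`, the weak gradient of `u` and the classical gradient of `p` obey the
  -- same integration by parts. The fundamental lemma then kills each component of the difference.
  have key : ∀ i : Fin d, ∀ᵐ x, x ∈ U →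
      (inner ℝ (grad u x - gradient p x) (EuclideanSpace.single i (1 : ℝ)) : ℝ) = 0 := fun i => by
    set v : E d := EuclideanSpace.single i (1 : ℝ)
    have hgp : LocallyIntegrableOn (gradient p) U volume :=
      (continuous_gradient hp).continuousOn.locallyIntegrableOn hU.measurableSet
    refine hU.ae_eq_zero_of_integral_contDiff_smul_eq_zero ?_ fun ψ h1 h2 h3 => ?_
    · intro x hx
      obtain ⟨V, hV, hi⟩ := (hgu.sub hgp) x hx
      exact ⟨V, hV, hi.inner_const v⟩
    have h1' : ContDiff ℝ 1 ψ := h1.of_le (by exact_mod_cast le_top)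
    have hw := integral_val_mul_fderiv u h1' h2 v
    have hcd : Continuous fun x => fderiv ℝ ψ x v :=
      (h1'.continuous_fderiv one_ne_zero).clm_apply continuous_const
    have hcp : Continuous fun x => fderiv ℝ p x v :=
      (hp.continuous_fderiv one_ne_zero).clm_apply continuous_const
    have e1 : ∫ x in D, val u x * fderiv ℝ ψ x v = ∫ x, p x * fderiv ℝ ψ x v := by
      have h0 : ∀ x, x ∉ U → fderiv ℝ ψ x v = 0 := fun x hx => by
        rw [fderiv_of_notMem_tsupport (𝕜 := ℝ) fun h => hx (h3 h)]; simp
      rw [setIntegral_eq_of_subset_of_forall_sdiff_eq_zero hD hUD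
        fun x hx => by rw [h0 x hx.2, mul_zero]]
      exact (integral_congr_ae (by filter_upwards [h] with x hx; rw [hx])).trans
        (setIntegral_eq_integral_of_forall_compl_eq_zero fun x hx => by rw [h0 x hx, mul_zero])
    have h0 : ∀ x, x ∉ U → ψ x = 0 := fun x hx =>
      image_eq_zero_of_notMem_tsupport fun h => hx (h3 h)
    have e2 : ∫ x in D, inner ℝ (grad u x) v * ψ x = ∫ x, ψ x * inner ℝ (grad u x) v := by
      rw [setIntegral_eq_integral_of_forall_compl_eq_zero fun x hx => by
        rw [h0 x fun h => hx (hUD h), mul_zero]]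
      simp only [mul_comm]
    have i1 : Integrable fun x => ψ x * inner ℝ (grad u x) v := by
      have hI : IntegrableOn (fun x => inner ℝ (grad u x) v * ψ x) D := by
        have hB : MemLp ψ 2 (volume.restrict D) :=
          (h1.continuous.memLp_of_hasCompactSupport h2).restrict D
        exact ((Lp.memLp (grad u)).inner_const v).integrable_mul hB
      have := hI.integrable_of_forall_notMem_eq_zero fun x hx => by
        rw [h0 x fun h => hx (hUD h), mul_zero]
      simpa only [mul_comm] using this
    have i2 : Integrable fun x => ψ x * fderiv ℝ p x v :=
      (h1.continuous.mul hcp).integrable_of_hasCompactSupport h2.mul_right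
    have e3 := integral_mul_fderiv_eq_neg_fderiv_mul_of_integrable (μ := (volume : Measure (E d)))
      (f := p) (g := ψ) (v := v)
      ((hcp.mul h1.continuous).integrable_of_hasCompactSupport h2.mul_left)
      ((hp.continuous.mul hcd).integrable_of_hasCompactSupport
        (h2.fderiv_apply (𝕜 := ℝ) v).mul_left)
      ((hp.continuous.mul h1.continuous).integrable_of_hasCompactSupport h2.mul_left)
      (fun x _ => hp.differentiable (by simp) x) fun x _ => h1'.differentiable (by simp) x
    simp only [smul_eq_mul, inner_sub_left, mul_sub, inner_gradient]
    rw [integral_sub i1 i2, ← e2]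
    rw [e1, e3] at hw
    simp only [mul_comm (ψ _)]
    linarith
  rw [Filter.EventuallyEq, ae_restrict_iff' hU.measurableSet]
  filter_upwards [ae_all_iff.2 key] with x hx hxU
  ext i
  have := hx i hxU
  rw [EuclideanSpace.inner_single_right] at this
  simpa [sub_eq_zero] using this

/-- The Friedrichs inequality. -/
theorem norm_val_le {R : ℝ} (hd : 0 < d) (hR0 : 0 ≤ R) (hR : D ⊆ Metric.closedBall 0 R) (u : H10 D) :
    ‖val u‖ ≤ 2 * R * normX u := by
  refine H10_induction (p := fun w => ‖w.1‖ ≤ 2 * R * ‖w.2‖)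
    (isClosed_le (by fun_prop) (by fun_prop)) (fun w hw => ?_) u
  obtain ⟨φ, h1, h2, h3, h4, h5⟩ := hw
  have h1' : ContDiff ℝ 1 φ := h1.of_le (by exact_mod_cast le_top)
  have hφd : Differentiable ℝ φ := h1'.differentiable (by simp)
  set e : E d := EuclideanSpace.single ⟨0, hd⟩ (1 : ℝ) with he
  have hen : ‖e‖ = 1 := by simp [he]
  have n1 : ‖w.1‖ ^ 2 = ∫ x, φ x ^ 2 := by
    rw [norm_sq_eq_integral]
    refine (integral_congr_ae (g := fun x => φ x ^ 2) (by
      filter_upwards [h4] with x hx; simp [hx])).trans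
      (setIntegral_eq_integral_of_forall_compl_eq_zero fun x hx => by
        rw [image_eq_zero_of_notMem_tsupport fun h => hx (h3 h)]; simp)
  have n2 : ‖w.2‖ ^ 2 = ∫ x, ‖gradient φ x‖ ^ 2 := by
    rw [norm_sq_eq_integral]
    refine (integral_congr_ae (g := fun x => ‖gradient φ x‖ ^ 2) (by
      filter_upwards [h5] with x hx; simp [hx])).trans
      (setIntegral_eq_integral_of_forall_compl_eq_zero fun x hx => by
        rw [norm_gradient_eq, fderiv_of_notMem_tsupport (𝕜 := ℝ) fun h => hx (h3 h)]; simp)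
  have hcφ : Continuous fun x => fderiv ℝ φ x e :=
    (h1'.continuous_fderiv one_ne_zero).clm_apply continuous_const
  have hfd : ∀ x, fderiv ℝ (fun x => inner ℝ e x) x e = (1 : ℝ) := fun x => by
    have : HasFDerivAt (fun x : E d => (inner ℝ e x : ℝ)) (innerSL ℝ e) x :=
      (innerSL ℝ e).hasFDerivAt
    rw [this.fderiv]
    simp [hen]
  have hsq : ∀ x, fderiv ℝ (fun x => φ x ^ 2) x e = 2 * φ x * fderiv ℝ φ x e := fun x => by
    have := (hφd x).hasFDerivAt.pow 2
    rw [this.fderiv]; simp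
  have c2 : HasCompactSupport fun x => φ x ^ 2 := by
    simp only [pow_two]; exact h2.mul_left
  have i1 : Integrable fun x => φ x ^ 2 := (h1.continuous.pow 2).integrable_of_hasCompactSupport c2
  have i2 : Integrable fun x => ‖gradient φ x‖ ^ 2 := by
    have hc2 : HasCompactSupport fun x => ‖gradient φ x‖ ^ 2 := by
      refine HasCompactSupport.intro h2 fun x hx => ?_
      rw [norm_gradient_eq, fderiv_of_notMem_tsupport (𝕜 := ℝ) hx]; simp
    exact ((continuous_gradient h1').norm.pow 2).integrable_of_hasCompactSupport hc2
  have i3 : Integrable fun x => 2 * φ x * fderiv ℝ φ x e * inner ℝ e x :=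
    (((continuous_const.mul h1.continuous).mul hcφ).mul
      (by fun_prop)).integrable_of_hasCompactSupport (h2.mul_left.mul_right.mul_right)
  -- The factor `1` in `φ ^ 2 * 1` is written as the derivative of `⟨e, x⟩` in direction `e` and
  -- integrated by parts. With `|⟨e, x⟩| ≤ R` on `D`, Young's inequality leaves half of the
  -- left-hand side to be absorbed, hence the constant `2 * R`.
  have hibp := integral_mul_fderiv_eq_neg_fderiv_mul_of_integrable
    (μ := (volume : Measure (E d))) (f := fun x => φ x ^ 2) (g := fun x => inner ℝ e x) (v := e)
    (by simpa only [hsq] using i3) (by simpa only [hfd, mul_one] using i1)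
    (((h1.continuous.pow 2).mul (by fun_prop)).integrable_of_hasCompactSupport c2.mul_right)
    (fun x _ => (hφd x).pow 2) fun x _ => (innerSL ℝ e).differentiableAt
  simp only [hsq, hfd, mul_one] at hibp
  have hmain : ∫ x, φ x ^ 2 ≤ ∫ x, (φ x ^ 2 / 2 + 2 * R ^ 2 * ‖gradient φ x‖ ^ 2) := by
    rw [hibp, ← integral_neg]
    refine integral_mono i3.neg ((i1.div_const 2).add (i2.const_mul _)) fun x => ?_
    simp only
    by_cases hx : x ∈ D
    · have hxR : |inner ℝ e x| ≤ R := by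
        refine (abs_real_inner_le_norm e x).trans ?_
        rw [hen, one_mul]; simpa using hR hx
      have hg : |fderiv ℝ φ x e| ≤ ‖gradient φ x‖ := by
        rw [← inner_gradient]
        refine (abs_real_inner_le_norm _ _).trans ?_
        rw [hen, mul_one]
      have h7 : |fderiv ℝ φ x e * inner ℝ e x| ≤ R * ‖gradient φ x‖ := by
        rw [abs_mul, mul_comm R]
        exact mul_le_mul hg hxR (abs_nonneg _) (norm_nonneg _)
      have h8 := sq_le_sq' (abs_le.1 h7).1 (abs_le.1 h7).2
      nlinarith [sq_nonneg (φ x + 2 * (fderiv ℝ φ x e * inner ℝ e x))]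
    · rw [image_eq_zero_of_notMem_tsupport fun h => hx (h3 h)]
      have : 0 ≤ 2 * R ^ 2 * ‖gradient φ x‖ ^ 2 := by positivity
      simpa using this
  rw [integral_add (i1.div_const 2) (i2.const_mul _), integral_div, integral_const_mul, ← n1,
    ← n2] at hmain
  refine abs_le_of_sq_le_sq' ?_ (by positivity) |>.2
  nlinarith

theorem norm_le_normX {R : ℝ} (hd : 0 < d) (hR0 : 0 ≤ R) (hR : D ⊆ Metric.closedBall 0 R) (u : H10 D) :
    ‖u‖ ≤ max (2 * R) 1 * normX u := by
  have h0 : 0 ≤ normX u := norm_nonneg _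
  change ‖u.1‖ ≤ _
  rw [Prod.norm_def]
  refine max_le ((norm_val_le hd hR0 hR u).trans ?_) ?_
  · exact mul_le_mul_of_nonneg_right (le_max_left _ _) h0
  · exact le_mul_of_one_le_left h0 (le_max_right _ _)

/-- The function underlying an element of `H¹₀`, as a continuous linear map. -/
noncomputable def valL (D : Set (E d)) : H10 D →L[ℝ] Lp ℝ 2 (volume.restrict D) :=
  (ContinuousLinearMap.fst ℝ _ _).comp (H10 D).subtypeL

/-- The weak gradient, as a continuous linear map. -/
noncomputable def gradL (D : Set (E d)) : H10 D →L[ℝ] Lp (E d) 2 (volume.restrict D) :=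
  (ContinuousLinearMap.snd ℝ _ _).comp (H10 D).subtypeL

theorem valL_apply (u : H10 D) : valL D u = val u := rfl

theorem gradL_apply (u : H10 D) : gradL D u = grad u := rfl

end Sobolev

end SGFEM


namespace SGFEM

/-! ### Mollification and criteria for membership in H¹₀ -/

section Mollification

open scoped Topology Classical Convolution

variable {d : ℕ} {D : Set (E d)}

/-- On a finite measure space, dominated convergence upgrades bounded pointwise convergence to
convergence in `L²`. -/
theorem exists_tendsto_Lp_of_bounded {α F : Type*} [MeasurableSpace α] {μ : Measure α}
    [IsFiniteMeasure μ] [NormedAddCommGroup F] [InnerProductSpace ℝ F] (f : ℕ → Lp F 2 μ)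
    {f₀ : α → F} {B : ℝ} (hB : ∀ n, ∀ᵐ x ∂μ, ‖f n x‖ ≤ B)
    (hlim : ∀ᵐ x ∂μ, Tendsto (fun n => f n x) atTop (𝓝 (f₀ x))) :
    ∃ w : Lp F 2 μ, w =ᵐ[μ] f₀ ∧ Tendsto f atTop (𝓝 w) := by
  have hm : AEStronglyMeasurable f₀ μ :=
    aestronglyMeasurable_of_tendsto_ae atTop (fun n => (Lp.memLp (f n)).1) hlim
  have hB0 : ∀ᵐ x ∂μ, ‖f₀ x‖ ≤ B := by
    filter_upwards [hlim, ae_all_iff.2 hB] with x hx hb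
    exact le_of_tendsto' hx.norm hb
  have hmem : MemLp f₀ 2 μ := MemLp.of_bound hm B hB0
  refine ⟨hmem.toLp f₀, hmem.coeFn_toLp, ?_⟩
  rw [tendsto_iff_norm_sub_tendsto_zero]
  have h2 : Tendsto (fun n => ‖f n - hmem.toLp f₀‖ ^ 2) atTop (𝓝 0) := by
    simp only [norm_sq_eq_integral]
    have : Tendsto (fun n => ∫ x, ‖(f n - hmem.toLp f₀) x‖ ^ 2 ∂μ) atTop (𝓝 (∫ _, (0 : ℝ) ∂μ)) := by
      refine tendsto_integral_of_dominated_convergence (fun _ => (2 * B) ^ 2)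
        (fun n => (Lp.memLp _).1.norm.pow 2) (integrable_const _) (fun n => ?_) ?_
      · filter_upwards [Lp.coeFn_sub (f n) (hmem.toLp f₀), hmem.coeFn_toLp, hB n, hB0]
          with x h1 h2 h3 h4
        rw [h1, Pi.sub_apply, h2, norm_pow, norm_norm]
        have := norm_sub_le (f n x) (f₀ x)
        exact pow_le_pow_left₀ (norm_nonneg _) (by linarith) 2
      · have hs : ∀ᵐ x ∂μ, ∀ n, (f n - hmem.toLp f₀) x = f n x - hmem.toLp f₀ x :=
          ae_all_iff.2 fun n => Lp.coeFn_sub _ _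
        filter_upwards [hlim, hs, hmem.coeFn_toLp] with x h1 h2 h3
        simp only [h2, h3]
        have := ((h1.sub_const (f₀ x)).norm).pow 2
        simpa using this
    simpa using this
  have := h2.sqrt
  simpa using this

/-- `g` and its gradient form an element of `H¹₀(D)`. -/
def IsH10Fun (D : Set (E d)) (g : E d → ℝ) : Prop :=
  ∃ u : H10 D, val u =ᵐ[volume.restrict D] g ∧ grad u =ᵐ[volume.restrict D] gradient g

/-- Bounded pointwise convergence of functions and gradients gives convergence of the pairs in `L²`,
and `H10 D` is closed there. -/
theorem isH10Fun_of_tendsto [IsFiniteMeasure (volume.restrict D)] {g : ℕ → E d → ℝ}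
    {g₀ : E d → ℝ} {B : ℝ} (h : ∀ n, IsH10Fun D (g n)) (hB : ∀ n x, |g n x| ≤ B)
    (hB' : ∀ n x, ‖gradient (g n) x‖ ≤ B)
    (hlim : ∀ᵐ x, Tendsto (fun n => g n x) atTop (𝓝 (g₀ x)))
    (hlim' : ∀ᵐ x, Tendsto (fun n => gradient (g n) x) atTop (𝓝 (gradient g₀ x))) :
    IsH10Fun D g₀ := by
  choose u hu hu' using h
  obtain ⟨w, hw, hwl⟩ := exists_tendsto_Lp_of_bounded (fun n => val (u n)) (f₀ := g₀) (B := B)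
    (fun n => by filter_upwards [hu n] with x hx; rw [hx]; exact hB n x)
    (by filter_upwards [ae_all_iff.2 hu, ae_restrict_of_ae hlim] with x hx h; simpa [hx] using h)
  obtain ⟨w', hw', hwl'⟩ := exists_tendsto_Lp_of_bounded (fun n => grad (u n))
    (f₀ := gradient g₀) (B := B)
    (fun n => by filter_upwards [hu' n] with x hx; rw [hx]; exact hB' n x)
    (by filter_upwards [ae_all_iff.2 hu', ae_restrict_of_ae hlim'] with x hx h; simpa [hx] using h)
  have hmem : (w, w') ∈ H10 D :=
    (Submodule.isClosed_topologicalClosure _).mem_of_tendsto (hwl.prodMk_nhds hwl')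
      (Eventually.of_forall fun n => (u n).2)
  exact ⟨⟨(w, w'), hmem⟩, hw, hw'⟩

/-- A test function represents an element of `H¹₀`. -/
theorem isH10Fun_test {φ : E d → ℝ} (h1 : ContDiff ℝ ∞ φ) (h2 : HasCompactSupport φ)
    (h3 : tsupport φ ⊆ D) : IsH10Fun D φ := by
  have h1' : ContDiff ℝ 1 φ := h1.of_le (by exact_mod_cast le_top)
  have hA : MemLp φ 2 (volume.restrict D) :=
    (h1.continuous.memLp_of_hasCompactSupport h2).restrict D
  have hc : HasCompactSupport (gradient φ) := by
    refine HasCompactSupport.intro h2 fun x hx => ?_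
    rw [← norm_eq_zero, norm_gradient_eq, fderiv_of_notMem_tsupport (𝕜 := ℝ) hx]; simp
  have hB : MemLp (gradient φ) 2 (volume.restrict D) :=
    ((continuous_gradient h1').memLp_of_hasCompactSupport hc).restrict D
  exact ⟨⟨(hA.toLp _, hB.toLp _), test_mem_H10 ⟨φ, h1, h2, h3, hA.coeFn_toLp, hB.coeFn_toLp⟩⟩,
    hA.coeFn_toLp, hB.coeFn_toLp⟩

theorem gradient_eq_of_eventuallyEq {g g' : E d → ℝ} {x : E d} (h : g =ᶠ[𝓝 x] g') :
    gradient g x = gradient g' x := by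
  simp only [gradient, h.fderiv_eq]

theorem gradient_inner_add (w : E d) (b : ℝ) (x : E d) :
    gradient (fun y => inner ℝ w y + b) x = w := by
  have h : HasFDerivAt (fun y : E d => (inner ℝ w y : ℝ) + b) (innerSL ℝ w) x :=
    (innerSL ℝ w).hasFDerivAt.add_const b
  refine ext_inner_right ℝ fun v => ?_
  rw [inner_gradient, h.fderiv]; rfl

theorem norm_gradient_le_of_lipschitz {g : E d → ℝ} {L : ℝ≥0} (h : LipschitzWith L g) (x : E d) :
    ‖gradient g x‖ ≤ L := by
  rw [norm_gradient_eq]; exact norm_fderiv_le_of_lipschitz ℝ h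

/-- The convolution with a normalized bump function. -/
noncomputable def mollify (φ : ContDiffBump (0 : E d)) (g : E d → ℝ) : E d → ℝ :=
  φ.normed volume ⋆[ContinuousLinearMap.lsmul ℝ ℝ, volume] g

theorem mollify_apply (φ : ContDiffBump (0 : E d)) (g : E d → ℝ) (x : E d) :
    mollify φ g x = ∫ t, φ.normed volume t * g (x - t) := rfl

theorem mollify_integrable (φ : ContDiffBump (0 : E d)) {g : E d → ℝ} (hg : Continuous g)
    (x : E d) : Integrable fun t => φ.normed volume t * g (x - t) :=
  (φ.continuous_normed.mul (by fun_prop)).integrable_of_hasCompactSupport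
    φ.hasCompactSupport_normed.mul_right

theorem mollify_lipschitz (φ : ContDiffBump (0 : E d)) {g : E d → ℝ} {L : ℝ≥0}
    (hg : LipschitzWith L g) : LipschitzWith L (mollify φ g) := by
  refine LipschitzWith.of_dist_le_mul fun x y => ?_
  rw [Real.dist_eq, mollify_apply, mollify_apply,
    ← integral_sub (mollify_integrable φ hg.continuous x) (mollify_integrable φ hg.continuous y), ← Real.norm_eq_abs]
  refine (norm_integral_le_of_norm_le (g := fun t => φ.normed volume t * (L * dist x y))
    (φ.integrable_normed.mul_const _) (Eventually.of_forall fun t => ?_)).trans_eq ?_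
  · rw [← mul_sub, norm_mul, Real.norm_of_nonneg (φ.nonneg_normed t)]
    refine mul_le_mul_of_nonneg_left ?_ (φ.nonneg_normed t)
    have := hg.dist_le_mul (x - t) (y - t)
    simpa [dist_sub_right, Real.dist_eq] using this
  · rw [integral_mul_const, φ.integral_normed, one_mul]

theorem abs_mollify_le (φ : ContDiffBump (0 : E d)) {g : E d → ℝ} {B : ℝ}
    (hB : ∀ x, |g x| ≤ B) (x : E d) : |mollify φ g x| ≤ B := by
  rw [mollify_apply, ← Real.norm_eq_abs]
  refine (norm_integral_le_of_norm_le (g := fun t => φ.normed volume t * B)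
    (φ.integrable_normed.mul_const _) (Eventually.of_forall fun t => ?_)).trans_eq ?_
  · rw [norm_mul, Real.norm_of_nonneg (φ.nonneg_normed t)]
    exact mul_le_mul_of_nonneg_left (hB _) (φ.nonneg_normed t)
  · rw [integral_mul_const, φ.integral_normed, one_mul]

/-- Symmetric mollification reproduces affine functions. -/
theorem mollify_affine (φ : ContDiffBump (0 : E d)) {g : E d → ℝ} {w : E d} {b : ℝ} {x : E d}
    (h : ∀ y ∈ Metric.ball x φ.rOut, g y = inner ℝ w y + b) :
    mollify φ g x = inner ℝ w x + b := by
  -- The bump is even, so its first moment vanishes.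
  have hI : ∫ t, φ.normed volume t * inner ℝ w t = 0 := by
    have h1 : ∫ t, φ.normed volume t * inner ℝ w t = ∫ t, φ.normed volume (-t) * inner ℝ w (-t) :=
      (integral_neg_eq_self (fun t => φ.normed volume t * inner ℝ w t) volume).symm
    simp only [φ.normed_neg, inner_neg_right, mul_neg, integral_neg] at h1
    linarith
  have hi : Integrable fun t => φ.normed volume t * inner ℝ w t :=
    (φ.continuous_normed.mul (by fun_prop)).integrable_of_hasCompactSupport
      φ.hasCompactSupport_normed.mul_right
  have : ∀ t, φ.normed volume t * g (x - t) =
      φ.normed volume t * (inner ℝ w x + b) - φ.normed volume t * inner ℝ w t := fun t => by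
    by_cases ht : t ∈ Metric.ball (0 : E d) φ.rOut
    · rw [h (x - t) (by simpa using ht), inner_sub_right]; ring
    · rw [← φ.support_normed_eq (μ := volume), Function.notMem_support] at ht
      rw [ht]; simp
  rw [mollify_apply]
  simp only [this]
  rw [integral_sub (φ.integrable_normed.mul_const _) hi, hI, integral_mul_const, φ.integral_normed]
  ring

theorem mollify_contDiff (φ : ContDiffBump (0 : E d)) {g : E d → ℝ} (hg : Continuous g) :
    ContDiff ℝ ∞ (mollify φ g) :=
  φ.hasCompactSupport_normed.contDiff_convolution_left _ φ.contDiff_normed hg.locallyIntegrable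

theorem tsupport_mollify_subset (φ : ContDiffBump (0 : E d)) {g : E d → ℝ} :
    tsupport (mollify φ g) ⊆ Metric.cthickening φ.rOut (tsupport g) := by
  refine closure_minimal (fun x hx => ?_) Metric.isClosed_cthickening
  obtain ⟨y, hy, t, ht, rfl⟩ := support_convolution_subset _ hx
  rw [φ.support_normed_eq, mem_ball_zero_iff] at hy
  exact Metric.mem_cthickening_of_dist_le _ t _ _ (subset_tsupport _ ht) (by simpa using hy.le)

/-- Lipschitz functions with compact support that are locally affine almost everywhere belong to
`H¹₀`. -/
theorem isH10Fun_of_lipschitz [IsFiniteMeasure (volume.restrict D)] (hD : IsOpen D) {g : E d → ℝ}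
    {L : ℝ≥0} (hL : LipschitzWith L g) (hc : HasCompactSupport g) (hs : tsupport g ⊆ D) {B : ℝ}
    (hB : ∀ x, |g x| ≤ B)
    (haff : ∀ᵐ x, ∃ (w : E d) (b : ℝ), g =ᶠ[𝓝 x] fun y => inner ℝ w y + b) : IsH10Fun D g := by
  obtain ⟨δ, hδ, hδD⟩ := hc.isCompact.exists_cthickening_subset_open hD hs
  let φ : ℕ → ContDiffBump (0 : E d) := fun n =>
    ⟨δ / (n + 1) / 2, δ / (n + 1), by positivity, half_lt_self (by positivity)⟩
  have hr : ∀ n, (φ n).rOut = δ / (n + 1) := fun n => rfl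
  have hr0 : Tendsto (fun n => (φ n).rOut) atTop (𝓝 0) := by
    simp only [hr]
    have := (tendsto_one_div_add_atTop_nhds_zero_nat (𝕜 := ℝ)).const_mul δ
    simpa [div_eq_mul_inv] using this
  refine isH10Fun_of_tendsto (g := fun n => mollify (φ n) g) (B := max B L) (fun n => ?_)
    (fun n x => (abs_mollify_le _ hB x).trans (le_max_left _ _))
    (fun n x => (norm_gradient_le_of_lipschitz (mollify_lipschitz _ hL) x).trans (le_max_right _ _))
    (Eventually.of_forall fun x =>
      ContDiffBump.convolution_tendsto_right_of_continuous hr0 hL.continuous x) ?_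
  · have h1 : tsupport (mollify (φ n) g) ⊆ Metric.cthickening δ (tsupport g) := by
      refine (tsupport_mollify_subset _).trans (Metric.cthickening_mono ?_ _)
      rw [hr]
      exact div_le_self hδ.le (by linarith [n.cast_nonneg (α := ℝ)])
    refine isH10Fun_test (mollify_contDiff _ hL.continuous) ?_ (h1.trans hδD)
    exact HasCompactSupport.of_support_subset_isCompact hc.isCompact.cthickening
      ((subset_tsupport _).trans h1)
  · filter_upwards [haff] with x ⟨w, b, hx⟩
    obtain ⟨r, hr1, hr2⟩ := Metric.eventually_nhds_iff_ball.1 hx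
    -- Near a point where `g` is affine, mollification at small scale reproduces `g`, so the
    -- gradients at the point are eventually constant.
    refine tendsto_const_nhds.congr' ?_
    filter_upwards [hr0.eventually (gt_mem_nhds (half_pos hr1))] with n hn
    rw [gradient_eq_of_eventuallyEq hx, gradient_eq_of_eventuallyEq (g := mollify (φ n) g)
      (g' := fun y => inner ℝ w y + b) ?_]
    filter_upwards [Metric.ball_mem_nhds x (half_pos hr1)] with y hy
    refine mollify_affine _ fun y' hy' => hr2 y' ?_
    rw [Metric.mem_ball] at *
    linarith [dist_triangle y' y x]

/-- The positive part of a piecewise affine function with positivity set in `D`. -/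
theorem isH10Fun_posPart [IsFiniteMeasure (volume.restrict D)] (hD : IsOpen D)
    (hbd : Bornology.IsBounded D) {c : E d → ℝ} {L : ℝ≥0} (hL : LipschitzWith L c)
    (h1 : ∀ x, c x ≤ 1) (hs : ∀ x, 0 < c x → x ∈ D)
    (haff : ∀ s : ℝ, ∀ᵐ x, ∃ (w : E d) (b : ℝ), c =ᶠ[𝓝 x] (fun y => inner ℝ w y + b) ∧
      (s < c x ∨ ∀ᶠ y in 𝓝 x, c y ≤ s)) : IsH10Fun D fun x => max 0 (c x) := by
  have hcc := hL.continuous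
  -- The support of `max 0 c = g 1` may touch the boundary of `D`. For `t > 1`, however, `g t` is
  -- positive only where `c > 1 - 1 / t > 0`, so its support is a compact subset of `D`; then `t`
  -- decreases to `1`.
  set g : ℝ → E d → ℝ := fun t x => max 0 (1 + t * (c x - 1)) with hg
  have hgL : ∀ t : ℝ, 0 ≤ t → t ≤ 2 → LipschitzWith (2 * L) (g t) := fun t ht ht2 => by
    refine LipschitzWith.of_dist_le_mul fun x y => ?_
    have := hL.dist_le_mul x y
    rw [Real.dist_eq] at *
    have h2 : |g t x - g t y| ≤ |(1 + t * (c x - 1)) - (1 + t * (c y - 1))| := by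
      simp only [hg]
      have := abs_max_sub_max_le_abs (1 + t * (c x - 1)) (1 + t * (c y - 1)) 0
      simpa [max_comm] using this
    refine h2.trans ?_
    have h3 : (1 + t * (c x - 1)) - (1 + t * (c y - 1)) = t * (c x - c y) := by ring
    rw [h3, abs_mul, abs_of_nonneg ht]
    push_cast
    rw [mul_assoc]
    exact mul_le_mul ht2 this (abs_nonneg _) (by norm_num)
  have hg1 : ∀ t : ℝ, 0 ≤ t → ∀ x, |g t x| ≤ 1 := fun t ht x => by
    rw [abs_of_nonneg (le_max_left _ _)]
    refine max_le zero_le_one ?_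
    nlinarith [h1 x]
  have hloc : ∀ t : ℝ, 0 < t → ∀ x w b, c =ᶠ[𝓝 x] (fun y => inner ℝ w y + b) → 1 - 1 / t < c x →
      g t =ᶠ[𝓝 x] fun y => inner ℝ (t • w) y + (1 + t * (b - 1)) := fun t ht x w b hx hpos => by
    filter_upwards [hx, hcc.continuousAt.eventually (lt_mem_nhds hpos)] with y hy hy2
    have : 0 ≤ 1 + t * (c y - 1) := by
      have := mul_le_mul_of_nonneg_left hy2.le ht.le
      rw [mul_sub, mul_one_div_cancel ht.ne'] at this
      linarith
    simp only [hg, max_eq_right this]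
    rw [hy, inner_smul_left]
    simp; ring
  have hloc0 : ∀ t : ℝ, 0 < t → ∀ x, (∀ᶠ y in 𝓝 x, c y ≤ 1 - 1 / t) →
      g t =ᶠ[𝓝 x] fun y => inner ℝ 0 y + 0 := fun t ht x hx => by
    filter_upwards [hx] with y hy
    have : 1 + t * (c y - 1) ≤ 0 := by
      have := mul_le_mul_of_nonneg_left hy ht.le
      rw [mul_sub, mul_one_div_cancel ht.ne'] at this
      linarith
    simp only [hg, max_eq_left this]
    simp
  have hone : (fun x => max 0 (c x)) = g 1 := by ext x; simp [hg]
  set t : ℕ → ℝ := fun n => 1 + 1 / ((n : ℝ) + 1) with htdef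
  have ht1 : ∀ n, 1 < t n := fun n => by
    have : (0 : ℝ) < 1 / ((n : ℝ) + 1) := by positivity
    simp only [htdef]; linarith
  have ht2 : ∀ n, t n ≤ 2 := fun n => by
    have : 1 / ((n : ℝ) + 1) ≤ 1 := by
      rw [div_le_one (by positivity)]; linarith [n.cast_nonneg (α := ℝ)]
    simp only [htdef]; linarith
  have htl : Tendsto t atTop (𝓝 1) := by
    have := (tendsto_one_div_add_atTop_nhds_zero_nat (𝕜 := ℝ)).const_add 1
    simpa [htdef] using this
  have hgt : ∀ n, IsH10Fun D (g (t n)) := fun n => by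
    have htn : 0 < t n := by linarith [ht1 n]
    have hlt : 0 < 1 - 1 / t n := by
      rw [sub_pos, div_lt_one htn]; exact ht1 n
    have hsub : tsupport (g (t n)) ⊆ {x | 1 - 1 / t n ≤ c x} := by
      refine closure_minimal (fun x hx => ?_) (isClosed_le continuous_const hcc)
      by_contra hlt'
      refine hx (max_eq_left ?_)
      have := mul_le_mul_of_nonneg_left (not_le.1 hlt').le htn.le
      rw [mul_sub, mul_one_div_cancel htn.ne'] at this
      linarith
    have hsubD : tsupport (g (t n)) ⊆ D := fun x hx => hs x (hlt.trans_le (hsub hx))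
    refine isH10Fun_of_lipschitz hD (hgL (t n) htn.le (ht2 n))
      (Metric.isCompact_of_isClosed_isBounded (isClosed_tsupport _) (hbd.subset hsubD)) hsubD
      (hg1 _ htn.le) ?_
    filter_upwards [haff (1 - 1 / t n)] with x ⟨w, b, hx, hx2⟩
    rcases hx2 with hx2 | hx2
    · exact ⟨_, _, hloc (t n) htn x w b hx hx2⟩
    · exact ⟨_, _, hloc0 (t n) htn x hx2⟩
  rw [hone]
  refine isH10Fun_of_tendsto (g := fun n => g (t n)) (B := max 1 (2 * L)) hgt
    (fun n x => (hg1 _ (by linarith [ht1 n]) x).trans (le_max_left _ _))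
    (fun n x => (norm_gradient_le_of_lipschitz (hgL (t n) (by linarith [ht1 n]) (ht2 n)) x).trans
      (by push_cast; exact le_max_right _ _))
    (Eventually.of_forall fun x => ?_) ?_
  · have : Continuous fun s : ℝ => g s x := by simp only [hg]; fun_prop
    exact (this.tendsto 1).comp htl
  · filter_upwards [haff 0] with x ⟨w, b, hx, hx2⟩
    rcases hx2 with hx2 | hx2
    · rw [gradient_eq_of_eventuallyEq (hloc 1 one_pos x w b hx (by simpa using hx2)),
        gradient_inner_add]
      have hev : ∀ᶠ n in atTop, gradient (g (t n)) x = t n • w := by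
        have : Tendsto (fun n => 1 - 1 / t n) atTop (𝓝 (1 - 1 / 1)) :=
          tendsto_const_nhds.sub (tendsto_const_nhds.div htl one_ne_zero)
        filter_upwards [this.eventually (gt_mem_nhds (show 1 - 1 / 1 < c x by simpa using hx2))]
          with n hn
        rw [gradient_eq_of_eventuallyEq (hloc (t n) (by linarith [ht1 n]) x w b hx hn),
          gradient_inner_add]
      exact (htl.smul_const w).congr' (hev.mono fun n hn => hn.symm)
    · rw [gradient_eq_of_eventuallyEq (hloc0 1 one_pos x (by simpa using hx2)), gradient_inner_add]
      refine tendsto_const_nhds.congr fun n => ?_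
      have htn : 0 < t n := by linarith [ht1 n]
      rw [gradient_eq_of_eventuallyEq (hloc0 (t n) htn x ?_), gradient_inner_add]
      have hlt : 0 < 1 - 1 / t n := by
        rw [sub_pos, div_lt_one htn]; exact ht1 n
      exact hx2.mono fun y hy => hy.trans hlt.le

end Mollification

end SGFEM


namespace SGFEM

/-! ### Existence of the nodal basis functions -/

section Hat

open scoped Topology Classical

variable {d : ℕ} {M : Mesh d} {T : Finset (E d)} {z : E d}

theorem mem_interiorVertices : z ∈ M.interiorVertices ↔ (∃ s ∈ M.faces, z ∈ s) ∧ z ∈ M.domain := by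
  simp [Mesh.interiorVertices]

theorem star_nonempty (hz : z ∈ M.interiorVertices) : (star M z).Nonempty := by
  obtain ⟨⟨s, hs, hzs⟩, -⟩ := mem_interiorVertices.1 hz
  obtain ⟨t, ht, hst, hc⟩ := M.pure s hs
  exact ⟨t, mem_star.2 ⟨mem_elements.2 ⟨ht, hc⟩, hst hzs⟩⟩

theorem star_cover (hd : 1 ≤ d) (hz : z ∈ M.interiorVertices) (x : E d) :
    ∃ T ∈ star M z, x ∈ vertexCone T z := by
  refine exists_mem_vertexCone hd subset_rfl (star_nonempty hz) (fun T hT w hw hwz => ?_) x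
  obtain ⟨hTe, hzT⟩ := mem_star.1 hT
  have hnb := not_isBoundaryFacet hd hTe hw hzT hwz.symm (mem_interiorVertices.1 hz).2
  rw [IsBoundaryFacet] at hnb
  push Not at hnb
  obtain ⟨T', hT', hF, hne⟩ := hnb
  exact ⟨T', mem_star.2 ⟨hT', hF (Finset.mem_erase.2 ⟨hwz.symm, hzT⟩)⟩, hne, hF⟩

/-- The cones at an interior vertex cover the space and their coordinates agree on overlaps, so they
glue to a global piecewise affine function. Its positive part will be the nodal function. -/
theorem exists_coneFun (hd : 1 ≤ d) (hz : z ∈ M.interiorVertices) :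
    ∃ c : E d → ℝ, ∀ T ∈ star M z, EqOn c (bary T z) (vertexCone T z) := by
  choose S hS hSc using star_cover hd hz
  exact ⟨fun x => bary (S x) z x, fun T hT x hx => bary_eq_bary_of_cone (hS x) hT (hSc x) hx z⟩

theorem vertexCone_convex (T : Finset (E d)) (z : E d) : Convex ℝ (vertexCone T z) := by
  have : vertexCone T z = ⋂ w ∈ T, ⋂ (_ : w ≠ z), bary T w ⁻¹' Ici 0 := by
    ext; simp [vertexCone]
  rw [this]
  exact convex_iInter₂ fun w _ => convex_iInter fun _ => (convex_Ici 0).affine_preimage _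

theorem coneFun_continuous (hd : 1 ≤ d) (hz : z ∈ M.interiorVertices) {c : E d → ℝ}
    (hc : ∀ T ∈ star M z, EqOn c (bary T z) (vertexCone T z)) : Continuous c := by
  refine (locallyFinite_of_finite fun T : {T // T ∈ star M z} => vertexCone T.1 z).continuous
    (eq_univ_of_forall fun x => ?_) (fun T => vertexCone_isClosed _ _) fun T =>
      ((affine_continuous _).continuousOn).congr (hc T.1 T.2)
  obtain ⟨T, hT, hx⟩ := star_cover hd hz x
  exact mem_iUnion.2 ⟨⟨T, hT⟩, hx⟩

/-- Along a segment, to the right of each parameter, some single cone is met arbitrarily close to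
it. There the function is affine, which bounds its slopes; a bound on the lower right slopes of a
continuous function integrates to a global bound. -/
theorem coneFun_lipschitz (hd : 1 ≤ d) (hz : z ∈ M.interiorVertices) {c : E d → ℝ}
    (hc : ∀ T ∈ star M z, EqOn c (bary T z) (vertexCone T z)) :
    LipschitzWith (∑ T ∈ star M z, ‖affGrad (bary T z)‖₊) c := by
  refine LipschitzWith.of_le_add_mul _ fun y x => ?_
  set L : ℝ := ((∑ T ∈ star M z, ‖affGrad (bary T z)‖₊ : ℝ≥0) : ℝ) with hL
  have hLT : ∀ T ∈ star M z, ‖affGrad (bary T z)‖ ≤ L := fun T hT => by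
    rw [hL, NNReal.coe_sum]
    exact Finset.single_le_sum (f := fun T => ((‖affGrad (bary T z)‖₊ : ℝ≥0) : ℝ))
      (fun _ _ => NNReal.coe_nonneg _) hT
  have hseg : Continuous fun s : ℝ => x + s • (y - x) := by fun_prop
  have key := image_le_of_liminf_slope_right_le_deriv_boundary (a := 0) (b := 1)
    (f := fun s : ℝ => c (x + s • (y - x))) (B := fun s : ℝ => c x + L * dist y x * s)
    (B' := fun _ => L * dist y x)
    ((coneFun_continuous hd hz hc).comp hseg).continuousOn (by simp) (by fun_prop)
    (fun s _ => by
      simpa using (((hasDerivAt_id s).const_mul (L * dist y x)).const_add (c x)).hasDerivWithinAt)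
    fun s _ r hr => ?_
  · have := key (right_mem_Icc.2 zero_le_one)
    simpa using this
  · have hfr : ∃ᶠ s' in 𝓝[>] s, ∃ T ∈ star M z, x + s' • (y - x) ∈ vertexCone T z :=
      (Eventually.of_forall fun s' => star_cover hd hz _).frequently
    obtain ⟨T, hT, hfT⟩ := exists_frequently_finset hfr
    have hs : x + s • (y - x) ∈ vertexCone T z :=
      (vertexCone_isClosed T z).mem_of_frequently_of_tendsto hfT
        ((hseg.tendsto s).mono_left nhdsWithin_le_nhds)
    refine (hfT.and_eventually self_mem_nhdsWithin).mono fun s' ⟨h1, h2⟩ => ?_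
    have h3 : 0 < s' - s := sub_pos.2 h2
    rw [slope_def_field, hc T hT h1, hc T hT hs, affine_sub,
      show x + s' • (y - x) - (x + s • (y - x)) = (s' - s) • (y - x) by module,
      inner_smul_right, mul_div_assoc, mul_div_cancel₀ _ h3.ne']
    refine lt_of_le_of_lt ?_ hr
    refine (real_inner_le_norm _ _).trans ?_
    rw [← dist_eq_norm]
    exact mul_le_mul_of_nonneg_right (hLT T hT) dist_nonneg

/-- Needed because `hat` is a choice, meaningful only if a candidate exists. A point where the cone
function is positive lies in an element with vertex `z`, so this open set is contained in the domain
and the criterion `isH10Fun_posPart` applies. -/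
theorem exists_isHat (hd : 1 ≤ d) (hz : z ∈ M.interiorVertices) : ∃ u, M.IsHat z u := by
  obtain ⟨c, hc⟩ := exists_coneFun hd hz
  have hcc := coneFun_continuous hd hz hc
  have hpos : ∀ x, 0 < c x → ∃ T ∈ star M z, x ∈ convexHull ℝ (T : Set (E d)) ∧
      c x = bary T z x := fun x hx => by
    obtain ⟨T, hT, hxT⟩ := star_cover hd hz x
    refine ⟨T, hT, (isSimplex_of_mem (mem_star.1 hT).1).mem_convexHull.2 fun w hw => ?_, hc T hT hxT⟩
    by_cases hwz : w = z
    · rw [hwz, ← hc T hT hxT]; exact hx.le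
    · exact hxT w hw hwz
  have hsub : {x | 0 < c x} ⊆ M.domain := by
    refine interior_maximal (fun x hx => ?_) (isOpen_lt continuous_const hcc)
    obtain ⟨T, hT, hxT, -⟩ := hpos x hx
    exact mem_space_iff_elements.2 ⟨T, (mem_star.1 hT).1, hxT⟩
  have h1 : ∀ x, c x ≤ 1 := fun x => by
    rcases le_or_gt (c x) 0 with h | h
    · linarith
    · obtain ⟨T, hT, hxT, he⟩ := hpos x h
      rw [he]; exact (isSimplex_of_mem (mem_star.1 hT).1).bary_le_one z hxT
  have haff : ∀ s : ℝ, ∀ᵐ x, ∃ (w : E d) (b : ℝ), c =ᶠ[𝓝 x] (fun y => inner ℝ w y + b) ∧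
      (s < c x ∨ ∀ᶠ y in 𝓝 x, c y ≤ s) := fun s => by
    -- Off the frontiers of finitely many convex sets, which are null, the function is locally
    -- affine and locally decides its position relative to the level `s`.
    have hae : ∀ᵐ x : E d, ∀ T ∈ star M z, x ∉ frontier (vertexCone T z) ∧
        x ∉ frontier (bary T z ⁻¹' Iic s) :=
      (eventually_all_finset _).2 fun T _ =>
        (measure_eq_zero_iff_ae_notMem.1 ((vertexCone_convex T z).addHaar_frontier volume)).and
        (measure_eq_zero_iff_ae_notMem.1
          (((convex_Iic s).affine_preimage (bary T z)).addHaar_frontier volume))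
    filter_upwards [hae] with x hx
    obtain ⟨T, hT, hxT⟩ := star_cover hd hz x
    have hint : x ∈ interior (vertexCone T z) := by
      have := (hx T hT).1
      rw [(vertexCone_isClosed T z).frontier_eq] at this
      by_contra h
      exact this ⟨hxT, h⟩
    have hloc : c =ᶠ[𝓝 x] bary T z := by
      filter_upwards [isOpen_interior.mem_nhds hint] with y hy
      exact hc T hT (interior_subset hy)
    refine ⟨affGrad (bary T z), bary T z 0, hloc.trans (Eventually.of_forall fun y => ?_), ?_⟩
    · have := affine_sub (bary T z) y 0
      simp only [sub_zero] at this
      simp only [← this]; ring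
    · rcases lt_or_ge s (c x) with h | h
      · exact Or.inl h
      right
      have hcl : IsClosed (bary T z ⁻¹' Iic s) := isClosed_Iic.preimage (affine_continuous _)
      have hxs : x ∈ interior (bary T z ⁻¹' Iic s) := by
        have := (hx T hT).2
        rw [hcl.frontier_eq] at this
        by_contra h'
        refine this ⟨?_, h'⟩
        rw [hc T hT hxT] at h
        exact h
      filter_upwards [hloc, isOpen_interior.mem_nhds hxs] with y h1 h2
      have h3 : y ∈ bary T z ⁻¹' Iic s := interior_subset h2
      rw [h1]; exact h3
  obtain ⟨u, hu, -⟩ := isH10Fun_posPart (domain_isOpen M) (domain_isBounded M)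
    (coneFun_lipschitz hd hz hc) h1 hsub haff
  refine ⟨u, fun T hT => ⟨bary T z, fun z' hz' => ⟨fun h => ?_, fun h => ?_⟩, ?_⟩⟩
  · rw [← h]; exact (isSimplex_of_mem hT).bary_self hz'
  · exact (isSimplex_of_mem hT).bary_of_ne hz' h
  · filter_upwards [ae_restrict_of_ae_restrict_of_subset (openSimplex_subset_domain hT) hu,
      ae_restrict_mem (openSimplex_isOpen T).measurableSet] with x hx hxT
    rw [hx]
    have hxh := openSimplex_subset T hxT
    by_cases hzT : z ∈ T
    · rw [hc T (mem_star.2 ⟨hT, hzT⟩) ((isSimplex_of_mem hT).convexHull_subset_vertexCone z hxh)]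
      exact max_eq_right ((isSimplex_of_mem hT).mem_convexHull.1 hxh z hzT)
    · rw [bary_of_notMem hzT]
      refine max_eq_left (not_lt.1 fun h0 => ?_)
      obtain ⟨S, hS, hxS, he⟩ := hpos x h0
      rw [he, bary_eq_bary (mem_star.1 hS).1 hT hxS hxh z, bary_of_notMem hzT] at h0
      simp at h0

/-- An affine function is determined by its values at the vertices, so every choice of `hat` has
this restriction to `T`. -/
theorem hat_ae_eq (hd : 1 ≤ d) (hz : z ∈ M.interiorVertices) (hT : T ∈ M.elements) :
    val (M.hat z) =ᵐ[volume.restrict (Mesh.openSimplex T)] bary T z := by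
  have hh : M.IsHat z (M.hat z) := Classical.epsilon_spec (exists_isHat hd hz)
  obtain ⟨l, hl, hv⟩ := hh T hT
  have : l = bary T z := by
    refine (isSimplex_of_mem hT).affine_ext fun w hw => ?_
    by_cases h : w = z
    · rw [(hl w hw).1 h, ← h, (isSimplex_of_mem hT).bary_self hw]
    · rw [(hl w hw).2 h, (isSimplex_of_mem hT).bary_of_ne hw h]
  rwa [this] at hv

end Hat

end SGFEM


namespace SGFEM

/-! ### The residual estimate on H¹₀ -/

section WeakBound

open scoped Topology Classical

variable {d : ℕ} {M : Mesh d} {T : Finset (E d)} {z : E d} {K : ℝ}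

/-- Since `H10 D` is closed in the ambient space, a relatively closed property is closed there, and
the induction over test pairs applies. -/
theorem H10_closed_induction {D : Set (E d)} {p : H10 D → Prop} (hp : IsClosed {u | p u})
    (ht : ∀ u : H10 D, u.1 ∈ testPairs D → p u) (u : H10 D) : p u := by
  have hcl : IsClosed (H10 D : Set (L2Pair D)) := Submodule.isClosed_topologicalClosure _
  have h := hcl.isClosedEmbedding_subtypeVal.isClosedMap _ hp
  obtain ⟨u', hu', he⟩ := H10_induction (p := fun w => w ∈ (Subtype.val '' {u : H10 D | p u})) h
    (fun w hw => ⟨⟨w, test_mem_H10 hw⟩, ht _ hw, rfl⟩) u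
  rwa [← Subtype.ext he]

theorem patch_isOpen (M : Mesh d) (z : E d) : IsOpen (M.patch z) := by
  rw [patch_eq]; exact isOpen_biUnion fun T _ => openSimplex_isOpen T

theorem patch_subset (M : Mesh d) (z : E d) : M.patch z ⊆ M.domain := by
  rw [patch_eq]; exact iUnion₂_subset fun T hT => openSimplex_subset_domain (mem_star.1 hT).1

theorem restrict_patch (M : Mesh d) (z : E d) :
    (volume.restrict M.domain).restrict (M.patch z) = volume.restrict (M.patch z) := by
  rw [Measure.restrict_restrict (patch_isOpen M z).measurableSet,
    inter_eq_left.2 (patch_subset M z)]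

/-- The patch average as a continuous linear functional. -/
noncomputable def patchMean (M : Mesh d) (z : E d) : H10 M.domain →L[ℝ] ℝ :=
  (volume.real (M.patch z))⁻¹ • (innerSL ℝ (indicatorConstLp 2 (patch_isOpen M z).measurableSet
    (measure_ne_top (volume.restrict M.domain) _) (1 : ℝ))).comp (valL M.domain)

theorem patchMean_apply (z : E d) (u : H10 M.domain) :
    patchMean M z u = ⨍ x in M.patch z, val u x := by
  rw [setAverage_eq, ← restrict_patch, patchMean]
  change (volume.real (M.patch z))⁻¹ • (inner ℝ _ (val u) : ℝ) = _
  rw [L2.inner_indicatorConstLp_one]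

/-- The Clément interpolant as a continuous linear map. -/
noncomputable def clementL (M : Mesh d) : H10 M.domain →L[ℝ] H10 M.domain :=
  ∑ z ∈ M.interiorVertices, (patchMean M z).smulRight (M.hat z)

theorem clementL_apply (u : H10 M.domain) : clementL M u = M.clement u := by
  simp only [clementL, Mesh.clement, _root_.sum_apply,
    ContinuousLinearMap.smulRight_apply, patchMean_apply]

/-- On `T` only the nodal functions of vertices of `T` are nonzero. The interpolant sums over
interior vertices and `localError` over all vertices of `T`; both reduce to the interior vertices of
`T`, as `nodeVal` is zero outside the domain. -/
theorem val_sub_clement (hd : 1 ≤ d) {φ : E d → ℝ} (u : H10 M.domain)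
    (hu : val u =ᵐ[volume.restrict M.domain] φ) (hT : T ∈ M.elements) :
    val (u - clementL M u) =ᵐ[volume.restrict (Mesh.openSimplex T)] localError M φ T := by
  have hs := openSimplex_subset_domain hT
  have h1 : ∀ z, patchMean M z u = ⨍ x in M.patch z, φ x := fun z => by
    rw [patchMean_apply]
    exact average_congr (ae_restrict_of_ae_restrict_of_subset (patch_subset M z) hu)
  have h2 : val (u - clementL M u) =
      val u - ∑ z ∈ M.interiorVertices, (⨍ x in M.patch z, φ x) • val (M.hat z) := by
    simp only [← valL_apply, map_sub, clementL, _root_.sum_apply, map_sum,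
      ContinuousLinearMap.smulRight_apply, map_smul, h1]
  have h3 : ((∑ z ∈ M.interiorVertices, (⨍ x in M.patch z, φ x) • val (M.hat z) :
      Lp ℝ 2 (volume.restrict M.domain)) : E d → ℝ) =ᵐ[volume.restrict M.domain]
      fun x => ∑ z ∈ M.interiorVertices, (⨍ x in M.patch z, φ x) * val (M.hat z) x := by
    have ha : ∀ᵐ x ∂volume.restrict M.domain, ∀ z ∈ M.interiorVertices,
        ((⨍ x in M.patch z, φ x) • val (M.hat z) : Lp ℝ 2 (volume.restrict M.domain)) x =
          (⨍ x in M.patch z, φ x) * val (M.hat z) x :=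
      (eventually_all_finset _).2 fun z _ => Lp.coeFn_smul _ _
    filter_upwards [Lp.coeFn_finsetSum M.interiorVertices
      (fun z => (⨍ x in M.patch z, φ x) • val (M.hat z)), ha] with x hx hx2
    rw [hx, Finset.sum_apply]
    exact Finset.sum_congr rfl hx2
  have h4 : ∀ᵐ x ∂volume.restrict (Mesh.openSimplex T), ∀ z ∈ M.interiorVertices,
      val (M.hat z) x = bary T z x :=
    (eventually_all_finset _).2 fun z hz => hat_ae_eq hd hz hT
  rw [h2]
  filter_upwards [ae_restrict_of_ae_restrict_of_subset hs (Lp.coeFn_sub (val u)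
      (∑ z ∈ M.interiorVertices, (⨍ x in M.patch z, φ x) • val (M.hat z))),
    ae_restrict_of_ae_restrict_of_subset hs hu, ae_restrict_of_ae_restrict_of_subset hs h3, h4]
    with x e1 e2 e3 e4
  rw [e1, Pi.sub_apply, e2, e3, localError]
  congr 1
  have h5 : ∀ z ∈ M.interiorVertices, (⨍ x in M.patch z, φ x) * val (M.hat z) x =
      nodeVal M φ z * bary T z x := fun z hz => by
    rw [e4 z hz, nodeVal, if_pos (mem_interiorVertices.1 hz).2]
  rw [Finset.sum_congr rfl h5]
  have h6 : ∀ z, z ∉ M.interiorVertices ∩ T → (z ∈ M.interiorVertices ∨ z ∈ T) →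
      nodeVal M φ z * bary T z x = 0 := fun z hz hor => by
    by_cases hzT : z ∈ T
    · have : z ∉ M.domain := fun h => hz (Finset.mem_inter.2
        ⟨mem_interiorVertices.2 ⟨⟨T, (mem_elements.1 hT).1, hzT⟩, h⟩, hzT⟩)
      rw [nodeVal, if_neg this, zero_mul]
    · rw [bary_of_notMem hzT]; simp
  rw [← Finset.sum_subset (Finset.inter_subset_left (s₁ := M.interiorVertices) (s₂ := T))
      fun z hz hz2 => h6 z hz2 (Or.inl hz),
    ← Finset.sum_subset (Finset.inter_subset_right (s₁ := M.interiorVertices) (s₂ := T))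
      fun z hz hz2 => h6 z hz2 (Or.inr hz)]

theorem restrict_hull_le (hT : T ∈ M.elements) :
    volume.restrict (convexHull ℝ (T : Set (E d))) ≤ volume.restrict M.domain := by
  rw [← Measure.restrict_congr_set (openSimplex_ae_eq T)]
  exact Measure.restrict_mono_set _ (openSimplex_subset_domain hT)

/-- Up to a null set, `Q` is a finite sum of fields that are continuous, hence bounded, on one
element and zero elsewhere. -/
theorem memLp_piecewise {Q : E d → E d} {q : Finset (E d) → E d → E d}
    (hq : ∀ T ∈ M.elements, Continuous (q T))
    (hQ : ∀ T ∈ M.elements, Q =ᵐ[volume.restrict (Mesh.openSimplex T)] q T) :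
    MemLp Q 2 (volume.restrict M.domain) := by
  have h1 : ∀ T ∈ M.elements, MemLp ((Mesh.openSimplex T).indicator (q T)) 2
      (volume.restrict M.domain) := fun T hT => by
    rw [memLp_indicator_iff_restrict (openSimplex_isOpen T).measurableSet,
      Measure.restrict_restrict (openSimplex_isOpen T).measurableSet,
      inter_eq_left.2 (openSimplex_subset_domain hT),
      Measure.restrict_congr_set (openSimplex_ae_eq T)]
    have hc := convexHull_isCompact T
    obtain ⟨B, hB⟩ := hc.exists_bound_of_continuousOn (hq T hT).continuousOn
    have : IsFiniteMeasure (volume.restrict (convexHull ℝ (T : Set (E d)))) :=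
      ⟨by simpa using hc.measure_lt_top⟩
    exact MemLp.of_bound (hq T hT).aestronglyMeasurable B
      ((ae_restrict_mem hc.measurableSet).mono hB)
  refine (memLp_congr_ae ?_).2 (memLp_finsetSum' M.elements h1)
  refine ae_domain_iff.2 fun T hT => ?_
  filter_upwards [hQ T hT, ae_restrict_mem (openSimplex_isOpen T).measurableSet] with x hx hxT
  rw [hx, Finset.sum_apply, Finset.sum_eq_single T, indicator_of_mem hxT]
  · intro S hS hne
    refine indicator_of_notMem (fun h => hne ?_) _
    exact eq_of_mem_openSimplex hS hT h (openSimplex_subset T hxT)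
  · exact fun h => absurd hT h

/-- The bound for the residual functional of a piecewise smooth flux on `H¹₀`. -/
theorem weak_residual_bound (hd : 2 ≤ d) (hK : 1 ≤ K) (hM : ∀ T ∈ M.elements, IsRegularSimplex K T)
    {q : Finset (E d) → E d → E d} (hq : ∀ T ∈ M.elements, ContDiff ℝ 1 (q T))
    {Q : E d → E d} (hQ : ∀ T ∈ M.elements, Q =ᵐ[volume.restrict (Mesh.openSimplex T)] q T)
    (f : Lp ℝ 2 (volume.restrict M.domain)) (u : H10 M.domain) :
    |(∫ x in M.domain, f x * val (u - clementL M u) x) -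
      ∫ x in M.domain, inner ℝ (Q x) (grad (u - clementL M u) x)| ≤
      detConst d K * √(etaSq M f q) * normX u := by
  have hd1 : 1 ≤ d := by omega
  have hQL : MemLp Q 2 (volume.restrict M.domain) :=
    memLp_piecewise (fun T hT => (hq T hT).continuous) hQ
  have hfun : ∀ e : H10 M.domain, (∫ x in M.domain, f x * val e x) -
      (∫ x in M.domain, inner ℝ (Q x) (grad e x)) = inner ℝ f (valL _ e) -
        inner ℝ (hQL.toLp Q) (gradL _ e) := fun e => by
    rw [L2.inner_def, L2.inner_def]
    congr 1
    · refine integral_congr_ae (Eventually.of_forall fun x => ?_)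
      simp [valL_apply, mul_comm]
    · refine integral_congr_ae ?_
      filter_upwards [hQL.coeFn_toLp] with x hx
      rw [hx, gradL_apply]
  rw [hfun]
  -- Both sides are continuous in `u`, including the interpolant, since patch averages are bounded
  -- functionals. Hence test functions suffice.
  refine H10_closed_induction (p := fun u => |(inner ℝ f (valL _ (u - clementL M u)) : ℝ) -
        inner ℝ (hQL.toLp Q) (gradL _ (u - clementL M u))| ≤
          detConst d K * √(etaSq M f q) * ‖gradL _ u‖)
    (isClosed_le (by fun_prop) (by fun_prop)) (fun u hu => ?_) u
  rw [← hfun]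
  obtain ⟨φ, h1, h2, h3, h4, h5⟩ := hu
  have h1' : ContDiff ℝ 1 φ := h1.of_le (by exact_mod_cast le_top)
  have hfT : ∀ T ∈ M.elements, MemLp f 2 (volume.restrict (convexHull ℝ (T : Set (E d)))) :=
    fun T hT => (Lp.memLp f).mono_measure (restrict_hull_le hT)
  have hbound := smooth_residual_bound hd hK hM hq hfT h1'
    fun x hx => image_eq_zero_of_notMem_tsupport fun h => hx (h3 h)
  have hen : √(∑ T ∈ M.elements, energy T φ) = ‖gradL _ u‖ := by
    rw [Real.sqrt_eq_iff_eq_sq (Finset.sum_nonneg fun _ _ => energy_nonneg _ _) (norm_nonneg _),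
      norm_sq_eq_integral, gradL_apply]
    have hi : IntegrableOn (fun x => ‖gradient φ x‖ ^ 2) M.domain :=
      ((((continuous_gradient h1').norm.pow 2).continuousOn.integrableOn_compact
        (domain_isBounded M).isCompact_closure)).mono_set subset_closure
    rw [show ∑ T ∈ M.elements, energy T φ = ∫ x in M.domain, ‖gradient φ x‖ ^ 2 from
      (setIntegral_domain hi).symm]
    refine integral_congr_ae ?_
    filter_upwards [h5] with x hx
    change _ = ‖u.1.2 x‖ ^ 2
    rw [hx]
  rw [hen] at hbound
  convert hbound using 2
  set e := u - clementL M u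
  have i1 : Integrable (fun x => f x * val e x) (volume.restrict M.domain) :=
    (Lp.memLp f).integrable_mul (Lp.memLp (val e))
  have i2 : Integrable (fun x => (inner ℝ (Q x) (grad e x) : ℝ)) (volume.restrict M.domain) :=
    (L2.integrable_inner (𝕜 := ℝ) (hQL.toLp Q) (grad e)).congr (by
      filter_upwards [hQL.coeFn_toLp] with x hx; rw [hx])
  rw [← integral_sub i1 i2,
    setIntegral_domain (h := fun x => f x * val e x - inner ℝ (Q x) (grad e x)) (i1.sub i2)]
  refine Finset.sum_congr rfl fun T hT => ?_
  rw [← Measure.restrict_congr_set (openSimplex_ae_eq T)]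
  have hv := val_sub_clement hd1 u h4 hT
  -- The error coincides with a smooth function on the open element, which identifies its weak
  -- gradient there.
  have hg := grad_ae_eq_gradient (domain_isOpen M).measurableSet _ (openSimplex_isOpen T)
    (openSimplex_subset_domain hT) (contDiff_localError h1' T) hv
  refine integral_congr_ae ?_
  filter_upwards [hv, hg, hQ T hT] with x e1 e2 e3
  rw [e1, e2, e3]

end WeakBound

end SGFEM


namespace SGFEM

section Hermite

open scoped Topology Polynomial

/-! ### Hermite polynomials in `L²` of the standard Gaussian measure -/

theorem integrable_eval_gaussian (v : ℝ≥0) (p : ℝ[X]) :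
    Integrable (fun t => p.eval t) (gaussianReal 0 v) := by
  simp only [Polynomial.eval_eq_sum_range]
  refine integrable_finsetSum _ fun i _ => Integrable.const_mul ?_ _
  have := (memLp_id_gaussianReal (μ := 0) (v := v) (i : ℝ≥0)).integrable_norm_pow'
  refine (integrable_norm_iff (by fun_prop)).1 ?_
  simpa using this

/-- Gaussian integration by parts: the density has derivative `-x` times itself. -/
theorem integral_X_mul_eval (p : ℝ[X]) :
    ∫ t, (Polynomial.X * p).eval t ∂gaussianReal 0 1 =
      ∫ t, p.derivative.eval t ∂gaussianReal 0 1 := by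
  have hd : ∀ x, HasDerivAt (gaussianPDFReal 0 1) (-x * gaussianPDFReal 0 1 x) x := fun x => by
    have h1 : HasDerivAt (fun x : ℝ => (√(2 * Real.pi * (1 : ℝ≥0)))⁻¹ *
        Real.exp (-(x - 0) ^ 2 / (2 * (1 : ℝ≥0)))) ((√(2 * Real.pi * (1 : ℝ≥0)))⁻¹ *
          (Real.exp (-(x - 0) ^ 2 / (2 * (1 : ℝ≥0))) * (-(2 * (x - 0)) / (2 * (1 : ℝ≥0))))) x := by
      refine HasDerivAt.const_mul _ (HasDerivAt.exp ?_)
      have := (((hasDerivAt_id x).sub_const 0).pow 2).neg.div_const (2 * ((1 : ℝ≥0) : ℝ))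
      simpa using this
    rw [gaussianPDFReal_def]
    convert h1 using 1
    simp only [NNReal.coe_one, sub_zero, mul_one]; ring
  have hi : ∀ q : ℝ[X], Integrable (fun x => q.eval x * gaussianPDFReal 0 1 x) := fun q => by
    have h := integrable_eval_gaussian 1 q
    rw [gaussianReal_of_var_ne_zero 0 one_ne_zero,
      integrable_withDensity_iff_integrable_smul' (measurable_gaussianPDF 0 1)
        (Eventually.of_forall fun _ => gaussianPDF_lt_top)] at h
    simpa [toReal_gaussianPDF, mul_comm] using h
  have h := integral_mul_deriv_eq_deriv_mul_of_integrable (u := fun x => p.eval x)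
    (u' := fun x => p.derivative.eval x) (v := gaussianPDFReal 0 1)
    (v' := fun x => -x * gaussianPDFReal 0 1 x) (fun x _ => p.hasDerivAt x) (fun x _ => hd x)
    (by
      have := (hi (Polynomial.X * p)).neg
      refine this.congr (Eventually.of_forall fun x => ?_)
      simp; ring) (hi _) (hi _)
  rw [integral_gaussianReal_eq_integral_smul one_ne_zero,
    integral_gaussianReal_eq_integral_smul one_ne_zero]
  have e1 : ∀ x, gaussianPDFReal 0 1 x • (Polynomial.X * p).eval x =
      -(p.eval x * (-x * gaussianPDFReal 0 1 x)) := fun x => by simp; ring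
  have e2 : ∀ x, gaussianPDFReal 0 1 x • p.derivative.eval x =
      p.derivative.eval x * gaussianPDFReal 0 1 x := fun x => by simp; ring
  simp only [e1, e2, integral_neg, h, neg_neg]

/-- The Hermite polynomials with real coefficients. -/
noncomputable def hermiteR (n : ℕ) : ℝ[X] := (Polynomial.hermite n).map (Int.castRingHom ℝ)

theorem hermiteR_succ (n : ℕ) :
    hermiteR (n + 1) = Polynomial.X * hermiteR n - (hermiteR n).derivative := by
  simp [hermiteR, Polynomial.hermite_succ, Polynomial.derivative_map]

theorem hermite1_eq (n : ℕ) (t : ℝ) :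
    hermite1 n t = (hermiteR n).eval t / √(n.factorial : ℝ) := by
  simp [hermite1, hermiteR, Polynomial.eval_map, Polynomial.aeval_def]

theorem hermite1_zero (t : ℝ) : hermite1 0 t = 1 := by
  simp [hermite1_eq, hermiteR]

theorem continuous_hermite1 (n : ℕ) : Continuous (hermite1 n) := by
  have : hermite1 n = fun t => (hermiteR n).eval t / √(n.factorial : ℝ) := by
    ext t; exact hermite1_eq n t
  rw [this]; fun_prop

/-- By the recursion, raising the Hermite index is the adjoint of differentiation in the Gaussian
`L²`, so all `n` derivatives move to `q`. Orthogonality follows by counting degrees. -/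
theorem integral_hermiteR_mul (n : ℕ) (q : ℝ[X]) :
    ∫ t, (hermiteR n * q).eval t ∂gaussianReal 0 1 =
      ∫ t, (Polynomial.derivative^[n] q).eval t ∂gaussianReal 0 1 := by
  induction n generalizing q with
  | zero => simp [hermiteR]
  | succ n ih =>
    rw [Function.iterate_succ_apply, ← ih, hermiteR_succ]
    have e1 : (Polynomial.X * hermiteR n - (hermiteR n).derivative) * q =
        Polynomial.X * (hermiteR n * q) - (hermiteR n).derivative * q := by ring
    rw [e1]
    simp only [Polynomial.eval_sub]
    rw [integral_sub (integrable_eval_gaussian 1 _) (integrable_eval_gaussian 1 _),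
      integral_X_mul_eval, Polynomial.derivative_mul]
    simp only [Polynomial.eval_add]
    rw [integral_add (integrable_eval_gaussian 1 _) (integrable_eval_gaussian 1 _)]
    ring

theorem natDegree_hermiteR (n : ℕ) : (hermiteR n).natDegree = n := by
  rw [hermiteR, Polynomial.natDegree_map_eq_of_injective (RingHom.injective_int _),
    Polynomial.natDegree_hermite]

theorem integral_hermiteR_self (n : ℕ) :
    ∫ t, (hermiteR n * hermiteR n).eval t ∂gaussianReal 0 1 = n.factorial := by
  have h0 : (Polynomial.derivative^[n] (hermiteR n)).natDegree = 0 := by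
    have := Polynomial.natDegree_iterate_derivative (hermiteR n) n
    rw [natDegree_hermiteR] at this
    omega
  rw [integral_hermiteR_mul, Polynomial.eq_C_of_natDegree_eq_zero h0,
    Polynomial.coeff_iterate_derivative]
  simp [hermiteR, Polynomial.coeff_map, Nat.descFactorial_self]

theorem integral_hermiteR_of_lt {m n : ℕ} (h : m < n) :
    ∫ t, (hermiteR n * hermiteR m).eval t ∂gaussianReal 0 1 = 0 := by
  rw [integral_hermiteR_mul, Polynomial.iterate_derivative_eq_zero (by rwa [natDegree_hermiteR])]
  simp

theorem integral_hermite1_mul (m n : ℕ) :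
    ∫ t, hermite1 m t * hermite1 n t ∂gaussianReal 0 1 = if m = n then 1 else 0 := by
  have e : ∀ t, hermite1 m t * hermite1 n t =
      (hermiteR m * hermiteR n).eval t / (√(m.factorial : ℝ) * √(n.factorial : ℝ)) := fun t => by
    rw [hermite1_eq, hermite1_eq, Polynomial.eval_mul]; field_simp
  simp only [e]
  rw [integral_div]
  split_ifs with h
  · rw [h, integral_hermiteR_self, Real.mul_self_sqrt (by positivity), div_self (by positivity)]
  · rcases lt_or_gt_of_ne h with h | h
    · rw [mul_comm, integral_hermiteR_of_lt h, zero_div]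
    · rw [integral_hermiteR_of_lt h, zero_div]

/-! ### Exponential moments -/

/-- Bounding `exp (t|x|)` by `exp (tx) + exp (-tx)` would leave a factor `2`, fatal in an infinite
product. From `exp s ≤ 1 + s * exp s` comes a bound `exp (C * t)` with `C` uniform for `t ≤ A`,
which multiplies to a finite value for summable `t`. -/
theorem lintegral_exp_mul_abs_le {A t : ℝ} (ht : 0 ≤ t) (htA : t ≤ A) :
    ∫⁻ x, ENNReal.ofReal (Real.exp (t * |x|)) ∂gaussianReal 0 1 ≤
      ENNReal.ofReal (Real.exp (t * (2 * Real.exp ((A + 1) ^ 2 / 2)))) := by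
  have hp := integrable_exp_mul_gaussianReal (μ := 0) (v := 1) (A + 1)
  have hn := integrable_exp_mul_gaussianReal (μ := 0) (v := 1) (-(A + 1))
  have hm : ∀ s : ℝ, ∫ x, Real.exp (s * x) ∂gaussianReal 0 1 = Real.exp (s ^ 2 / 2) := fun s => by
    have := congrFun (mgf_id_gaussianReal (μ := 0) (v := 1)) s
    simpa [mgf] using this
  have hb : ∀ x : ℝ, Real.exp (t * |x|) ≤
      1 + t * (Real.exp ((A + 1) * x) + Real.exp (-(A + 1) * x)) := fun x => by
    have h1 : Real.exp (t * |x|) ≤ 1 + t * |x| * Real.exp (t * |x|) := by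
      have := Real.add_one_le_exp (-(t * |x|))
      rw [Real.exp_neg] at this
      have hpos := Real.exp_pos (t * |x|)
      have h2 := mul_le_mul_of_nonneg_right this hpos.le
      rw [inv_mul_cancel₀ hpos.ne'] at h2
      linarith
    have h2 : |x| * Real.exp (t * |x|) ≤ Real.exp ((A + 1) * |x|) := by
      have h3 : |x| ≤ Real.exp |x| := by linarith [Real.add_one_le_exp |x|]
      have h4 : Real.exp (t * |x|) ≤ Real.exp (A * |x|) :=
        Real.exp_le_exp.2 (mul_le_mul_of_nonneg_right htA (abs_nonneg x))
      calc _ ≤ Real.exp |x| * Real.exp (A * |x|) :=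
            mul_le_mul h3 h4 (Real.exp_pos _).le (Real.exp_pos _).le
        _ = _ := by rw [← Real.exp_add]; ring_nf
    have h3 : Real.exp ((A + 1) * |x|) ≤ Real.exp ((A + 1) * x) + Real.exp (-(A + 1) * x) := by
      rcases abs_cases x with ⟨h, -⟩ | ⟨h, -⟩
      · rw [h]; linarith [Real.exp_pos (-(A + 1) * x)]
      · rw [h, mul_neg, ← neg_mul]; linarith [Real.exp_pos ((A + 1) * x)]
    have h4 := mul_le_mul_of_nonneg_left (h2.trans h3) ht
    linarith
  have hi : Integrable (fun x => 1 + t * (Real.exp ((A + 1) * x) + Real.exp (-(A + 1) * x)))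
      (gaussianReal 0 1) := (integrable_const _).add ((hp.add hn).const_mul t)
  calc _ ≤ ∫⁻ x, ENNReal.ofReal (1 + t * (Real.exp ((A + 1) * x) + Real.exp (-(A + 1) * x)))
          ∂gaussianReal 0 1 := lintegral_mono fun x => ENNReal.ofReal_le_ofReal (hb x)
    _ = ENNReal.ofReal (1 + t * (2 * Real.exp ((A + 1) ^ 2 / 2))) := by
        rw [← ofReal_integral_eq_lintegral_ofReal hi
          (Eventually.of_forall fun x => by positivity)]
        congr 1
        rw [integral_add (g := fun x => t * (Real.exp ((A + 1) * x) + Real.exp (-(A + 1) * x)))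
          (integrable_const _) ((hp.add hn).const_mul t), integral_const_mul,
          integral_add hp hn, hm, hm, neg_sq, integral_const, probReal_univ, one_smul]
        ring
    _ ≤ _ := ENNReal.ofReal_le_ofReal (by
        linarith [Real.add_one_le_exp (t * (2 * Real.exp ((A + 1) ^ 2 / 2)))])

/-- Exponential integrability of series of nonnegative random variables. -/
theorem lintegral_exp_tsum_le {Ω : Type*} [MeasurableSpace Ω] {P : Measure Ω} {h : ℕ → Ω → ℝ}
    (hm : ∀ m, Measurable (h m)) (h0 : ∀ m y, 0 ≤ h m y) {C : ℝ≥0∞} (hC : C ≠ ⊤)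
    (hb : ∀ n, ∫⁻ y, ∏ m ∈ Finset.range n, ENNReal.ofReal (Real.exp (h m y)) ∂P ≤ C) :
    (∀ᵐ y ∂P, Summable fun m => h m y) ∧
      ∫⁻ y, ENNReal.ofReal (Real.exp (∑' m, h m y)) ∂P ≤ C := by
  set F : ℕ → Ω → ℝ≥0∞ := fun n y => ENNReal.ofReal (Real.exp (∑ m ∈ Finset.range n, h m y))
    with hF
  have hFe : ∀ n y, F n y = ∏ m ∈ Finset.range n, ENNReal.ofReal (Real.exp (h m y)) := fun n y => by
    simp only [hF]
    rw [Real.exp_sum, ENNReal.ofReal_prod_of_nonneg fun _ _ => (Real.exp_pos _).le]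
  have hFm : ∀ n, Measurable (F n) := fun n => by
    simp only [hF]
    exact ((Finset.measurable_sum _ fun m _ => hm m).exp).ennreal_ofReal
  have hmono : Monotone F := fun i j hij y => ENNReal.ofReal_le_ofReal (Real.exp_le_exp.2
    (Finset.sum_le_sum_of_subset_of_nonneg (Finset.range_mono hij) fun m _ _ => h0 m y))
  have hsup : ∫⁻ y, ⨆ n, F n y ∂P ≤ C := by
    rw [lintegral_iSup hFm hmono]
    exact iSup_le fun n => by simpa only [hFe] using hb n
  -- The monotone limit of the exponentials has a finite integral, so it is finite almost everywhere
  -- and bounds the partial sums.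
  have hae : ∀ᵐ y ∂P, Summable fun m => h m y := by
    filter_upwards [ae_lt_top (Measurable.iSup hFm) (hsup.trans_lt hC.lt_top).ne] with y hy
    refine summable_of_sum_range_le (c := Real.log (⨆ n, F n y).toReal) (fun m => h0 m y) fun n => ?_
    have h1 : F n y ≤ ⨆ n, F n y := le_iSup (fun n => F n y) n
    have h2 : Real.exp (∑ m ∈ Finset.range n, h m y) ≤ (⨆ n, F n y).toReal :=
      (ENNReal.ofReal_le_iff_le_toReal hy.ne).1 h1
    exact (Real.le_log_iff_exp_le ((Real.exp_pos _).trans_le h2)).2 h2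
  refine ⟨hae, (lintegral_mono_ae ?_).trans hsup⟩
  filter_upwards [hae] with y hy
  have ht : Tendsto (fun n => F n y) atTop (𝓝 (ENNReal.ofReal (Real.exp (∑' m, h m y)))) :=
    (ENNReal.continuous_ofReal.tendsto _).comp
      ((Real.continuous_exp.tendsto _).comp hy.hasSum.tendsto_sum_nat)
  exact le_of_tendsto' ht fun n => le_iSup (fun n => F n y) n

end Hermite

end SGFEM


namespace SGFEM

/-! ### Gaussian product measures -/

section Product

open scoped Topology Classical

variable {σ : ℕ → ℝ}

theorem map_div_gaussian {s : ℝ} (hs : 0 < s) :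
    (gaussianReal 0 (Real.toNNReal (s ^ 2))).map (fun t => t / s) = gaussianReal 0 1 := by
  rw [gaussianReal_map_div_const, zero_div]
  congr 1
  ext
  simp only [NNReal.coe_div, NNReal.coe_mk, Real.coe_toNNReal _ (sq_nonneg s), NNReal.coe_one]
  rw [div_self (by positivity)]

theorem map_eval_div (hσ : ∀ m, 0 < σ m) (m : ℕ) :
    (gammaMeasure σ).map (fun y => y m / σ m) = gaussianReal 0 1 := by
  rw [← map_div_gaussian (hσ m)]
  have h1 := Measure.infinitePi_map_eval (fun m => gaussianReal 0 (Real.toNNReal (σ m ^ 2))) m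
  rw [← h1, Measure.map_map (by fun_prop) (by fun_prop)]
  rfl

/-- Under `gammaMeasure σ` the variables `y m / σ m` are independent standard Gaussians. -/
theorem lintegral_prod_std (hσ : ∀ m, 0 < σ m) (S : Finset ℕ) {g : ℕ → ℝ → ℝ≥0∞}
    (hg : ∀ m, Measurable (g m)) :
    ∫⁻ y, ∏ m ∈ S, g m (y m / σ m) ∂gammaMeasure σ = ∏ m ∈ S, ∫⁻ t, g m t ∂gaussianReal 0 1 := by
  have hi := iIndepFun_infinitePi (P := fun m => gaussianReal 0 (Real.toNNReal (σ m ^ 2)))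
    (X := fun m t => g m (t / σ m)) (fun m => (hg m).comp (by fun_prop))
  have := lintegral_prod_eq_prod_lintegral_of_indepFun S _ hi
    (fun m => (hg m).comp (by fun_prop))
  refine Eq.trans this (Finset.prod_congr rfl fun m _ => ?_)
  rw [← map_eval_div hσ m, lintegral_map (hg m) (by fun_prop)]
  rfl

theorem integral_prod_std (hσ : ∀ m, 0 < σ m) (S : Finset ℕ) {g : ℕ → ℝ → ℝ}
    (hg : ∀ m, Measurable (g m)) :
    ∫ y, ∏ m ∈ S, g m (y m / σ m) ∂gammaMeasure σ = ∏ m ∈ S, ∫ t, g m t ∂gaussianReal 0 1 := by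
  have hi := iIndepFun_infinitePi (P := fun m => gaussianReal 0 (Real.toNNReal (σ m ^ 2)))
    (X := fun m t => g m (t / σ m)) (fun m => (hg m).comp (by fun_prop))
  have hi' := hi.precomp (g := fun m : S => (m : ℕ)) Subtype.val_injective
  have := hi'.integral_fun_prod_eq_prod_integral
    (fun m => ((hg m).comp (by fun_prop)).aestronglyMeasurable)
  simp only [Finset.univ_eq_attach] at this
  change ∫ y, ∏ m ∈ S.attach, g m (y m / σ m) ∂gammaMeasure σ =
    ∏ m ∈ S.attach, ∫ y, g m (y m / σ m) ∂gammaMeasure σ at this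
  rw [Finset.prod_attach S (fun m => ∫ y, g m (y m / σ m) ∂gammaMeasure σ)] at this
  have e : ∀ y : ℕ → ℝ, ∏ m ∈ S.attach, g m (y m / σ m) = ∏ m ∈ S, g m (y m / σ m) := fun y =>
    Finset.prod_attach S (fun m => g m (y m / σ m))
  simp only [e] at this
  refine Eq.trans this (Finset.prod_congr rfl fun m _ => ?_)
  rw [← map_eval_div hσ m, integral_map ((measurable_pi_apply m).div_const _).aemeasurable
    (hg m).aestronglyMeasurable]

/-! ### Tensor product Hermite polynomials -/

theorem hermiteT_eq_prod (σ : ℕ → ℝ) (μ : ℕ →₀ ℕ) {S : Finset ℕ} (hS : μ.support ⊆ S) (y : ℕ → ℝ) :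
    hermiteT σ μ y = ∏ m ∈ S, hermite1 (μ m) (y m / σ m) := by
  rw [hermiteT]
  refine Finset.prod_subset hS fun m _ hm => ?_
  rw [Finsupp.notMem_support_iff.1 hm, hermite1_zero]

theorem hermiteT_zero (σ : ℕ → ℝ) (y : ℕ → ℝ) : hermiteT σ 0 y = 1 := by simp [hermiteT]

theorem measurable_hermiteT (σ : ℕ → ℝ) (μ : ℕ →₀ ℕ) : Measurable (hermiteT σ μ) := by
  unfold hermiteT
  refine Finset.measurable_prod _ fun m _ => (continuous_hermite1 _).measurable.comp (by fun_prop)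

theorem lintegral_hermiteT_pow (hσ : ∀ m, 0 < σ m) (μ : ℕ →₀ ℕ) (k : ℕ) :
    ∫⁻ y, ENNReal.ofReal (|hermiteT σ μ y| ^ k) ∂gammaMeasure σ < ⊤ := by
  have e : ∀ y, ENNReal.ofReal (|hermiteT σ μ y| ^ k) =
      ∏ m ∈ μ.support, ENNReal.ofReal (|hermite1 (μ m) (y m / σ m)| ^ k) := fun y => by
    rw [hermiteT, Finset.abs_prod, ← Finset.prod_pow,
      ENNReal.ofReal_prod_of_nonneg fun _ _ => by positivity]
  simp only [e]
  rw [lintegral_prod_std hσ μ.support (g := fun m t => ENNReal.ofReal (|hermite1 (μ m) t| ^ k))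
    (fun m => ((continuous_hermite1 _).abs.pow k).measurable.ennreal_ofReal)]
  refine ENNReal.prod_lt_top fun m _ => ?_
  have hi : Integrable (fun t => |hermite1 (μ m) t| ^ k) (gaussianReal 0 1) := by
    have h1 := integrable_eval_gaussian 1 (hermiteR (μ m) ^ k)
    have h2 := (h1.div_const (√((μ m).factorial : ℝ) ^ k)).norm
    refine h2.congr (Eventually.of_forall fun t => ?_)
    simp [hermite1_eq, abs_div, div_pow]
  exact hi.lintegral_lt_top

theorem integrable_hermiteT_mul (hσ : ∀ m, 0 < σ m) (μ ν : ℕ →₀ ℕ) :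
    Integrable (fun y => hermiteT σ μ y * hermiteT σ ν y) (gammaMeasure σ) := by
  have h : ∀ μ, MemLp (hermiteT σ μ) 2 (gammaMeasure σ) := fun μ => by
    refine (memLp_two_iff_integrable_sq (measurable_hermiteT σ μ).aestronglyMeasurable).2 ?_
    refine ⟨((measurable_hermiteT σ μ).pow_const 2).aestronglyMeasurable, ?_⟩
    rw [hasFiniteIntegral_iff_ofReal (Eventually.of_forall fun _ => sq_nonneg _)]
    simpa using lintegral_hermiteT_pow hσ μ 2
  exact (h μ).integrable_mul (h ν)

theorem integral_hermiteT_mul (hσ : ∀ m, 0 < σ m) (μ ν : ℕ →₀ ℕ) :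
    ∫ y, hermiteT σ μ y * hermiteT σ ν y ∂gammaMeasure σ = if μ = ν then 1 else 0 := by
  have e : ∀ y, hermiteT σ μ y * hermiteT σ ν y = ∏ m ∈ μ.support ∪ ν.support,
      (hermite1 (μ m) (y m / σ m) * hermite1 (ν m) (y m / σ m)) := fun y => by
    rw [hermiteT_eq_prod σ μ Finset.subset_union_left, hermiteT_eq_prod σ ν
      Finset.subset_union_right, Finset.prod_mul_distrib]
  simp only [e]
  rw [integral_prod_std hσ _ (g := fun m t => hermite1 (μ m) t * hermite1 (ν m) t)
    (fun m => ((continuous_hermite1 _).mul (continuous_hermite1 _)).measurable)]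
  simp only [integral_hermite1_mul]
  split_ifs with h
  · simp [h]
  · obtain ⟨m, hm⟩ := DFunLike.ne_iff.1 h
    refine Finset.prod_eq_zero (i := m) ?_ (if_neg hm)
    rw [Finset.mem_union, Finsupp.mem_support_iff, Finsupp.mem_support_iff]
    omega

/-! ### The density of the scaled product measure -/

theorem gaussian_eq_withDensity {s : ℝ} (hs : 0 < s) :
    gaussianReal 0 (Real.toNNReal (s ^ 2)) = (gaussianReal 0 1).withDensity fun t =>
      ENNReal.ofReal (s⁻¹ * Real.exp (-((s⁻¹ ^ 2 - 1) / 2 * t ^ 2))) := by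
  have hs2 : Real.toNNReal (s ^ 2) ≠ 0 := by
    rw [Ne, Real.toNNReal_eq_zero]; push Not; positivity
  rw [gaussianReal_of_var_ne_zero 0 one_ne_zero, gaussianReal_of_var_ne_zero 0 hs2,
    ← withDensity_mul _ (measurable_gaussianPDF 0 1) (by fun_prop)]
  congr 1
  ext t
  rw [Pi.mul_apply, gaussianPDF, gaussianPDF,
    ← ENNReal.ofReal_mul (gaussianPDFReal_nonneg _ _ _)]
  congr 1
  simp only [gaussianPDFReal, Real.coe_toNNReal _ (sq_nonneg s), NNReal.coe_one, sub_zero, mul_one]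
  rw [show (√(2 * Real.pi))⁻¹ * Real.exp (-t ^ 2 / 2) *
      (s⁻¹ * Real.exp (-((s⁻¹ ^ 2 - 1) / 2 * t ^ 2))) = (√(2 * Real.pi))⁻¹ * s⁻¹ *
      (Real.exp (-t ^ 2 / 2) * Real.exp (-((s⁻¹ ^ 2 - 1) / 2 * t ^ 2))) by ring, ← Real.exp_add,
    Real.sqrt_mul (by positivity), Real.sqrt_sq hs.le, mul_inv]
  congr 2
  field_simp
  ring

/-- The one-dimensional densities. -/
noncomputable def zeta1 (s t : ℝ) : ℝ := s⁻¹ * Real.exp (-((s⁻¹ ^ 2 - 1) / 2 * t ^ 2))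

theorem zeta1_nonneg {s : ℝ} (hs : 0 < s) (t : ℝ) : 0 ≤ zeta1 s t := by
  unfold zeta1; positivity

theorem measurable_zeta1 (s : ℝ) : Measurable (zeta1 s) := by unfold zeta1; fun_prop

theorem lintegral_zeta1 {s : ℝ} (hs : 0 < s) :
    ∫⁻ t, ENNReal.ofReal (zeta1 s t) ∂gaussianReal 0 1 = 1 := by
  have := measure_univ (μ := gaussianReal 0 (Real.toNNReal (s ^ 2)))
  rw [gaussian_eq_withDensity hs, withDensity_apply _ MeasurableSet.univ,
    Measure.restrict_univ] at this
  exact this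

theorem gammaStd_eq : gammaStd = gammaMeasure fun _ => 1 := by
  simp [gammaStd, gammaMeasure]

theorem lintegral_prod_gammaStd (S : Finset ℕ) {g : ℕ → ℝ → ℝ≥0∞} (hg : ∀ m, Measurable (g m)) :
    ∫⁻ y, ∏ m ∈ S, g m (y m) ∂gammaStd = ∏ m ∈ S, ∫⁻ t, g m t ∂gaussianReal 0 1 := by
  have := lintegral_prod_std (σ := fun _ => 1) (fun _ => one_pos) S hg
  simpa [gammaStd_eq] using this

theorem measurable_zeta (σ : ℕ → ℝ) : Measurable (zeta σ) := by
  unfold zeta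
  exact Measurable.tprod fun m => by fun_prop

/-- Almost sure convergence and domination of the partial products of the density. -/
theorem ae_zeta {s : ℕ → ℝ} (hs0 : ∀ m, 0 ≤ s m) (hs : Summable s) :
    (∀ᵐ y ∂gammaStd, Tendsto (fun n => ∏ m ∈ Finset.range n, zeta1 (Real.exp (s m)) (y m)) atTop
      (𝓝 (zeta (fun m => Real.exp (s m)) y)) ∧ 0 < zeta (fun m => Real.exp (s m)) y) ∧
    ∃ G : (ℕ → ℝ) → ℝ≥0∞, ∫⁻ y, G y ∂gammaStd ≠ ⊤ ∧
      ∀ᵐ y ∂gammaStd, ∀ n, ENNReal.ofReal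
        (∏ m ∈ Finset.range n, zeta1 (Real.exp (s m)) (y m)) ≤ G y := by
  -- The logarithm of each factor of the density is `h m y - s m`, where `h m ≥ 0` because the
  -- standard deviation is at least `1`. Splitting off the summable deterministic part leaves a
  -- monotone series, and `exp (∑ h)` is an integrable majorant of all partial products.
  set h : ℕ → (ℕ → ℝ) → ℝ := fun m y => (1 - (Real.exp (s m))⁻¹ ^ 2) / 2 * y m ^ 2 with hh
  have h0 : ∀ m y, 0 ≤ h m y := fun m y => by
    have : (Real.exp (s m))⁻¹ ≤ 1 := inv_le_one_of_one_le₀ (Real.one_le_exp (hs0 m))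
    have h2 : (Real.exp (s m))⁻¹ ^ 2 ≤ 1 := pow_le_one₀ (by positivity) this
    have : 0 ≤ 1 - (Real.exp (s m))⁻¹ ^ 2 := by linarith
    positivity
  have hz : ∀ m (y : ℕ → ℝ), zeta1 (Real.exp (s m)) (y m) = Real.exp (h m y - s m) := fun m y => by
    rw [zeta1, Real.exp_sub, div_eq_mul_inv (Real.exp (h m y)), mul_comm (Real.exp (h m y))]
    congr 2
    simp only [hh]; ring
  obtain ⟨hsum, hG⟩ := lintegral_exp_tsum_le (P := gammaStd) (h := h)
    (C := ENNReal.ofReal (Real.exp (∑' m, s m)))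
    (fun m => by fun_prop) h0 ENNReal.ofReal_ne_top fun n => by
      rw [lintegral_prod_gammaStd (Finset.range n)
        (g := fun m t => ENNReal.ofReal (Real.exp ((1 - (Real.exp (s m))⁻¹ ^ 2) / 2 * t ^ 2)))
        (fun m => by fun_prop)]
      -- No explicit Gaussian integral is needed: the integrand is `exp (s m)` times a probability
      -- density.
      have h1 : ∀ m, ∫⁻ t, ENNReal.ofReal (Real.exp ((1 - (Real.exp (s m))⁻¹ ^ 2) / 2 * t ^ 2))
          ∂gaussianReal 0 1 = ENNReal.ofReal (Real.exp (s m)) := fun m => by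
        have e : ∀ t : ℝ, ENNReal.ofReal (Real.exp ((1 - (Real.exp (s m))⁻¹ ^ 2) / 2 * t ^ 2)) =
            ENNReal.ofReal (Real.exp (s m)) * ENNReal.ofReal (zeta1 (Real.exp (s m)) t) :=
          fun t => by
          rw [← ENNReal.ofReal_mul (Real.exp_pos _).le, zeta1, ← mul_assoc,
            mul_inv_cancel₀ (Real.exp_pos _).ne', one_mul]
          congr 2; ring
        simp only [e]
        rw [lintegral_const_mul _ (measurable_zeta1 _).ennreal_ofReal,
          lintegral_zeta1 (Real.exp_pos _), mul_one]
      simp only [h1]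
      rw [← ENNReal.ofReal_prod_of_nonneg fun _ _ => (Real.exp_pos _).le, ← Real.exp_sum]
      exact ENNReal.ofReal_le_ofReal (Real.exp_le_exp.2
        (hs.sum_le_tsum _ fun m _ => hs0 m))
  refine ⟨?_, fun y => ENNReal.ofReal (Real.exp (∑' m, h m y)),
    (hG.trans_lt ENNReal.ofReal_lt_top).ne, ?_⟩
  · filter_upwards [hsum] with y hy
    have hp := (hy.sub hs).hasSum.rexp
    have hp' : HasProd (fun m => zeta1 (Real.exp (s m)) (y m))
        (Real.exp (∑' m, (h m y - s m))) := by
      simpa only [hz, Function.comp_def] using hp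
    have : zeta (fun m => Real.exp (s m)) y = Real.exp (∑' m, (h m y - s m)) := hp'.tprod_eq
    rw [this]
    exact ⟨hp'.tendsto_prod_nat, Real.exp_pos _⟩
  · filter_upwards [hsum] with y hy n
    simp only [hz]
    rw [← Real.exp_sum]
    refine ENNReal.ofReal_le_ofReal (Real.exp_le_exp.2 ?_)
    exact (Finset.sum_le_sum fun m _ => by linarith [hs0 m]).trans
      (hy.sum_le_tsum _ fun m _ => h0 m y)

/-- `ζ` is the density of the scaled Gaussian product measure. -/
theorem gammaMeasure_eq_withDensity {s : ℕ → ℝ} (hs0 : ∀ m, 0 ≤ s m) (hs : Summable s) :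
    gammaMeasure (fun m => Real.exp (s m)) =
      gammaStd.withDensity fun y => ENNReal.ofReal (zeta (fun m => Real.exp (s m)) y) := by
  obtain ⟨hz, G, hG, hGb⟩ := ae_zeta hs0 hs
  symm
  -- The product measure is determined by boxes with finitely many constrained coordinates. On such
  -- a box the integral of the partial products is constant once they include `S`, since the other
  -- factors integrate to one, and dominated convergence identifies it with the integral of `zeta`.
  refine Measure.eq_infinitePi _ fun S t ht => ?_
  have hmeas : MeasurableSet ((S : Set ℕ).pi t) :=
    MeasurableSet.pi S.countable_toSet fun m _ => ht m
  rw [withDensity_apply _ hmeas, ← lintegral_indicator hmeas]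
  set F : ℕ → (ℕ → ℝ) → ℝ≥0∞ := fun n => ((S : Set ℕ).pi t).indicator fun y =>
    ENNReal.ofReal (∏ m ∈ Finset.range n, zeta1 (Real.exp (s m)) (y m)) with hF
  have hlim : Tendsto (fun n => ∫⁻ y, F n y ∂gammaStd) atTop
      (𝓝 (∫⁻ y, ((S : Set ℕ).pi t).indicator
        (fun y => ENNReal.ofReal (zeta (fun m => Real.exp (s m)) y)) y ∂gammaStd)) := by
    refine tendsto_lintegral_of_dominated_convergence G (fun n => ?_) (fun n => ?_) hG ?_
    · refine Measurable.indicator ?_ hmeas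
      exact (Finset.measurable_prod _ fun m _ =>
        (measurable_zeta1 _).comp (measurable_pi_apply m)).ennreal_ofReal
    · filter_upwards [hGb] with y hy
      exact (indicator_le_self' (fun _ _ => zero_le) y).trans (hy n)
    · filter_upwards [hz] with y hy
      by_cases hyS : y ∈ (S : Set ℕ).pi t
      · simp only [hF, indicator_of_mem hyS]
        exact (ENNReal.continuous_ofReal.tendsto _).comp hy.1
      · simp only [hF, indicator_of_notMem hyS]
        exact tendsto_const_nhds
  refine tendsto_nhds_unique hlim (tendsto_const_nhds.congr' ?_)
  obtain ⟨N, hN⟩ := S.bddAbove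
  filter_upwards [eventually_gt_atTop N] with n hn
  have hSn : S ⊆ Finset.range n := fun m hm => Finset.mem_range.2 ((hN hm).trans_lt hn)
  set g : ℕ → ℝ → ℝ≥0∞ := fun m => if m ∈ S then
    (t m).indicator (fun x => ENNReal.ofReal (zeta1 (Real.exp (s m)) x)) else
      fun x => ENNReal.ofReal (zeta1 (Real.exp (s m)) x) with hg
  have hgm : ∀ m, Measurable (g m) := fun m => by
    simp only [hg]
    split_ifs
    · exact (measurable_zeta1 _).ennreal_ofReal.indicator (ht m)
    · exact (measurable_zeta1 _).ennreal_ofReal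
  have hFg : ∀ y, F n y = ∏ m ∈ Finset.range n, g m (y m) := fun y => by
    by_cases hyS : y ∈ (S : Set ℕ).pi t
    · simp only [hF, indicator_of_mem hyS]
      rw [ENNReal.ofReal_prod_of_nonneg fun m _ => zeta1_nonneg (Real.exp_pos _) _]
      refine Finset.prod_congr rfl fun m _ => ?_
      simp only [hg]
      split_ifs with hm
      · rw [indicator_of_mem (hyS m hm)]
      · rfl
    · simp only [hF, indicator_of_notMem hyS]
      rw [Set.mem_pi] at hyS
      push Not at hyS
      obtain ⟨m, hm, hmt⟩ := hyS
      refine (Finset.prod_eq_zero (hSn hm) ?_).symm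
      simp only [hg]
      rw [if_pos (by exact hm), indicator_of_notMem hmt]
  simp only [hFg]
  rw [lintegral_prod_gammaStd _ hgm, ← Finset.prod_subset hSn]
  · refine Finset.prod_congr rfl fun m hm => ?_
    simp only [hg, if_pos hm]
    rw [lintegral_indicator (ht m), gaussian_eq_withDensity (Real.exp_pos _),
      withDensity_apply _ (ht m)]
    rfl
  · intro m _ hm
    simp only [hg, if_neg hm]
    exact lintegral_zeta1 (Real.exp_pos _)

end Product

end SGFEM


namespace SGFEM

section Parametric

open scoped Topology Classical

variable {d : ℕ} {D : Set (E d)} {b : ℕ → E d → ℝ} {ϑ ρ : ℝ}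

/-! ### Integrability of the parametric functions -/

theorem alpha_nonneg (D : Set (E d)) (b : ℕ → E d → ℝ) (l : ℕ) : 0 ≤ alpha D b l :=
  ENNReal.toReal_nonneg

theorem ae_abs_le_alpha (hb : ∀ l, MemLp (b l) ⊤ (volume.restrict D)) :
    ∀ᵐ x ∂volume.restrict D, ∀ l, |b l x| ≤ alpha D b l := by
  refine ae_all_iff.2 fun l => ?_
  have h := ae_le_eLpNormEssSup (f := b l) (μ := volume.restrict D)
  filter_upwards [h] with x hx
  rw [← eLpNorm_exponent_top] at hx
  have h2 := ENNReal.toReal_mono (hb l).2.ne hx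
  rw [toReal_enorm] at h2
  exact h2

/-- In standardized variables the coefficients are `2 * α m * σ m`, still summable because the `σ m`
are bounded. The factor `2` is what the Young inequality behind `integrable_hermiteT_smul` consumes.
-/
theorem lintegral_exp_alpha (hα : Summable (alpha D b)) (hϑ : 0 < ϑ) (hρ : 0 < ρ) :
    (∀ᵐ y ∂gammaMeasure (sigma D b ϑ ρ), Summable fun m => 2 * alpha D b m * |y m|) ∧
      ∫⁻ y, ENNReal.ofReal (Real.exp (∑' m, 2 * alpha D b m * |y m|))
        ∂gammaMeasure (sigma D b ϑ ρ) < ⊤ := by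
  set σ := sigma D b ϑ ρ with hσdef
  have hα0 := alpha_nonneg D b
  have hσ : ∀ m, 0 < σ m := fun m => Real.exp_pos _
  set t : ℕ → ℝ := fun m => 2 * alpha D b m * σ m with ht
  have ht0 : ∀ m, 0 ≤ t m := fun m => mul_nonneg (mul_nonneg two_pos.le (hα0 m)) (hσ m).le
  have hts : Summable t := by
    refine Summable.of_nonneg_of_le ht0 (fun m => ?_)
      (hα.mul_left (2 * Real.exp (ϑ * ρ * ∑' m, alpha D b m)))
    have h1 : σ m ≤ Real.exp (ϑ * ρ * ∑' m, alpha D b m) :=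
      Real.exp_le_exp.2 (mul_le_mul_of_nonneg_left (hα.le_tsum m fun j _ => hα0 j) (by positivity))
    have := mul_le_mul_of_nonneg_left h1 (mul_nonneg two_pos.le (hα0 m))
    simp only [ht]; linarith
  set C : ℝ := 2 * Real.exp ((∑' m, t m + 1) ^ 2 / 2) with hC
  have hC0 : 0 ≤ C := by positivity
  have key := lintegral_exp_tsum_le (P := gammaMeasure σ)
    (h := fun m y => 2 * alpha D b m * |y m|) (C := ENNReal.ofReal (Real.exp (C * ∑' m, t m)))
    (fun m => by fun_prop) (fun m y => mul_nonneg (mul_nonneg two_pos.le (hα0 m)) (abs_nonneg _))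
    ENNReal.ofReal_ne_top fun n => by
      have e : ∀ m (y : ℕ → ℝ), 2 * alpha D b m * |y m| = t m * |y m / σ m| := fun m y => by
        rw [abs_div, abs_of_pos (hσ m)]
        simp only [ht]
        field_simp [(hσ m).ne']
      simp only [e]
      rw [lintegral_prod_std hσ (Finset.range n)
        (g := fun m x => ENNReal.ofReal (Real.exp (t m * |x|))) (fun m => by fun_prop)]
      refine (Finset.prod_le_prod' fun m _ => lintegral_exp_mul_abs_le (ht0 m)
        (hts.le_tsum m fun j _ => ht0 j)).trans ?_
      rw [← ENNReal.ofReal_prod_of_nonneg fun _ _ => (Real.exp_pos _).le, ← Real.exp_sum,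
        ← Finset.sum_mul, mul_comm C]
      exact ENNReal.ofReal_le_ofReal (Real.exp_le_exp.2
        (mul_le_mul_of_nonneg_right (hts.sum_le_tsum _ fun m _ => ht0 m) hC0))
  exact ⟨key.1, key.2.trans_lt ENNReal.ofReal_lt_top⟩

/-- A lower bound uniform in `x`; through it the weighted energy in `MemV` controls the norm of `v
y`. -/
theorem exp_neg_le_coeffA {x : E d} {y : ℕ → ℝ} (hx : ∀ l, |b l x| ≤ alpha D b l)
    (hy : Summable fun m => 2 * alpha D b m * |y m|) :
    Real.exp (-((∑' m, 2 * alpha D b m * |y m|) / 2)) ≤ coeffA b x y := by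
  refine Real.exp_le_exp.2 ?_
  rw [← tsum_div_const, ← tsum_neg]
  have hle : ∀ l, |b l x * y l| ≤ 2 * alpha D b l * |y l| / 2 := fun l => by
    rw [abs_mul]
    have := mul_le_mul_of_nonneg_right (hx l) (abs_nonneg (y l))
    linarith
  exact (hy.div_const 2).neg.tsum_le_tsum (fun l => (abs_le.1 (hle l)).1)
    (Summable.of_norm_bounded (hy.div_const 2) hle)

theorem ofReal_normX_sq (u : H10 D) :
    ENNReal.ofReal (normX u ^ 2) = ∫⁻ x in D, ENNReal.ofReal (‖grad u x‖ ^ 2) := by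
  rw [normX, norm_sq_eq_integral, ofReal_integral_eq_lintegral_ofReal]
  · exact (Lp.memLp (grad u)).norm.integrable_sq
  · exact Eventually.of_forall fun _ => sq_nonneg _

theorem sigma_pos (D : Set (E d)) (b : ℕ → E d → ℝ) (ϑ ρ : ℝ) (m : ℕ) : 0 < sigma D b ϑ ρ m :=
  Real.exp_pos _

theorem gammaMeasure_sigma (hα : Summable (alpha D b)) (hϑ : 0 < ϑ) (hρ : 0 < ρ) :
    gammaMeasure (sigma D b ϑ ρ) =
      gammaStd.withDensity fun y => ENNReal.ofReal (zeta (sigma D b ϑ ρ) y) :=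
  gammaMeasure_eq_withDensity (fun m => mul_nonneg (by positivity) (alpha_nonneg D b m))
    (hα.mul_left _)

theorem ae_zeta_sigma (hα : Summable (alpha D b)) (hϑ : 0 < ϑ) (hρ : 0 < ρ) :
    ∀ᵐ y ∂gammaStd, 0 < zeta (sigma D b ϑ ρ) y :=
  (ae_zeta (fun m => mul_nonneg (by positivity) (alpha_nonneg D b m))
    (hα.mul_left (ϑ * ρ))).1.mono fun _ h => h.2

/-- The products of functions in `𝒱_{ϑρ}` with Hermite polynomials are integrable. -/
theorem integrable_hermiteT_smul (hd : 0 < d) {R : ℝ} (hR0 : 0 ≤ R)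
    (hR : D ⊆ Metric.closedBall 0 R) (hb : ∀ l, MemLp (b l) ⊤ (volume.restrict D))
    (hα : Summable (alpha D b)) (hϑ : 0 < ϑ) (hρ : 0 < ρ) {v : (ℕ → ℝ) → H10 D}
    (hv : MemV D b ϑ ρ v) (μ : ℕ →₀ ℕ) :
    Integrable (fun y => hermiteT (sigma D b ϑ ρ) μ y • v y)
      (gammaMeasure (sigma D b ϑ ρ)) := by
  set σ := sigma D b ϑ ρ with hσdef
  have hac : gammaMeasure σ ≪ gammaStd := by
    rw [gammaMeasure_sigma hα hϑ hρ]; exact withDensity_absolutelyContinuous _ _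
  refine ⟨(measurable_hermiteT σ μ).aestronglyMeasurable.smul (hv.1.mono_ac hac), ?_⟩
  obtain ⟨hsum, hexp⟩ := lintegral_exp_alpha hα hϑ hρ
  set S : (ℕ → ℝ) → ℝ := fun y => (∑' m, 2 * alpha D b m * |y m|) / 2 with hS
  have hSm : Measurable S := by
    simp only [hS]; exact (Measurable.tsum fun m => by fun_prop).div_const 2
  set C := max (2 * R) 1 with hC
  -- With `H = |hermiteT σ μ y|` and `n = normX (v y)`, Young's inequality is used twice: `H n ≤ H²
  -- e^S + e^{-S} n²` and `H² e^S ≤ H⁴ + e^{2S}`. The three terms are integrable by Hermite moments,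
  -- exponential moments and `MemV`.
  have hpt : ∀ᵐ y ∂gammaMeasure σ, ‖hermiteT σ μ y • v y‖ₑ ≤ ENNReal.ofReal C *
      ((ENNReal.ofReal (|hermiteT σ μ y| ^ 4) + ENNReal.ofReal (Real.exp (2 * S y))) +
        ∫⁻ x in D, ENNReal.ofReal (coeffA b x y * ‖grad (v y) x‖ ^ 2)) := by
    filter_upwards [hsum] with y hy
    have h1 : ENNReal.ofReal (Real.exp (-(S y)) * normX (v y) ^ 2) ≤
        ∫⁻ x in D, ENNReal.ofReal (coeffA b x y * ‖grad (v y) x‖ ^ 2) := by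
      rw [ENNReal.ofReal_mul (Real.exp_pos _).le, ofReal_normX_sq,
        ← lintegral_const_mul' _ _ ENNReal.ofReal_ne_top]
      refine lintegral_mono_ae ?_
      filter_upwards [ae_abs_le_alpha hb] with x hx
      rw [← ENNReal.ofReal_mul (Real.exp_pos _).le]
      exact ENNReal.ofReal_le_ofReal
        (mul_le_mul_of_nonneg_right (exp_neg_le_coeffA hx hy) (sq_nonneg _))
    refine le_trans ?_ (mul_le_mul_right (add_le_add_right h1 _) _)
    rw [← ENNReal.ofReal_add (by positivity) (by positivity),
      ← ENNReal.ofReal_add (by positivity) (by positivity),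
      ← ENNReal.ofReal_mul (by positivity), ← ofReal_norm]
    refine ENNReal.ofReal_le_ofReal ?_
    rw [norm_smul, Real.norm_eq_abs]
    have h2 := norm_le_normX hd hR0 hR (v y)
    have h3 : 0 ≤ normX (v y) := norm_nonneg _
    have h4 := mul_le_mul_of_nonneg_left h2 (abs_nonneg (hermiteT σ μ y))
    refine h4.trans ?_
    rw [show |hermiteT σ μ y| * (C * normX (v y)) = C * (|hermiteT σ μ y| * normX (v y)) by ring]
    refine mul_le_mul_of_nonneg_left ?_ (by positivity)
    set H := |hermiteT σ μ y|
    set n := normX (v y)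
    have e1 : Real.exp (2 * S y) = Real.exp (S y) ^ 2 := by rw [← Real.exp_nat_mul]; norm_num
    have e2 : Real.exp (-(S y)) = (Real.exp (S y))⁻¹ := Real.exp_neg _
    rw [e1, e2]
    have he := Real.exp_pos (S y)
    set e := Real.exp (S y)
    have h5 : H * n ≤ H ^ 2 * e + e⁻¹ * n ^ 2 := by
      have h6 : 0 ≤ e⁻¹ * (H * e - n) ^ 2 := by positivity
      have h7 : e⁻¹ * (H * e - n) ^ 2 = H ^ 2 * e - 2 * (H * n) + e⁻¹ * n ^ 2 := by
        field_simp
        ring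
      have h8 : 0 ≤ H * n := mul_nonneg (abs_nonneg _) h3
      linarith
    nlinarith [sq_nonneg (H ^ 2 - e)]
  refine (lintegral_mono_ae hpt).trans_lt ?_
  rw [lintegral_const_mul' _ _ ENNReal.ofReal_ne_top]
  refine ENNReal.mul_lt_top ENNReal.ofReal_lt_top ?_
  have hm1 : Measurable fun y => ENNReal.ofReal (|hermiteT σ μ y| ^ 4) :=
    ((measurable_hermiteT σ μ).abs.pow_const 4).ennreal_ofReal
  have hm2 : Measurable fun y => ENNReal.ofReal (Real.exp (2 * S y)) := by fun_prop
  rw [lintegral_add_left (f := fun y => ENNReal.ofReal (|hermiteT σ μ y| ^ 4) +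
    ENNReal.ofReal (Real.exp (2 * S y))) (hm1.add hm2), lintegral_add_left hm1]
  refine ENNReal.add_lt_top.2 ⟨ENNReal.add_lt_top.2
    ⟨lintegral_hermiteT_pow (sigma_pos D b ϑ ρ) μ 4, ?_⟩, hv.2⟩
  have e : ∀ y, 2 * S y = ∑' m, 2 * alpha D b m * |y m| := fun y => by
    simp only [hS]; ring
  simpa only [e] using hexp

end Parametric

section Residual

open scoped Topology Classical

variable {d : ℕ} {M : Mesh d} {T : Finset (E d)} {σ : ℕ → ℝ} {Λ Δ : Finset (ℕ →₀ ℕ)}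
  {a : (ℕ →₀ ℕ) → E d → ℝ} {w : (ℕ → ℝ) → H10 M.domain} {p : ℕ}

/-! ### The residual flux on the elements -/

theorem contDiff_mvPolynomial_eval (q : MvPolynomial (Fin d) ℝ) {n : WithTop ℕ∞} :
    ContDiff ℝ n fun x : E d => MvPolynomial.eval (fun i => x i) q := by
  induction q using MvPolynomial.induction_on with
  | C c => simpa using contDiff_const
  | add p q hp hq => simpa using hp.add hq
  | mul_X p i hp =>
    have hi : ContDiff ℝ n fun x : E d => x i := (EuclideanSpace.proj (𝕜 := ℝ) i).contDiff
    simpa using hp.mul hi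

theorem contDiff_gradient {g : E d → ℝ} (hg : ContDiff ℝ 2 g) : ContDiff ℝ 1 (gradient g) := by
  have h1 : ContDiff ℝ 1 (fderiv ℝ g) := hg.fderiv_right (by norm_num)
  exact (InnerProductSpace.toDual ℝ (E d)).symm.contDiff.comp h1

theorem branch_spec (hu : PiecewiseC1 M u) (hT : T ∈ M.elements) :
    ContDiff ℝ 1 (branch u T) ∧ EqOn u (branch u T) (Mesh.openSimplex T) := by
  have h := hu T hT
  rw [branch, dif_pos h]
  exact h.choose_spec

theorem localPoly_spec {u : H10 M.domain} (hu : u ∈ M.feSpace p) (hT : T ∈ M.elements) :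
    val u =ᵐ[volume.restrict (Mesh.openSimplex T)]
      fun x => MvPolynomial.eval (fun i => x i) (M.localPoly u T) := by
  have h : ∃ q : MvPolynomial (Fin d) ℝ,
      val u =ᵐ[volume.restrict (Mesh.openSimplex T)] fun x => MvPolynomial.eval (fun i => x i) q := by
    obtain ⟨q, -, hq⟩ := hu T hT
    exact ⟨q, hq⟩
  rw [Mesh.localPoly, dif_pos h]
  exact h.choose_spec

theorem contDiff_resOn (ha : ∀ ν ∈ Δ, PiecewiseC1 M (a ν)) (hT : T ∈ M.elements) (η : ℕ →₀ ℕ) :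
    ContDiff ℝ 1 (resOn M σ Λ Δ a w T η) := by
  unfold resOn
  refine ContDiff.sum fun μ _ => ContDiff.sum fun ν hν => ?_
  exact (contDiff_const.mul (branch_spec (ha ν hν) hT).1).smul
    (contDiff_gradient (contDiff_mvPolynomial_eval _))

/-- The weak gradients of finite element functions are the gradients of their local polynomials, so
the weak flux has a `C¹` representative up to the boundary of each element. -/
theorem res_ae_eq_resOn (ha : ∀ ν ∈ Δ, PiecewiseC1 M (a ν))
    (hw : ∀ μ ∈ Λ, hermiteCoeff σ w μ ∈ M.feSpace p) (hT : T ∈ M.elements) (η : ℕ →₀ ℕ) :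
    res M σ Λ Δ a w η =ᵐ[volume.restrict (Mesh.openSimplex T)] resOn M σ Λ Δ a w T η := by
  have h1 : ∀ᵐ x ∂volume.restrict (Mesh.openSimplex T), ∀ μ ∈ Λ,
      grad (hermiteCoeff σ w μ) x = gradient (fun x' : E d =>
        MvPolynomial.eval (fun i => x' i) (M.localPoly (hermiteCoeff σ w μ) T)) x :=
    (eventually_all_finset _).2 fun μ hμ =>
      grad_ae_eq_gradient (domain_isOpen M).measurableSet _ (openSimplex_isOpen T)
        (openSimplex_subset_domain hT) (contDiff_mvPolynomial_eval _) (localPoly_spec (hw μ hμ) hT)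
  filter_upwards [h1, ae_restrict_mem (openSimplex_isOpen T).measurableSet] with x hx hxT
  refine Finset.sum_congr rfl fun μ hμ => Finset.sum_congr rfl fun ν hν => ?_
  rw [hx μ hμ, (branch_spec (ha ν hν) hT).2 hxT]

/-- Orthonormality recovers the coefficients, so those used in `res` are finite element functions.
-/
theorem hermiteCoeff_of_sum (hσ : ∀ m, 0 < σ m) {W : (ℕ →₀ ℕ) → H10 M.domain}
    (hw : ∀ y, w y = ∑ μ ∈ Λ, hermiteT σ μ y • W μ) {μ : ℕ →₀ ℕ} (hμ : μ ∈ Λ) :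
    hermiteCoeff σ w μ = W μ := by
  have e : ∀ y, hermiteT σ μ y • w y =
      ∑ ν ∈ Λ, (hermiteT σ μ y * hermiteT σ ν y) • W ν := fun y => by
    rw [hw, Finset.smul_sum]
    exact Finset.sum_congr rfl fun ν _ => smul_smul _ _ _
  simp only [hermiteCoeff, e]
  rw [integral_finsetSum _ fun ν _ => (integrable_hermiteT_mul hσ μ ν).smul_const _]
  simp only [integral_smul_const, integral_hermiteT_mul hσ]
  simp [hμ]

/-- The flux of the active residual at a fixed parameter. -/
noncomputable def fluxOn (M : Mesh d) (σ : ℕ → ℝ) (Λ Δ : Finset (ℕ →₀ ℕ))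
    (a : (ℕ →₀ ℕ) → E d → ℝ) (w : (ℕ → ℝ) → H10 M.domain) (y : ℕ → ℝ) (T : Finset (E d))
    (x : E d) : E d :=
  ∑ η ∈ Λ, hermiteT σ η y • resOn M σ Λ Δ a w T η x

theorem contDiff_fluxOn (ha : ∀ ν ∈ Δ, PiecewiseC1 M (a ν)) (hT : T ∈ M.elements) (y : ℕ → ℝ) :
    ContDiff ℝ 1 (fluxOn M σ Λ Δ a w y T) :=
  ContDiff.sum fun η _ => (contDiff_resOn ha hT η).const_smul (hermiteT σ η y)

theorem divergence_fluxOn (ha : ∀ ν ∈ Δ, PiecewiseC1 M (a ν)) (hT : T ∈ M.elements) (y : ℕ → ℝ)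
    (x : E d) : divergence (fluxOn M σ Λ Δ a w y T) x =
      ∑ η ∈ Λ, divergence (resOn M σ Λ Δ a w T η) x * hermiteT σ η y := by
  have hdiff : ∀ η, DifferentiableAt ℝ (resOn M σ Λ Δ a w T η) x := fun η =>
    (contDiff_resOn ha hT η).differentiable (by simp) x
  have : HasFDerivAt (fluxOn M σ Λ Δ a w y T)
      (∑ η ∈ Λ, hermiteT σ η y • fderiv ℝ (resOn M σ Λ Δ a w T η) x) x :=
    HasFDerivAt.fun_sum fun η _ => (hdiff η).hasFDerivAt.fun_const_smul _
  simp only [divergence, this.fderiv, _root_.sum_apply, _root_.smul_apply]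
  simp only [Finset.sum_mul]
  rw [Finset.sum_comm]
  refine Finset.sum_congr rfl fun i _ => ?_
  rw [WithLp.ofLp_sum, Finset.sum_apply]
  refine Finset.sum_congr rfl fun η _ => ?_
  rw [PiLp.smul_apply, smul_eq_mul, mul_comm]

theorem memLp_res (ha : ∀ ν ∈ Δ, PiecewiseC1 M (a ν))
    (hw : ∀ μ ∈ Λ, hermiteCoeff σ w μ ∈ M.feSpace p) (η : ℕ →₀ ℕ) :
    MemLp (res M σ Λ Δ a w η) 2 (volume.restrict M.domain) :=
  memLp_piecewise (q := fun T => resOn M σ Λ Δ a w T η)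
    (fun _ hT => (contDiff_resOn ha hT η).continuous) fun _ hT => res_ae_eq_resOn ha hw hT η

/-- The flux functionals of the active residual. -/
theorem exists_fluxL (ha : ∀ ν ∈ Δ, PiecewiseC1 M (a ν))
    (hw : ∀ μ ∈ Λ, hermiteCoeff σ w μ ∈ M.feSpace p) (η : ℕ →₀ ℕ) :
    ∃ l : H10 M.domain →L[ℝ] ℝ, ∀ u,
      l u = ∫ x in M.domain, inner ℝ (res M σ Λ Δ a w η x) (grad u x) := by
  have h := memLp_res ha hw η
  refine ⟨(innerSL ℝ (h.toLp _)).comp (gradL M.domain), fun u => ?_⟩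
  change (inner ℝ (h.toLp _) (grad u) : ℝ) = _
  rw [L2.inner_def]
  refine integral_congr_ae ?_
  filter_upwards [h.coeFn_toLp] with x hx
  rw [hx]

theorem exists_loadL (f : Lp ℝ 2 (volume.restrict M.domain)) :
    ∃ l : H10 M.domain →L[ℝ] ℝ, ∀ u, l u = ∫ x in M.domain, f x * val u x := by
  refine ⟨(innerSL ℝ f).comp (valL M.domain), fun u => ?_⟩
  change (inner ℝ f (val u) : ℝ) = _
  rw [L2.inner_def]
  refine integral_congr_ae (Eventually.of_forall fun x => ?_)
  simp [mul_comm]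

/-- The bound for the active residual at a fixed parameter. -/
theorem activeResidual_bound (hd : 2 ≤ d) {K : ℝ} (hK : 1 ≤ K)
    (hM : ∀ T ∈ M.elements, IsRegularSimplex K T) (ha : ∀ ν ∈ Δ, PiecewiseC1 M (a ν))
    (hw : ∀ μ ∈ Λ, hermiteCoeff σ w μ ∈ M.feSpace p) (f : Lp ℝ 2 (volume.restrict M.domain))
    (y : ℕ → ℝ) (u : H10 M.domain) :
    |activeResidual M σ Λ Δ a f w y (u - clementL M u)| ≤
      detConst d K * √(etaSq M f (fluxOn M σ Λ Δ a w y)) * normX u := by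
  have hQ : ∀ T ∈ M.elements, (fun x => ∑ η ∈ Λ, hermiteT σ η y • res M σ Λ Δ a w η x)
      =ᵐ[volume.restrict (Mesh.openSimplex T)] fluxOn M σ Λ Δ a w y T := fun T hT => by
    have : ∀ᵐ x ∂volume.restrict (Mesh.openSimplex T), ∀ η ∈ Λ,
        res M σ Λ Δ a w η x = resOn M σ Λ Δ a w T η x :=
      (eventually_all_finset _).2 fun η _ => res_ae_eq_resOn ha hw hT η
    filter_upwards [this] with x hx
    exact Finset.sum_congr rfl fun η hη => by rw [hx η hη]
  have h := weak_residual_bound hd hK hM (fun T hT => contDiff_fluxOn ha hT y) hQ f u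
  convert h using 3
  simp only [sum_inner, inner_smul_left, conj_trivial]
  rw [integral_finsetSum]
  · simp only [integral_const_mul]
    rfl
  · intro η _
    refine Integrable.const_mul ?_ _
    have hm := memLp_res ha hw η
    refine (L2.integrable_inner (𝕜 := ℝ) (hm.toLp _) (grad (u - clementL M u))).congr ?_
    filter_upwards [hm.coeFn_toLp] with x hx
    rw [hx]

end Residual

end SGFEM


namespace SGFEM

/-! ### The estimator as a norm over the parameters -/

section Estimator

open scoped Topology Classical

variable {d : ℕ} {M : Mesh d} {T : Finset (E d)} {σ : ℕ → ℝ} {Λ Δ : Finset (ℕ →₀ ℕ)}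
  {a : (ℕ →₀ ℕ) → E d → ℝ} {w : (ℕ → ℝ) → H10 M.domain}
  {f : Lp ℝ 2 (volume.restrict M.domain)}

/-- The contribution of one element to the squared estimator at a fixed parameter. -/
noncomputable def elementEst (M : Mesh d) (σ : ℕ → ℝ) (Λ Δ : Finset (ℕ →₀ ℕ))
    (a : (ℕ →₀ ℕ) → E d → ℝ) (f : Lp ℝ 2 (volume.restrict M.domain))
    (w : (ℕ → ℝ) → H10 M.domain) (T : Finset (E d)) (y : ℕ → ℝ) : ℝ≥0∞ :=
  ∫⁻ x in Mesh.openSimplex T, ENNReal.ofReal ((elementResidual M σ Λ Δ a f w T x y * zeta σ y) ^ 2)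

/-- The contribution of one face to the squared estimator at a fixed parameter. -/
noncomputable def faceEst (M : Mesh d) (σ : ℕ → ℝ) (Λ Δ : Finset (ℕ →₀ ℕ))
    (a : (ℕ →₀ ℕ) → E d → ℝ) (w : (ℕ → ℝ) → H10 M.domain) (F : Finset (E d)) (y : ℕ → ℝ) : ℝ≥0∞ :=
  ∫⁻ x, ENNReal.ofReal ((faceJump M σ Λ Δ a w F x y * zeta σ y) ^ 2) ∂faceMeasure F

theorem measurable_elementEst (ha : ∀ ν ∈ Δ, PiecewiseC1 M (a ν)) (hT : T ∈ M.elements) :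
    Measurable (elementEst M σ Λ Δ a f w T) := by
  unfold elementEst
  refine Measurable.lintegral_prod_right' (f := fun q : (ℕ → ℝ) × E d =>
    ENNReal.ofReal ((elementResidual M σ Λ Δ a f w T q.2 q.1 * zeta σ q.1) ^ 2)) ?_
  refine ((Measurable.mul ?_ ((measurable_zeta σ).comp measurable_fst)).pow_const 2).ennreal_ofReal
  refine ((Lp.stronglyMeasurable f).measurable.comp measurable_snd).add
    (Finset.measurable_sum _ fun η _ => ?_)
  exact ((continuous_divergence (contDiff_resOn ha hT η)).measurable.comp measurable_snd).mul
    ((measurable_hermiteT σ η).comp measurable_fst)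

theorem measurable_faceEst (hd : 1 ≤ d) (ha : ∀ ν ∈ Δ, PiecewiseC1 M (a ν)) {F : Finset (E d)}
    (hF : F ∈ M.interiorFaces) : Measurable (faceEst M σ Λ Δ a w F) := by
  have := isFiniteMeasure_faceMeasure hd hF
  unfold faceEst
  refine Measurable.lintegral_prod_right' (f := fun q : (ℕ → ℝ) × E d =>
    ENNReal.ofReal ((faceJump M σ Λ Δ a w F q.2 q.1 * zeta σ q.1) ^ 2)) ?_
  refine ((Measurable.mul ?_ ((measurable_zeta σ).comp measurable_fst)).pow_const 2).ennreal_ofReal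
  refine Finset.measurable_sum _ fun T hT => Finset.measurable_sum _ fun η _ => ?_
  have hc : Continuous fun x =>
      (inner ℝ (resOn M σ Λ Δ a w T η x) (Mesh.outerNormal T F) : ℝ) :=
    (contDiff_resOn ha (Finset.mem_filter.1 hT).1 η).continuous.inner continuous_const
  exact (hc.measurable.comp measurable_snd).mul ((measurable_hermiteT σ η).comp measurable_fst)

/-- The squared estimator at a fixed parameter. -/
theorem ofReal_etaSq (hd : 1 ≤ d) (ha : ∀ ν ∈ Δ, PiecewiseC1 M (a ν)) (y : ℕ → ℝ) :
    ENNReal.ofReal (zeta σ y ^ 2 * etaSq M f (fluxOn M σ Λ Δ a w y)) =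
      (∑ T ∈ M.elements, ENNReal.ofReal (Mesh.size T ^ 2) * elementEst M σ Λ Δ a f w T y) +
        ∑ F ∈ M.interiorFaces, ENNReal.ofReal (Mesh.size F) * faceEst M σ Λ Δ a w F y := by
  have h1 : ∀ T ∈ M.elements, ENNReal.ofReal (Mesh.size T ^ 2) * elementEst M σ Λ Δ a f w T y =
      ENNReal.ofReal (zeta σ y ^ 2 * (Mesh.size T ^ 2 * ∫ x in convexHull ℝ (T : Set (E d)),
        (f x + divergence (fluxOn M σ Λ Δ a w y T) x) ^ 2)) := fun T hT => by
    have hm : MemLp (fun x => f x + divergence (fluxOn M σ Λ Δ a w y T) x) 2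
        (volume.restrict (convexHull ℝ (T : Set (E d)))) :=
      ((Lp.memLp f).mono_measure (restrict_hull_le hT)).add
        (memLp_convexHull (continuous_divergence (contDiff_fluxOn ha hT y)) T)
    rw [show zeta σ y ^ 2 * (Mesh.size T ^ 2 * ∫ x in convexHull ℝ (T : Set (E d)),
        (f x + divergence (fluxOn M σ Λ Δ a w y T) x) ^ 2) = Mesh.size T ^ 2 *
        ∫ x in convexHull ℝ (T : Set (E d)),
          zeta σ y ^ 2 * (f x + divergence (fluxOn M σ Λ Δ a w y T) x) ^ 2 by
        rw [integral_const_mul]; ring, ENNReal.ofReal_mul (sq_nonneg _),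
      ofReal_integral_eq_lintegral_ofReal (hm.integrable_sq.const_mul _)
        (Eventually.of_forall fun x => by positivity), elementEst,
      Measure.restrict_congr_set (openSimplex_ae_eq T)]
    congr 1
    refine lintegral_congr fun x => ?_
    rw [elementResidual, divergence_fluxOn ha hT, mul_pow, mul_comm]
  have h2 : ∀ F ∈ M.interiorFaces, ENNReal.ofReal (Mesh.size F) * faceEst M σ Λ Δ a w F y =
      ENNReal.ofReal (zeta σ y ^ 2 * (Mesh.size F * ∫ x, (∑ T ∈ M.elements.filter (fun T => F ⊆ T),
        inner ℝ (fluxOn M σ Λ Δ a w y T x) (Mesh.outerNormal T F)) ^ 2 ∂faceMeasure F)) :=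
      fun F hF => by
    have hc : Continuous fun x => ∑ T ∈ M.elements.filter (fun T => F ⊆ T),
        (inner ℝ (fluxOn M σ Λ Δ a w y T x) (Mesh.outerNormal T F) : ℝ) :=
      continuous_finsetSum _ fun T hT =>
        (contDiff_fluxOn ha (Finset.mem_filter.1 hT).1 y).continuous.inner continuous_const
    rw [show zeta σ y ^ 2 * (Mesh.size F * ∫ x, (∑ T ∈ M.elements.filter (fun T => F ⊆ T),
        inner ℝ (fluxOn M σ Λ Δ a w y T x) (Mesh.outerNormal T F)) ^ 2 ∂faceMeasure F) =
        Mesh.size F * ∫ x, zeta σ y ^ 2 * (∑ T ∈ M.elements.filter (fun T => F ⊆ T),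
          inner ℝ (fluxOn M σ Λ Δ a w y T x) (Mesh.outerNormal T F)) ^ 2 ∂faceMeasure F by
        rw [integral_const_mul]; ring, ENNReal.ofReal_mul (size_nonneg F),
      ofReal_integral_eq_lintegral_ofReal ((memLp_face hd hF hc).integrable_sq.const_mul _)
        (Eventually.of_forall fun x => by positivity), faceEst]
    congr 1
    refine lintegral_congr fun x => ?_
    have e : faceJump M σ Λ Δ a w F x y = ∑ T ∈ M.elements.filter (fun T => F ⊆ T),
        inner ℝ (fluxOn M σ Λ Δ a w y T x) (Mesh.outerNormal T F) := by
      rw [faceJump]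
      refine Finset.sum_congr rfl fun T _ => ?_
      rw [fluxOn]
      simp only [sum_inner, real_inner_smul_left, mul_comm]
    rw [e, mul_pow, mul_comm]
  have p1 : ∀ T ∈ M.elements, 0 ≤ zeta σ y ^ 2 * (Mesh.size T ^ 2 *
      ∫ x in convexHull ℝ (T : Set (E d)),
        (f x + divergence (fluxOn M σ Λ Δ a w y T) x) ^ 2) := fun T _ =>
    mul_nonneg (sq_nonneg _) (mul_nonneg (sq_nonneg _) (integral_nonneg fun _ => sq_nonneg _))
  have p2 : ∀ F ∈ M.interiorFaces, 0 ≤ zeta σ y ^ 2 * (Mesh.size F *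
      ∫ x, (∑ T ∈ M.elements.filter (fun T => F ⊆ T),
        inner ℝ (fluxOn M σ Λ Δ a w y T x) (Mesh.outerNormal T F)) ^ 2 ∂faceMeasure F) :=
    fun F _ => mul_nonneg (sq_nonneg _)
      (mul_nonneg (size_nonneg F) (integral_nonneg fun _ => sq_nonneg _))
  rw [Finset.sum_congr rfl h1, Finset.sum_congr rfl h2, ← ENNReal.ofReal_sum_of_nonneg p1,
    ← ENNReal.ofReal_sum_of_nonneg p2, ← ENNReal.ofReal_add (Finset.sum_nonneg p1)
      (Finset.sum_nonneg p2), etaSq, mul_add, Finset.mul_sum, Finset.mul_sum]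

/-- Joint measurability in space and parameter allows the finite sums to be exchanged with the
integral; the squared estimator is then the `γ`-integral of the pointwise one weighted by `ζ²`. -/
theorem estDet_eq (hd : 1 ≤ d) (ha : ∀ ν ∈ Δ, PiecewiseC1 M (a ν)) :
    estDet M σ Λ Δ a f w = (∫⁻ y, ENNReal.ofReal
      (zeta σ y ^ 2 * etaSq M f (fluxOn M σ Λ Δ a w y)) ∂gammaStd) ^ (1 / 2 : ℝ) := by
  simp only [ofReal_etaSq hd ha]
  have m1 : ∀ T ∈ M.elements, Measurable fun y =>
      ENNReal.ofReal (Mesh.size T ^ 2) * elementEst M σ Λ Δ a f w T y := fun T hT =>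
    (measurable_elementEst ha hT).const_mul _
  have m2 : ∀ F ∈ M.interiorFaces, Measurable fun y =>
      ENNReal.ofReal (Mesh.size F) * faceEst M σ Λ Δ a w F y := fun F hF =>
    (measurable_faceEst hd ha hF).const_mul _
  rw [lintegral_add_left (Finset.measurable_sum _ m1), lintegral_finsetSum' _ fun T hT =>
    (m1 T hT).aemeasurable, lintegral_finsetSum' _ fun F hF => (m2 F hF).aemeasurable, estDet]
  congr 2
  · refine Finset.sum_congr rfl fun T hT => ?_
    rw [lintegral_const_mul _ (measurable_elementEst ha hT)]
    rfl
  · refine Finset.sum_congr rfl fun F hF => ?_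
    rw [lintegral_const_mul _ (measurable_faceEst hd ha hF)]
    rfl

theorem measurable_ofReal_etaSq (hd : 1 ≤ d) (ha : ∀ ν ∈ Δ, PiecewiseC1 M (a ν)) :
    Measurable fun y =>
      ENNReal.ofReal (zeta σ y ^ 2 * etaSq M f (fluxOn M σ Λ Δ a w y)) := by
  simp only [ofReal_etaSq hd ha]
  exact (Finset.measurable_sum _ fun T hT => (measurable_elementEst ha hT).const_mul _).add
    (Finset.measurable_sum _ fun F hF => (measurable_faceEst hd ha hF).const_mul _)

theorem etaSq_nonneg (M : Mesh d) (f : E d → ℝ) (q : Finset (E d) → E d → E d) :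
    0 ≤ etaSq M f q :=
  add_nonneg
    (Finset.sum_nonneg fun _ _ => mul_nonneg (sq_nonneg _) (integral_nonneg fun _ => sq_nonneg _))
    (Finset.sum_nonneg fun F _ =>
      mul_nonneg (size_nonneg F) (integral_nonneg fun _ => sq_nonneg _))

end Estimator

/-! ### Truncated Hermite expansions tested with retained modes -/

section Galerkin

variable {H : Type*} [NormedAddCommGroup H] [NormedSpace ℝ H] [CompleteSpace H] {σ : ℕ → ℝ}
  {Λ : Finset (ℕ →₀ ℕ)}

/-- Against Hermite polynomials with index in `Λ`, the truncated Hermite expansion of `C ∘ v` acts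
in the same way as `C ∘ v`. -/
theorem integral_hermiteT_functional (hσ : ∀ m, 0 < σ m) {v : (ℕ → ℝ) → H}
    (hv : ∀ μ, Integrable (fun y => hermiteT σ μ y • v y) (gammaMeasure σ)) (C : H →L[ℝ] H)
    (L : H →L[ℝ] ℝ) {η : ℕ →₀ ℕ} (hη : η ∈ Λ) :
    Integrable (fun y => hermiteT σ η y * L (v y - ∑ μ ∈ Λ, hermiteT σ μ y •
      C (∫ y, hermiteT σ μ y • v y ∂gammaMeasure σ))) (gammaMeasure σ) ∧
    Integrable (fun y => hermiteT σ η y * L (v y - C (v y))) (gammaMeasure σ) ∧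
    ∫ y, hermiteT σ η y * L (v y - ∑ μ ∈ Λ, hermiteT σ μ y •
      C (∫ y, hermiteT σ μ y • v y ∂gammaMeasure σ)) ∂gammaMeasure σ =
      ∫ y, hermiteT σ η y * L (v y - C (v y)) ∂gammaMeasure σ := by
  have hL : ∀ L' : H →L[ℝ] ℝ, Integrable (fun y => hermiteT σ η y * L' (v y)) (gammaMeasure σ) ∧
      ∫ y, hermiteT σ η y * L' (v y) ∂gammaMeasure σ =
        L' (∫ y, hermiteT σ η y • v y ∂gammaMeasure σ) := fun L' => by
    have h1 := L'.integrable_comp (hv η)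
    have h2 := L'.integral_comp_comm (hv η)
    simp only [map_smul, smul_eq_mul] at h1 h2
    exact ⟨h1, h2⟩
  set c : (ℕ →₀ ℕ) → ℝ := fun μ => L (C (∫ y, hermiteT σ μ y • v y ∂gammaMeasure σ)) with hc
  have e1 : ∀ y, hermiteT σ η y * L (v y - ∑ μ ∈ Λ, hermiteT σ μ y •
      C (∫ y, hermiteT σ μ y • v y ∂gammaMeasure σ)) = hermiteT σ η y * L (v y) -
        ∑ μ ∈ Λ, hermiteT σ η y * hermiteT σ μ y * c μ := fun y => by
    rw [map_sub, map_sum, mul_sub, Finset.mul_sum]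
    congr 1
    refine Finset.sum_congr rfl fun μ _ => ?_
    rw [map_smul, smul_eq_mul, mul_assoc]
  have e2 : ∀ y, hermiteT σ η y * L (v y - C (v y)) =
      hermiteT σ η y * L (v y) - hermiteT σ η y * (L.comp C) (v y) := fun y => by
    rw [map_sub, mul_sub]; rfl
  have i1 : ∀ μ ∈ Λ, Integrable (fun y => hermiteT σ η y * hermiteT σ μ y * c μ)
      (gammaMeasure σ) := fun μ _ => (integrable_hermiteT_mul hσ η μ).mul_const _
  simp only [e1, e2]
  -- From the truncated sum only `μ = η` survives and leaves `L` of `C` applied to the coefficient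
  -- of `v`; commuting bounded maps with the integral gives the same value for `C ∘ v`.
  refine ⟨(hL L).1.sub (integrable_finsetSum _ i1), (hL L).1.sub (hL (L.comp C)).1, ?_⟩
  rw [integral_sub (hL L).1 (integrable_finsetSum _ i1), integral_sub (hL L).1 (hL (L.comp C)).1,
    (hL (L.comp C)).2, integral_finsetSum _ i1]
  simp only [integral_mul_const, integral_hermiteT_mul hσ]
  simp [hη, hc]

end Galerkin

end SGFEM


namespace SGFEM

/-! ### The parametric estimate -/

section Main

open scoped Topology Classical

variable {d : ℕ} {M : Mesh d} {D : Set (E d)} {b : ℕ → E d → ℝ} {ϑ ρ : ℝ} {p : ℕ}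
  {Λ Δ : Finset (ℕ →₀ ℕ)} {a : (ℕ →₀ ℕ) → E d → ℝ} {w v : (ℕ → ℝ) → H10 M.domain}
  {f : Lp ℝ 2 (volume.restrict M.domain)}

theorem zero_mem_tensorSet {k : ℕ} {n : ℕ → ℕ} (hn : ∀ m < k, 1 ≤ n m) :
    (0 : ℕ →₀ ℕ) ∈ tensorSet k n := by
  refine Finset.mem_finsupp_iff.2 ⟨by simp, fun m hm => ?_⟩
  have := hn m (Finset.mem_range.1 hm)
  simpa using Nat.lt_of_lt_of_le Nat.zero_lt_one this

/-- The active residual is a finite sum of bounded functionals with Hermite coefficients. -/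
theorem exists_activeResidual_eq_sum (ha : ∀ ν ∈ Δ, PiecewiseC1 M (a ν)) {σ : ℕ → ℝ}
    (hw : ∀ μ ∈ Λ, hermiteCoeff σ w μ ∈ M.feSpace p) (h0 : 0 ∈ Λ)
    (f : Lp ℝ 2 (volume.restrict M.domain)) :
    ∃ l : (ℕ →₀ ℕ) → H10 M.domain →L[ℝ] ℝ, ∀ y u,
      activeResidual M σ Λ Δ a f w y u = ∑ η ∈ Λ, hermiteT σ η y * l η u := by
  obtain ⟨lf, hlf⟩ := exists_loadL f
  choose lq hlq using fun η => exists_fluxL (σ := σ) ha hw η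
  -- The load is constant in `y`, that is, a multiple of the mode of index `0`, which `h0` provides.
  refine ⟨fun η => (if η = 0 then lf else 0) - lq η, fun y u => ?_⟩
  have e : ∀ η, hermiteT σ η y * ((if η = 0 then lf else 0) - lq η) u =
      (if η = 0 then lf u else 0) - hermiteT σ η y * lq η u := fun η => by
    rw [_root_.sub_apply, mul_sub]
    split_ifs with h
    · rw [h, hermiteT_zero, one_mul]
    · simp
  simp only [e, Finset.sum_sub_distrib, Finset.sum_ite_eq', h0, if_true, activeResidual, hlf, hlq]

/-- The reduction to a deterministic problem. The tensor interpolant and the pointwise interpolant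
of `v` differ in general, but not when tested with the modes of the active residual. -/
theorem integral_activeResidual_tensorClement {σ : ℕ → ℝ} (hσ : ∀ m, 0 < σ m)
    (ha : ∀ ν ∈ Δ, PiecewiseC1 M (a ν))
    (hw : ∀ μ ∈ Λ, hermiteCoeff σ w μ ∈ M.feSpace p) (h0 : 0 ∈ Λ)
    (hv : ∀ μ, Integrable (fun y => hermiteT σ μ y • v y) (gammaMeasure σ)) :
    Integrable (fun y => activeResidual M σ Λ Δ a f w y (v y - tensorClement M σ Λ v y))
      (gammaMeasure σ) ∧
    residualPairing M σ Λ Δ a f w (fun y => v y - tensorClement M σ Λ v y) =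
      ∫ y, activeResidual M σ Λ Δ a f w y (v y - clementL M (v y)) ∂gammaMeasure σ := by
  obtain ⟨l, hl⟩ := exists_activeResidual_eq_sum ha hw h0 f
  have key := fun η (hη : η ∈ Λ) => integral_hermiteT_functional hσ hv (clementL M) (l η) hη
  simp only [clementL_apply] at key
  simp only [residualPairing, hl, tensorClement, hermiteCoeff, clementL_apply]
  refine ⟨integrable_finsetSum _ fun η hη => (key η hη).1, ?_⟩
  rw [integral_finsetSum _ fun η hη => (key η hη).1,
    integral_finsetSum _ fun η hη => (key η hη).2.1]
  exact Finset.sum_congr rfl fun η hη => (key η hη).2.2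

theorem continuous_normX : Continuous (normX : H10 D → ℝ) :=
  (gradL D).continuous.norm

/-- A weighted Cauchy–Schwarz inequality for functions that are bounded by a product. -/
theorem ofReal_abs_integral_withDensity_le {α : Type*} [MeasurableSpace α] {μ : Measure α}
    {z g S N : α → ℝ} (hz : Measurable z) (hz0 : ∀ᵐ y ∂μ, 0 < z y)
    (hS : Measurable fun y => ENNReal.ofReal (z y ^ 2 * S y)) (hS0 : ∀ y, 0 ≤ S y)
    (hN : AEMeasurable N μ) (hN0 : ∀ y, 0 ≤ N y) {C : ℝ} (hC : 0 ≤ C)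
    (hg : ∀ y, |g y| ≤ C * √(S y) * N y) :
    ENNReal.ofReal |∫ y, g y ∂μ.withDensity fun y => ENNReal.ofReal (z y)| ≤
      ENNReal.ofReal C * (∫⁻ y, ENNReal.ofReal (z y ^ 2 * S y) ∂μ) ^ (1 / 2 : ℝ) *
        (∫⁻ y, ENNReal.ofReal (N y ^ 2) ∂μ) ^ (1 / 2 : ℝ) := by
  set A : α → ℝ≥0∞ := fun y => ENNReal.ofReal (z y ^ 2 * S y) ^ (1 / 2 : ℝ) with hA
  set B : α → ℝ≥0∞ := fun y => ENNReal.ofReal (N y) with hB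
  have hAm : Measurable A := hS.pow_const _
  have hBm : AEMeasurable B μ := hN.ennreal_ofReal
  calc ENNReal.ofReal |∫ y, g y ∂μ.withDensity fun y => ENNReal.ofReal (z y)|
      ≤ ∫⁻ y, ENNReal.ofReal |g y| ∂μ.withDensity fun y => ENNReal.ofReal (z y) := by
        simp only [← Real.enorm_eq_ofReal_abs]
        exact enorm_integral_le_lintegral_enorm _
    _ = ∫⁻ y, ENNReal.ofReal (z y) * ENNReal.ofReal |g y| ∂μ := by
        rw [lintegral_withDensity_eq_lintegral_mul_non_measurable _
          hz.ennreal_ofReal (Eventually.of_forall fun _ => ENNReal.ofReal_lt_top)]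
        rfl
    -- The whole density goes to the factor with `S`, so that `N` is measured with respect to the
    -- unweighted `μ`.
    _ ≤ ∫⁻ y, ENNReal.ofReal C * (A y * B y) ∂μ := by
        refine lintegral_mono_ae ?_
        filter_upwards [hz0] with y hy
        have eA : A y = ENNReal.ofReal (z y * √(S y)) := by
          simp only [hA]
          rw [ENNReal.ofReal_rpow_of_nonneg (mul_nonneg (sq_nonneg _) (hS0 y)) (by norm_num),
            ← Real.sqrt_eq_rpow, Real.sqrt_mul (sq_nonneg _), Real.sqrt_sq hy.le]
        have eB : B y = ENNReal.ofReal (N y) := rfl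
        rw [eA, eB, ← ENNReal.ofReal_mul hy.le,
          ← ENNReal.ofReal_mul (mul_nonneg hy.le (Real.sqrt_nonneg _)), ← ENNReal.ofReal_mul hC]
        exact ENNReal.ofReal_le_ofReal
          ((mul_le_mul_of_nonneg_left (hg y) hy.le).trans_eq (by ring))
    _ = ENNReal.ofReal C * ∫⁻ y, A y * B y ∂μ :=
        lintegral_const_mul'' _ (hAm.aemeasurable.mul hBm)
    _ ≤ ENNReal.ofReal C * ((∫⁻ y, A y ^ (2 : ℝ) ∂μ) ^ (1 / 2 : ℝ) *
          (∫⁻ y, B y ^ (2 : ℝ) ∂μ) ^ (1 / 2 : ℝ)) := by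
        gcongr
        exact ENNReal.lintegral_mul_le_Lp_mul_Lq _ Real.HolderConjugate.two_two hAm.aemeasurable hBm
    _ = _ := by
        have eA : ∀ y, A y ^ (2 : ℝ) = ENNReal.ofReal (z y ^ 2 * S y) := fun y => by
          simp only [hA]
          rw [← ENNReal.rpow_mul]; norm_num
        have eB : ∀ y, B y ^ (2 : ℝ) = ENNReal.ofReal (N y ^ 2) := fun y => by
          simp only [hB]
          rw [ENNReal.rpow_two, ENNReal.ofReal_pow (hN0 y)]
        simp only [eA, eB, mul_assoc]

/-- The bound at each parameter, integrated with the density `ζ` by weighted Cauchy–Schwarz. It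
holds in `[0, ∞]`, so an infinite estimator or norm needs no separate case. -/
theorem ofReal_residualPairing_le (hd : 2 ≤ d) {K : ℝ} (hK : 1 ≤ K)
    (hM : ∀ T ∈ M.elements, IsRegularSimplex K T)
    (hb : ∀ l, MemLp (b l) ⊤ (volume.restrict M.domain)) (hα : Summable (alpha M.domain b))
    (hϑ : 0 < ϑ) (hρ : 0 < ρ) (ha : ∀ ν ∈ Δ, PiecewiseC1 M (a ν))
    (hw : ∀ μ ∈ Λ, hermiteCoeff (sigma M.domain b ϑ ρ) w μ ∈ M.feSpace p) (h0 : 0 ∈ Λ)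
    (hv : MemV M.domain b ϑ ρ v) {C : ℝ} (hC0 : 0 ≤ C) (hC : detConst d K ≤ C) :
    Integrable (fun y => activeResidual M (sigma M.domain b ϑ ρ) Λ Δ a f w y
      (v y - tensorClement M (sigma M.domain b ϑ ρ) Λ v y))
        (gammaMeasure (sigma M.domain b ϑ ρ)) ∧
    ENNReal.ofReal |residualPairing M (sigma M.domain b ϑ ρ) Λ Δ a f w
      (fun y => v y - tensorClement M (sigma M.domain b ϑ ρ) Λ v y)| ≤
      ENNReal.ofReal C * estDet M (sigma M.domain b ϑ ρ) Λ Δ a f w * normL2X v := by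
  obtain ⟨R, hR0, hR⟩ := (domain_isBounded M).subset_closedBall_lt 0 0
  have hvi := integrable_hermiteT_smul (by omega) hR0.le hR hb hα hϑ hρ hv
  have hγ := gammaMeasure_sigma hα hϑ hρ
  have hζ := ae_zeta_sigma hα hϑ hρ
  obtain ⟨hint, heq⟩ := integral_activeResidual_tensorClement (f := f)
    (sigma_pos M.domain b ϑ ρ) ha hw h0 hvi
  refine ⟨hint, ?_⟩
  rw [heq, hγ, estDet_eq (by omega) ha, normL2X]
  refine ofReal_abs_integral_withDensity_le (measurable_zeta _) hζ
    (measurable_ofReal_etaSq (by omega) ha) (fun y => etaSq_nonneg M f _)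
    (continuous_normX.comp_aestronglyMeasurable hv.1).aemeasurable (fun y => norm_nonneg _) hC0
    fun y => ?_
  refine (activeResidual_bound hd hK hM ha hw f y (v y)).trans ?_
  have hn : 0 ≤ normX (v y) := norm_nonneg _
  exact mul_le_mul_of_nonneg_right (mul_le_mul_of_nonneg_right hC (Real.sqrt_nonneg _)) hn

end Main

end SGFEM

theorem mainTheorem2 (d : ℕ) (hd : 2 ≤ d) (κ : ℝ) :
    ∃ cdet : ℝ, 0 < cdet ∧
      ∀ (𝒯 : SGFEM.Mesh d), 𝒯.ShapeRegular κ →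
      ∀ (b : ℕ → SGFEM.E d → ℝ), (∀ l, MemLp (b l) ⊤ (volume.restrict 𝒯.domain)) →
        Summable (SGFEM.alpha 𝒯.domain b) →
      ∀ (ϑ ρ : ℝ), 0 < ϑ → ϑ < 1 → 0 < ρ →
      ∀ (p : ℕ), 1 ≤ p →
      ∀ (K : ℕ) (n : ℕ → ℕ), (∀ m < K, 1 ≤ n m) →
      ∀ (L : ℕ) (q : ℕ → ℕ) (a : (ℕ →₀ ℕ) → SGFEM.E d → ℝ),
        (∀ ν ∈ SGFEM.tensorSet L q, SGFEM.PiecewiseC1 𝒯 (a ν)) →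
      ∀ (f : Lp ℝ 2 (volume.restrict 𝒯.domain)),
      ∀ w ∈ SGFEM.discreteSpace 𝒯 p (SGFEM.sigma 𝒯.domain b ϑ ρ) (SGFEM.tensorSet K n),
      ∀ (v : (ℕ → ℝ) → SGFEM.H10 𝒯.domain), SGFEM.MemV 𝒯.domain b ϑ ρ v →
        Integrable (fun y =>
            SGFEM.activeResidual 𝒯 (SGFEM.sigma 𝒯.domain b ϑ ρ) (SGFEM.tensorSet K n)
              (SGFEM.tensorSet L q) a f w y
              (v y - SGFEM.tensorClement 𝒯 (SGFEM.sigma 𝒯.domain b ϑ ρ)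
                (SGFEM.tensorSet K n) v y))
            (SGFEM.gammaMeasure (SGFEM.sigma 𝒯.domain b ϑ ρ)) ∧
        ENNReal.ofReal |SGFEM.residualPairing 𝒯 (SGFEM.sigma 𝒯.domain b ϑ ρ)
            (SGFEM.tensorSet K n) (SGFEM.tensorSet L q) a f w
            (fun y => v y - SGFEM.tensorClement 𝒯 (SGFEM.sigma 𝒯.domain b ϑ ρ)
              (SGFEM.tensorSet K n) v y)|
          ≤ ENNReal.ofReal cdet *
            SGFEM.estDet 𝒯 (SGFEM.sigma 𝒯.domain b ϑ ρ) (SGFEM.tensorSet K n)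
              (SGFEM.tensorSet L q) a f w *
            SGFEM.normL2X v := by
  -- Regularity forces `κ ≥ 1` only when the mesh has an element, so `κ` is replaced by `max κ 1`,
  -- which weakens the regularity condition; the outer maximum ensures positivity.
  refine ⟨max (SGFEM.detConst d (max κ 1)) 1, by positivity, ?_⟩
  intro M hreg b hb hα ϑ ρ hϑ _ hρ p _ K n hn L q a ha f w hw v hv
  obtain ⟨W, hW, hwW⟩ := hw
  refine SGFEM.ofReal_residualPairing_le (p := p) hd (le_max_right κ 1) (fun T hT => ?_) hb hα hϑ hρ
    ha (fun μ hμ => ?_) (SGFEM.zero_mem_tensorSet hn) hv (by positivity) (le_max_left _ _)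
  · obtain ⟨x, r, hr, hball, hs⟩ := hreg T hT
    exact ⟨SGFEM.isSimplex_of_mem hT, x, r, hr, hball,
      hs.trans (mul_le_mul_of_nonneg_right (le_max_left _ _) hr.le)⟩
  · rw [SGFEM.hermiteCoeff_of_sum (SGFEM.sigma_pos _ b ϑ ρ) hwW hμ]
    exact hW μ hμ
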